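/- **Setting.** Let $G=(V,E)$ be a finite directed graph and $T>0$ a rational time horizon. Each arc $e$ has a rational transit time $\tau_e\in\mathbb R$ (possibly negative), a transit cost $c_e:[0,T]\to\mathbb R$ and a transit capacity $u_e:[0,T]\to\mathbb R_{\ge0}$. Each node $v$ has a supply/demand rate $b_v:[0,T]\to\mathbb R$, an initial storage $s_v\ge 0$ and a storage capacity $U_v:[0,T]\to\mathbb R_{\ge0}$; storage costs are zero. A function $h$ is called *piecewise analytic* on $[0,T]$ if there are a partition $0=\theta_0<\dots<\theta_m=T$, an $\epsilon>0$ and functions $h_k$, analytic on $(\theta_{k-1}-\epsilon,\theta_k+\epsilon)$, with $h=h_k$ on $[\theta_{k-1},\theta_k)$ for $k=1,\dots,m$. All $c_e,u_e,b_v,U_v$ are piecewise analytic, every $U_v$ is continuous on $[0,T]$, and no flow can arrive before time $0$: $u_e(\theta)=0$ whenever $0\le\theta<T$ and $\theta+\tau_e<0$. For $x\in L_\infty([0,T])^E$ (put $x_e=0$ outside $[0,T)$) let $X_e(\theta)=\int_0^\theta x_e$ for $\theta\ge 0$, $X_e(\theta)=0$ for $\theta<0$, $B_v(\theta)=s_v+\int_0^\theta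 b_v$, and $$Y_v(\theta)=B_v(\theta)-\sum_{e\text{ leaving }v}X_e(\theta)+\sum_{e\text{ entering }v}X_e(\theta-\tau_e).$$ $x$ is *feasible* if $0\le x_e\le u_e$ almost everywhere for every $e$, and $0\le Y_v\le U_v$ on $[0,T]$ for every $v$. It is *optimal* for MCFP if it is feasible and minimizes $\int_0^T\sum_e c_e x_e\,d\theta$ over all feasible flows in $L_\infty([0,T])^E$. A *dual function* is a family $\pi=(\pi_v)_{v\in V}$ of functions on $[0,T]$ of bounded variation, right-continuous, with $\pi_v(T)=0$; put $\pi_v(\theta)=\pi_v(T)=0$ for $\theta>T$ and $\pi_v(\theta)=\pi_v(0)$ for $\theta<0$. (With $\rho_e(\theta)=\min\{0,c_e(\theta)-\pi_v(\theta)+\pi_w(\theta+\tau_e)\}$ for $e=(v,w)$, the pair $(\pi,\rho)$ is then feasible for the dual problem, whose remaining constraints are $\pi_v(\theta)-\pi_w(\theta+\tau_e)+\rho_e(\theta)\le c_e(\theta)$ and $\rho_e(\theta)\le 0$ for $\theta\in[0,T)$.) A monotone increasing $g$ is *strictly increasing at* $\theta\in(0,T)$ if $g(\theta_1)<g(\theta_2)$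 for all $\theta_1<\theta<\theta_2$ in $[0,T]$; at $0$ if $g(0)<g(\theta)$ for all $\theta\in(0,T]$; at $T$ if $g(\theta)<g(T)$ for all $\theta\in[0,T)$. If $\pi_v=\pi_v^+-\pi_v^-$ is the Jordan decomposition into positive and negative variation, $\pi_v$ is strictly increasing (decreasing) at $\theta$ if $\pi_v^+$ (respectively $\pi_v^-$) is strictly increasing at $\theta$. The function $\pi$ is *complementary slack* with $x$ if for all arcs $e=(v,w)$ and nodes $v$: (CS1) $c_e(\theta)-\pi_v(\theta)+\pi_w(\theta+\tau_e)>0$ implies $x_e(\theta)=0$, for $\theta\in[0,T)$; (CS2) $c_e(\theta)-\pi_v(\theta)+\pi_w(\theta+\tau_e)<0$ implies $x_e(\theta)=u_e(\theta)$, for $\theta\in[0,T)$; (CS3) if $\pi_v$ is strictly increasing at $\theta\in[0,T]$, then $Y_v(\theta)=0$; (CS4) if $\pi_v$ is strictly decreasing at $\theta\in[0,T]$, then $Y_v(\theta)=U_v(\theta)$. **Theorem (reduced cost optimality).** Let $x$ be a feasible piecewise analytic flow. Then $x$ is optimal for MCFP if and only if there is a piecewise analytic dual function $\pi$ that is complementary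 slack with $x$. -/

import Mathlib

open MeasureTheory Set

/-- `h` is piecewise analytic on `[0,T]`: for some partition `0 = t₀ < t₁ < ⋯ < tₘ = T` it coincides
on each `[tₖ₋₁, tₖ)` with a function that is real analytic on a neighbourhood of `[tₖ₋₁, tₖ]`. -/
def PiecewiseAnalytic (T : ℝ) (h : ℝ → ℝ) : Prop :=
  ∃ (m : ℕ) (t : Fin (m + 1) → ℝ) (ε : ℝ) (g : Fin m → ℝ → ℝ),
    StrictMono t ∧ t 0 = 0 ∧ t (Fin.last m) = T ∧ 0 < ε ∧
    ∀ k : Fin m,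
      AnalyticOnNhd ℝ (g k) (Ioo (t k.castSucc - ε) (t k.succ + ε)) ∧
      EqOn (g k) h (Ico (t k.castSucc) (t k.succ))

/-- Nearest point of `[0,T]` (for `0 ≤ T`). Used to extend functions on `[0,T]` by their
boundary values. -/
noncomputable def clamp (T θ : ℝ) : ℝ := max 0 (min θ T)

/-- The positive part `f⁺` in the (minimal) Jordan decomposition `f = f⁺ - f⁻` on `[0,T]`. -/
noncomputable def jordanPos (T : ℝ) (f : ℝ → ℝ) (θ : ℝ) : ℝ :=
  (variationOnFromTo f (Icc 0 T) 0 θ + f θ + f 0) / 2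

/-- The negative part `f⁻` in the (minimal) Jordan decomposition `f = f⁺ - f⁻` on `[0,T]`. -/
noncomputable def jordanNeg (T : ℝ) (f : ℝ → ℝ) (θ : ℝ) : ℝ :=
  (variationOnFromTo f (Icc 0 T) 0 θ - f θ + f 0) / 2

/-- A monotone `g` on `[0,T]` is strictly increasing at `θ ∈ [0,T]`: `g θ₁ < g θ₂` whenever
`θ₁ < θ < θ₂`, with the one-sided version at the two endpoints. -/
def MonoStrictIncAt (T : ℝ) (g : ℝ → ℝ) (θ : ℝ) : Prop :=
  (θ ∈ Ioo 0 T → ∀ θ₁ ∈ Icc 0 T, ∀ θ₂ ∈ Icc 0 T, θ₁ < θ → θ < θ₂ → g θ₁ < g θ₂) ∧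
  (θ = 0 → ∀ θ₂ ∈ Ioc 0 T, g 0 < g θ₂) ∧
  (θ = T → ∀ θ₁ ∈ Ico 0 T, g θ₁ < g T)

/-- A function of bounded variation on `[0,T]` is strictly increasing at `θ`. -/
def StrictIncAt (T : ℝ) (f : ℝ → ℝ) (θ : ℝ) : Prop := MonoStrictIncAt T (jordanPos T f) θ

/-- A function of bounded variation on `[0,T]` is strictly decreasing at `θ`. -/
def StrictDecAt (T : ℝ) (f : ℝ → ℝ) (θ : ℝ) : Prop := MonoStrictIncAt T (jordanNeg T f) θ

/-- The data of a minimum cost flow over time problem without storage costs, on the directed graph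
with nodes `V` and arcs `E`. Only the values of the functions on `[0,T]` matter. -/
structure FlowNetwork (V E : Type*) where
  /-- tail of an arc -/
  src : E → V
  /-- head of an arc -/
  tgt : E → V
  /-- time horizon -/
  T : ℝ
  T_pos : 0 < T
  /-- transit times (possibly negative) -/
  τ : E → ℝ
  /-- transit costs -/
  c : E → ℝ → ℝ
  /-- transit capacities -/
  u : E → ℝ → ℝ
  u_nonneg : ∀ e, ∀ θ ∈ Icc 0 T, 0 ≤ u e θ
  /-- supply / demand rates -/
  b : V → ℝ → ℝ
  /-- initial storage -/
  s : V → ℝ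
  s_nonneg : ∀ v, 0 ≤ s v
  /-- storage capacities -/
  U : V → ℝ → ℝ
  U_nonneg : ∀ v, ∀ θ ∈ Icc 0 T, 0 ≤ U v θ

namespace FlowNetwork

variable {V E : Type*} (N : FlowNetwork V E)

/-- Cumulative supply `B_v(θ)`. -/
noncomputable def B (v : V) (θ : ℝ) : ℝ := N.s v + ∫ t in (0 : ℝ)..θ, N.b v t

/-- Amount `X_e(θ)` of flow that has entered the arc `e` up to time `θ`, for every real `θ`
(no flow enters an arc outside `[0,T)`). -/
noncomputable def X (x : E → ℝ → ℝ) (e : E) (θ : ℝ) : ℝ := ∫ t in (0 : ℝ)..(clamp N.T θ), x e t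

/-- Storage `Y_v(θ)` induced by the flow `x` through flow conservation. -/
noncomputable def Y [Fintype E] [DecidableEq V] (x : E → ℝ → ℝ) (v : V) (θ : ℝ) : ℝ :=
  N.B v θ - ∑ e with N.src e = v, N.X x e θ + ∑ e with N.tgt e = v, N.X x e (θ - N.τ e)

/-- `x ∈ L^∞([0,T])^E` satisfies all constraints of the minimum cost flow over time problem. -/
structure Feasible [Fintype E] [DecidableEq V] (x : E → ℝ → ℝ) : Prop where
  memLp : ∀ e, MemLp (x e) ⊤ (volume.restrict (Ico 0 N.T))
  capacity : ∀ e, ∀ᵐ θ ∂(volume.restrict (Ico 0 N.T)), 0 ≤ x e θ ∧ x e θ ≤ N.u e θ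
  storage : ∀ v, ∀ θ ∈ Icc 0 N.T, 0 ≤ N.Y x v θ ∧ N.Y x v θ ≤ N.U v θ

/-- Total transit cost. -/
noncomputable def cost [Fintype E] (x : E → ℝ → ℝ) : ℝ :=
  ∫ θ in (0 : ℝ)..N.T, ∑ e, N.c e θ * x e θ

/-- `x` is an optimal solution of the minimum cost flow over time problem. -/
def Optimal [Fintype E] [DecidableEq V] (x : E → ℝ → ℝ) : Prop :=
  N.Feasible x ∧ ∀ x' : E → ℝ → ℝ, N.Feasible x' → N.cost x ≤ N.cost x'

/-- Reduced cost `c_e(θ) - π_v(θ) + π_w(θ + τ_e)` of `e = (v,w)`; `π_w` is extended beyond `[0,T]`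
by its boundary values. -/
noncomputable def redCost (π : V → ℝ → ℝ) (e : E) (θ : ℝ) : ℝ :=
  N.c e θ - π (N.src e) θ + π (N.tgt e) (clamp N.T (θ + N.τ e))

/-- The dual variable `ρ` associated with `π`. -/
noncomputable def rho (π : V → ℝ → ℝ) (e : E) (θ : ℝ) : ℝ := min 0 (N.redCost π e θ)

/-- `(π, ρ)` satisfies the constraints of the dual problem. -/
structure DualFeasible (π : V → ℝ → ℝ) (ρ : E → ℝ → ℝ) : Prop where
  reduced : ∀ e, ∀ θ ∈ Ico 0 N.T,
    π (N.src e) θ - π (N.tgt e) (clamp N.T (θ + N.τ e)) + ρ e θ ≤ N.c e θ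
  boundedVariation : ∀ v, BoundedVariationOn (π v) (Icc 0 N.T)
  rightCont : ∀ v, ∀ θ ∈ Ico 0 N.T, ContinuousWithinAt (π v) (Ici θ) θ
  terminal : ∀ v, π v N.T = 0
  rho_nonpos : ∀ e, ∀ θ ∈ Ico 0 N.T, ρ e θ ≤ 0

/-- The complementary slackness conditions between a flow `x` and a dual function `π`. -/
structure ComplementarySlack [Fintype E] [DecidableEq V]
    (x : E → ℝ → ℝ) (π : V → ℝ → ℝ) : Prop where
  cs1 : ∀ e, ∀ θ ∈ Ico 0 N.T, 0 < N.redCost π e θ → x e θ = 0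
  cs2 : ∀ e, ∀ θ ∈ Ico 0 N.T, N.redCost π e θ < 0 → x e θ = N.u e θ
  cs3 : ∀ v, ∀ θ ∈ Icc 0 N.T, StrictIncAt N.T (π v) θ → N.Y x v θ = 0
  cs4 : ∀ v, ∀ θ ∈ Icc 0 N.T, StrictDecAt N.T (π v) θ → N.Y x v θ = N.U v θ

end FlowNetwork

/-!
The network is expanded along a time grid, and optimality of a flow is read off from the absence of
negative residual circulations in this finite network.

*Sufficiency.* Let `π` be complementary slack with `x` and let `x'` be feasible. The difference `D` of
the flows induces in each node a storage difference `W` with `W' = (inflow - outflow)` of `D`. By the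
slackness on arcs, the cost of `D` is at least what is left after replacing `c e` by
`π (src e) - π (tgt e)`, that is, `-∑ v, ∫ π v * (W v)'`. Integration by parts over the pieces of `π v`
turns this into `∫ W v dπ v`, which is nonnegative, since by slackness in the nodes `π v` increases only
where `Y v = 0`, hence `W v ≥ 0`, and decreases only where `Y v = U v`, hence `W v ≤ 0`
(`cost_le_of_complementarySlack`).

*Necessity.* Because the horizon and the transit times are rational, they are multiples of a common time
unit, so `[0,T]` has a subdivision into cells that is compatible with all translations by transit times
(`TimeGrid`, `exists_timeGrid`). It is chosen so fine that on each cell the constraints are either tight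
or slack throughout, and that the cost of any residual walk is monotone or antitone. Near each end of
each cell place a short window. The windows, the arcs between them and storage form a finite network
whose residual circulations can be realized by small feasible changes of `x`; as the windows shrink, the
cost of the change tends to the weight of the circulation. If `x` is optimal, there is therefore no
negative residual circulation (`circulation_weight_nonneg`), and so there are node potentials
(`exists_isPotential`). These prescribe the dual function at the ends of the cells. Inside a cell it is
the weight of a lightest walk, a minimum of finitely many analytic functions, which stays between the
prescribed values and is monotone (`exists_interpolated_potential`). Storage arcs make the potentials
monotone in time where the storage constraints are slack, which gives complementary slackness in the
nodes (`exists_signed_monotoneOn_glue`).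
-/

open Filter Topology

/-! ### Interval predicates and finite partitions -/

/-- A hereditary predicate `G s t` on intervals that holds on all short intervals to the right and to
the left of each point of `[a,b]`. -/
structure LocallyHolds (a b : ℝ) (G : ℝ → ℝ → Prop) : Prop where
  mono : ∀ ⦃s t s' t' : ℝ⦄, s ≤ s' → s' < t' → t' ≤ t → G s t → G s' t'
  right : ∀ t ∈ Ico a b, ∀ᶠ s in 𝓝[>] t, G t s
  left : ∀ t ∈ Ioc a b, ∀ᶠ s in 𝓝[<] t, G s t

theorem LocallyHolds.and {a b : ℝ} {G H : ℝ → ℝ → Prop} (hG : LocallyHolds a b G)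
    (hH : LocallyHolds a b H) : LocallyHolds a b (fun s t => G s t ∧ H s t) where
  mono := fun _ _ _ _ h1 h2 h3 h => ⟨hG.mono h1 h2 h3 h.1, hH.mono h1 h2 h3 h.2⟩
  right := fun t ht => (hG.right t ht).and (hH.right t ht)
  left := fun t ht => (hG.left t ht).and (hH.left t ht)

theorem LocallyHolds.forall {ι : Type*} [Finite ι] {a b : ℝ} {G : ι → ℝ → ℝ → Prop}
    (hG : ∀ i, LocallyHolds a b (G i)) : LocallyHolds a b (fun s t => ∀ i, G i s t) where
  mono := fun _ _ _ _ h1 h2 h3 h i => (hG i).mono h1 h2 h3 (h i)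
  right := fun t ht => eventually_all.2 fun i => (hG i).right t ht
  left := fun t ht => eventually_all.2 fun i => (hG i).left t ht

/-- A predicate that holds locally holds on every interval of a suitable finite partition. -/
theorem LocallyHolds.exists_partition {a b : ℝ} (hab : a ≤ b) {G : ℝ → ℝ → Prop}
    (hG : LocallyHolds a b G) :
    ∃ (m : ℕ) (t : ℕ → ℝ), t 0 = a ∧ t m = b ∧ ∀ j < m, t j < t (j + 1) ∧ G (t j) (t (j + 1)) := by
  set S : Set ℝ := {s | s ∈ Icc a b ∧ ∃ (m : ℕ) (t : ℕ → ℝ), t 0 = a ∧ t m = s ∧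
    ∀ j < m, t j < t (j + 1) ∧ G (t j) (t (j + 1))} with hS
  have hext : ∀ s ∈ S, ∀ s', s < s' → s' ≤ b → G s s' → s' ∈ S := by
    rintro s ⟨hs, m, t, h0, hm, ht⟩ s' hss hs' hg
    refine ⟨⟨hs.1.trans hss.le, hs'⟩, m + 1, fun j => if j ≤ m then t j else s', by simp [h0],
      by simp, fun j hj => ?_⟩
    rcases Nat.lt_or_ge j m with h | h
    · simpa [h.le, Nat.succ_le_of_lt h] using ht j h
    · obtain rfl : j = m := by omega
      simpa [hm] using And.intro hss hg
  have ha : a ∈ S := ⟨⟨le_rfl, hab⟩, 0, fun _ => a, rfl, rfl, by simp⟩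
  have hbdd : BddAbove S := ⟨b, fun s hs => hs.1.2⟩
  set c := sSup S with hc
  have hac : a ≤ c := le_csSup hbdd ha
  have hcb : c ≤ b := csSup_le ⟨a, ha⟩ fun s hs => hs.1.2
  have hcS : c ∈ S := by
    rcases hac.eq_or_lt with h | h
    · rwa [← h]
    obtain ⟨l, hl, hl'⟩ := (mem_nhdsLT_iff_exists_Ioo_subset).1 (hG.left c ⟨h, hcb⟩)
    obtain ⟨s, hs, hs'⟩ := exists_lt_of_lt_csSup ⟨a, ha⟩ (show l < sSup S from hl)
    rcases (le_csSup hbdd hs).eq_or_lt with h2 | h2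
    · rwa [hc, ← h2]
    · exact hext s hs c h2 hcb (hl' ⟨hs', h2⟩)
  rcases hcb.eq_or_lt with h | h
  · obtain ⟨_, hm⟩ := hcS
    rwa [h] at hm
  · obtain ⟨r, hr, hr'⟩ := (mem_nhdsGT_iff_exists_Ioo_subset).1 (hG.right c ⟨hac, h⟩)
    obtain ⟨s, hs1, hs2⟩ := exists_between (lt_min h hr)
    have := hext c hcS s hs1 (hs2.le.trans (min_le_left _ _))
      (hr' ⟨hs1, hs2.trans_le (min_le_right _ _)⟩)
    exact absurd (le_csSup hbdd this) (not_le.2 hs1)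

theorem eventually_right_of_nhdsGT {t : ℝ} {P : ℝ → Prop} (h : ∀ᶠ s in 𝓝[>] t, P s) :
    ∀ᶠ b in 𝓝[>] t, ∀ s ∈ Ioc t b, P s := by
  obtain ⟨r, hr, hr'⟩ := (mem_nhdsGT_iff_exists_Ioo_subset).1 h
  filter_upwards [Ioo_mem_nhdsGT hr] with b hb s hs
  exact hr' ⟨hs.1, hs.2.trans_lt hb.2⟩

theorem eventually_left_of_nhdsLT {t : ℝ} {P : ℝ → Prop} (h : ∀ᶠ s in 𝓝[<] t, P s) :
    ∀ᶠ a in 𝓝[<] t, ∀ s ∈ Ico a t, P s := by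
  obtain ⟨r, hr, hr'⟩ := (mem_nhdsLT_iff_exists_Ioo_subset).1 h
  filter_upwards [Ioo_mem_nhdsLT hr] with b hb s hs
  exact hr' ⟨hb.1.trans_le hs.1, hs.2⟩

theorem eventually_right_of_nhdsGE {t : ℝ} {P : ℝ → Prop} (h : ∀ᶠ s in 𝓝[≥] t, P s) :
    ∀ᶠ b in 𝓝[>] t, ∀ s ∈ Icc t b, P s := by
  filter_upwards [eventually_right_of_nhdsGT (h.filter_mono (nhdsWithin_mono _ Ioi_subset_Ici_self))]
    with b hb s hs
  rcases hs.1.eq_or_lt with h1 | h1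
  · exact h1 ▸ h.self_of_nhdsWithin self_mem_Ici
  · exact hb s ⟨h1, hs.2⟩

theorem eventually_right_of_nhds {t : ℝ} {P : ℝ → Prop} (h : ∀ᶠ s in 𝓝 t, P s) :
    ∀ᶠ b in 𝓝[>] t, ∀ s ∈ Icc t b, P s :=
  eventually_right_of_nhdsGE (h.filter_mono nhdsWithin_le_nhds)

theorem eventually_left_of_nhds {t : ℝ} {P : ℝ → Prop} (h : ∀ᶠ s in 𝓝 t, P s) :
    ∀ᶠ a in 𝓝[<] t, ∀ s ∈ Icc a t, P s := by
  filter_upwards [eventually_left_of_nhdsLT (h.filter_mono nhdsWithin_le_nhds)] with b hb s hs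
  rcases hs.2.eq_or_lt with h1 | h1
  · exact h1 ▸ h.self_of_nhds
  · exact hb s ⟨hs.1, h1⟩

/-! ### Signs and monotonicity of analytic germs -/

theorem pos_or_neg_of_ne_zero {a b : ℝ} {f : ℝ → ℝ} (hc : ContinuousOn f (Ioo a b))
    (h0 : ∀ s ∈ Ioo a b, f s ≠ 0) : (∀ s ∈ Ioo a b, 0 < f s) ∨ (∀ s ∈ Ioo a b, f s < 0) := by
  by_contra! h
  obtain ⟨⟨s, hs, h1⟩, r, hr, h2⟩ := h
  obtain ⟨c, hc, hc'⟩ := (isPreconnected_Ioo.image f hc).ordConnected.out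
    (mem_image_of_mem f hs) (mem_image_of_mem f hr) ⟨h1, h2⟩
  exact h0 c hc hc'

/-- The three possible signs of a function on an interval. -/
def ConstSign (a b : ℝ) (f : ℝ → ℝ) : Prop :=
  (∀ s ∈ Ioo a b, f s = 0) ∨ (∀ s ∈ Ioo a b, 0 < f s) ∨ (∀ s ∈ Ioo a b, f s < 0)

theorem AnalyticAt.eventually_constSign_right {f : ℝ → ℝ} {t : ℝ} (hf : AnalyticAt ℝ f t) :
    ∀ᶠ b in 𝓝[>] t, ConstSign t b f := by
  have hcont := eventually_right_of_nhds (hf.eventually_analyticAt)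
  rcases hf.eventually_eq_zero_or_eventually_ne_zero with h | h
  · filter_upwards [eventually_right_of_nhds h] with b hb
    exact .inl fun s hs => hb s (Ioo_subset_Icc_self hs)
  · filter_upwards [hcont, eventually_right_of_nhdsGT (h.filter_mono (nhdsGT_le_nhdsNE t))] with b h1 h2
    exact .inr (pos_or_neg_of_ne_zero
      (fun s hs => (h1 s (Ioo_subset_Icc_self hs)).continuousAt.continuousWithinAt)
      fun s hs => h2 s (Ioo_subset_Ioc_self hs))

theorem AnalyticAt.eventually_constSign_left {f : ℝ → ℝ} {t : ℝ} (hf : AnalyticAt ℝ f t) :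
    ∀ᶠ a in 𝓝[<] t, ConstSign a t f := by
  have hcont := eventually_left_of_nhds (hf.eventually_analyticAt)
  rcases hf.eventually_eq_zero_or_eventually_ne_zero with h | h
  · filter_upwards [eventually_left_of_nhds h] with b hb
    exact .inl fun s hs => hb s (Ioo_subset_Icc_self hs)
  · filter_upwards [hcont, eventually_left_of_nhdsLT (h.filter_mono (nhdsLT_le_nhdsNE t))] with b h1 h2
    exact .inr (pos_or_neg_of_ne_zero
      (fun s hs => (h1 s (Ioo_subset_Icc_self hs)).continuousAt.continuousWithinAt)
      fun s hs => h2 s (Ioo_subset_Ico_self hs))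

theorem monotoneOn_or_antitoneOn_of_constSign {f f' : ℝ → ℝ} {a b : ℝ}
    (hc : ContinuousOn f (Icc a b)) (hd : ∀ s ∈ Ioo a b, HasDerivAt f (f' s) s)
    (hs : ConstSign a b f') : MonotoneOn f (Icc a b) ∨ AntitoneOn f (Icc a b) := by
  have hdiff : DifferentiableOn ℝ f (interior (Icc a b)) := by
    rw [interior_Icc]
    exact fun s hs => (hd s hs).differentiableAt.differentiableWithinAt
  have key : (∀ s ∈ Ioo a b, 0 ≤ f' s) → MonotoneOn f (Icc a b) := fun h =>
    monotoneOn_of_deriv_nonneg (convex_Icc a b) hc hdiff fun s hs => by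
      rw [interior_Icc] at hs; rw [(hd s hs).deriv]; exact h s hs
  have key2 : (∀ s ∈ Ioo a b, f' s ≤ 0) → AntitoneOn f (Icc a b) := fun h =>
    antitoneOn_of_deriv_nonpos (convex_Icc a b) hc hdiff fun s hs => by
      rw [interior_Icc] at hs; rw [(hd s hs).deriv]; exact h s hs
  rcases hs with h | h | h
  exacts [.inl (key fun s hs => (h s hs).ge), .inl (key fun s hs => (h s hs).le),
    .inr (key2 fun s hs => (h s hs).le)]

theorem AnalyticAt.eventually_monotoneOn_right {f : ℝ → ℝ} {t : ℝ} (hf : AnalyticAt ℝ f t) :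
    ∀ᶠ b in 𝓝[>] t, MonotoneOn f (Icc t b) ∨ AntitoneOn f (Icc t b) := by
  filter_upwards [eventually_right_of_nhds hf.eventually_analyticAt,
    hf.deriv.eventually_constSign_right] with b h1 h2
  exact monotoneOn_or_antitoneOn_of_constSign
    (fun s hs => (h1 s hs).continuousAt.continuousWithinAt)
    (fun s hs => (h1 s (Ioo_subset_Icc_self hs)).differentiableAt.hasDerivAt) h2

theorem AnalyticAt.eventually_monotoneOn_left {f : ℝ → ℝ} {t : ℝ} (hf : AnalyticAt ℝ f t) :
    ∀ᶠ a in 𝓝[<] t, MonotoneOn f (Icc a t) ∨ AntitoneOn f (Icc a t) := by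
  filter_upwards [eventually_left_of_nhds hf.eventually_analyticAt,
    hf.deriv.eventually_constSign_left] with b h1 h2
  exact monotoneOn_or_antitoneOn_of_constSign
    (fun s hs => (h1 s hs).continuousAt.continuousWithinAt)
    (fun s hs => (h1 s (Ioo_subset_Icc_self hs)).differentiableAt.hasDerivAt) h2

/-- A function whose derivative has constant sign on an interval vanishes there at most once, unless
it is constant. -/
theorem exists_forall_ne_of_constSign_deriv {f f' : ℝ → ℝ} {a b : ℝ}
    (hd : ∀ s ∈ Ioo a b, HasDerivAt f (f' s) s) (hs : ConstSign a b f') :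
    (∀ s ∈ Ioo a b, f s = 0) ∨ ∃ z, ∀ s ∈ Ioo a b, s ≠ z → f s ≠ 0 := by
  by_contra! h
  obtain ⟨⟨s, hs0, hs1⟩, h⟩ := h
  obtain ⟨z, hz, -, hz0⟩ := h s
  obtain ⟨w, hw, hwz, hw0⟩ := h z
  have hcont : ContinuousOn f (Ioo a b) := fun s hs => (hd s hs).continuousAt.continuousWithinAt
  have rolle : ∀ p ∈ Ioo a b, ∀ q ∈ Ioo a b, p < q → f p = f q → ∃ c ∈ Ioo a b, f' c = 0 := by
    intro p hp q hq hpq hf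
    obtain ⟨c, hc, hc'⟩ := exists_hasDerivAt_eq_zero hpq
      (hcont.mono (Icc_subset_Ioo hp.1 hq.2)) hf
      (fun x hx => hd x ⟨hp.1.trans hx.1, hx.2.trans hq.2⟩)
    exact ⟨c, ⟨hp.1.trans hc.1, hc.2.trans hq.2⟩, hc'⟩
  have : ∃ c ∈ Ioo a b, f' c = 0 := by
    rcases lt_or_gt_of_ne hwz with h | h
    exacts [rolle w hw z hz h (hw0.trans hz0.symm), rolle z hz w hw h (hz0.trans hw0.symm)]
  obtain ⟨c, hc, hc0⟩ := this
  rcases hs with h | h | h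
  · apply hs1
    exact (isOpen_Ioo.is_const_of_deriv_eq_zero isPreconnected_Ioo
      (fun x hx => (hd x hx).differentiableAt.differentiableWithinAt)
      (fun x hx => (hd x hx).deriv.trans (h x hx)) hs0 hz).trans hz0
  · exact (h c hc).ne' hc0
  · exact (h c hc).ne hc0

/-! ### Piecewise analytic functions through their one-sided germs -/

/-- On `[a,b)`, `h` has an analytic germ to the right of every point (which includes the value at the
point) and to the left of every point of `(a,b]` (which excludes the value). -/
structure HasAnalyticGerms (a b : ℝ) (h : ℝ → ℝ) : Prop where
  right : ∀ t ∈ Ico a b, ∃ g, AnalyticAt ℝ g t ∧ h =ᶠ[𝓝[≥] t] g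
  left : ∀ t ∈ Ioc a b, ∃ g, AnalyticAt ℝ g t ∧ h =ᶠ[𝓝[<] t] g

namespace HasAnalyticGerms

variable {a b : ℝ} {f g : ℝ → ℝ}

theorem of_analyticAt (h : ∀ t ∈ Icc a b, AnalyticAt ℝ f t) : HasAnalyticGerms a b f :=
  ⟨fun t ht => ⟨f, h t (Ico_subset_Icc_self ht), .rfl⟩,
    fun t ht => ⟨f, h t (Ioc_subset_Icc_self ht), .rfl⟩⟩

theorem const (c : ℝ) : HasAnalyticGerms a b fun _ => c :=
  of_analyticAt fun _ _ => analyticAt_const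

theorem add (hf : HasAnalyticGerms a b f) (hg : HasAnalyticGerms a b g) :
    HasAnalyticGerms a b (fun s => f s + g s) := by
  refine ⟨fun t ht => ?_, fun t ht => ?_⟩
  · obtain ⟨f', h1, h2⟩ := hf.right t ht
    obtain ⟨g', h3, h4⟩ := hg.right t ht
    exact ⟨_, h1.add h3, h2.add h4⟩
  · obtain ⟨f', h1, h2⟩ := hf.left t ht
    obtain ⟨g', h3, h4⟩ := hg.left t ht
    exact ⟨_, h1.add h3, h2.add h4⟩

theorem sub (hf : HasAnalyticGerms a b f) (hg : HasAnalyticGerms a b g) :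
    HasAnalyticGerms a b (fun s => f s - g s) := by
  refine ⟨fun t ht => ?_, fun t ht => ?_⟩
  · obtain ⟨f', h1, h2⟩ := hf.right t ht
    obtain ⟨g', h3, h4⟩ := hg.right t ht
    exact ⟨_, h1.sub h3, h2.sub h4⟩
  · obtain ⟨f', h1, h2⟩ := hf.left t ht
    obtain ⟨g', h3, h4⟩ := hg.left t ht
    exact ⟨_, h1.sub h3, h2.sub h4⟩

theorem congr (hf : HasAnalyticGerms a b f) (hfg : EqOn f g (Ico a b)) :
    HasAnalyticGerms a b g := by
  refine ⟨fun t ht => ?_, fun t ht => ?_⟩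
  · obtain ⟨f', h1, h2⟩ := hf.right t ht
    refine ⟨f', h1, EventuallyEq.trans ?_ h2⟩
    filter_upwards [Ico_mem_nhdsGE ht.2] with s hs
    exact (hfg ⟨ht.1.trans hs.1, hs.2⟩).symm
  · obtain ⟨f', h1, h2⟩ := hf.left t ht
    refine ⟨f', h1, EventuallyEq.trans ?_ h2⟩
    filter_upwards [Ioo_mem_nhdsLT ht.1] with s hs
    exact (hfg ⟨hs.1.le, hs.2.trans_le ht.2⟩).symm

/-- The minimum is again given by one of the two germs, since their difference has constant sign. -/
theorem min (hf : HasAnalyticGerms a b f) (hg : HasAnalyticGerms a b g) :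
    HasAnalyticGerms a b (fun s => min (f s) (g s)) := by
  refine ⟨fun t ht => ?_, fun t ht => ?_⟩
  · obtain ⟨f', h1, h2⟩ := hf.right t ht
    obtain ⟨g', h3, h4⟩ := hg.right t ht
    have key : (∀ᶠ s in 𝓝[>] t, f' s ≤ g' s) ∨ (∀ᶠ s in 𝓝[>] t, g' s ≤ f' s) := by
      obtain ⟨c, hc, hct⟩ := ((h1.sub h3).eventually_constSign_right.and self_mem_nhdsWithin).exists
      rcases hc with h | h | h
      · left; filter_upwards [Ioo_mem_nhdsGT hct] with s hs using (sub_eq_zero.1 (h s hs)).le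
      · right; filter_upwards [Ioo_mem_nhdsGT hct] with s hs using (sub_pos.1 (h s hs)).le
      · left; filter_upwards [Ioo_mem_nhdsGT hct] with s hs using (sub_neg.1 (h s hs)).le
    have ext : ∀ {p q : ℝ → ℝ}, AnalyticAt ℝ p t → AnalyticAt ℝ q t →
        (∀ᶠ s in 𝓝[>] t, p s ≤ q s) → ∀ᶠ s in 𝓝[≥] t, p s ≤ q s := fun hp hq h => by
      have h0 := le_of_tendsto_of_tendsto (hp.continuousAt.tendsto.mono_left nhdsWithin_le_nhds)
        (hq.continuousAt.tendsto.mono_left nhdsWithin_le_nhds) h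
      rw [← Ioi_insert, nhdsWithin_insert]
      exact eventually_sup.2 ⟨by simpa using h0, h⟩
    rcases key with h | h
    · refine ⟨f', h1, ?_⟩
      filter_upwards [h2, h4, ext h1 h3 h] with s e1 e2 e3
      rw [e1, e2, min_eq_left e3]
    · refine ⟨g', h3, ?_⟩
      filter_upwards [h2, h4, ext h3 h1 h] with s e1 e2 e3
      rw [e1, e2, min_eq_right e3]
  · obtain ⟨f', h1, h2⟩ := hf.left t ht
    obtain ⟨g', h3, h4⟩ := hg.left t ht
    obtain ⟨c, hc, hct⟩ := ((h1.sub h3).eventually_constSign_left.and self_mem_nhdsWithin).exists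
    have key : (∀ᶠ s in 𝓝[<] t, f' s ≤ g' s) ∨ (∀ᶠ s in 𝓝[<] t, g' s ≤ f' s) := by
      rcases hc with h | h | h
      · left; filter_upwards [Ioo_mem_nhdsLT hct] with s hs using (sub_eq_zero.1 (h s hs)).le
      · right; filter_upwards [Ioo_mem_nhdsLT hct] with s hs using (sub_pos.1 (h s hs)).le
      · left; filter_upwards [Ioo_mem_nhdsLT hct] with s hs using (sub_neg.1 (h s hs)).le
    rcases key with h | h
    · refine ⟨f', h1, ?_⟩
      filter_upwards [h2, h4, h] with s e1 e2 e3
      rw [e1, e2, min_eq_left e3]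
    · refine ⟨g', h3, ?_⟩
      filter_upwards [h2, h4, h] with s e1 e2 e3
      rw [e1, e2, min_eq_right e3]

theorem mono (hf : HasAnalyticGerms a b f) {a' b' : ℝ} (ha : a ≤ a') (hb : b' ≤ b) :
    HasAnalyticGerms a' b' f :=
  ⟨fun t ht => hf.right t ⟨ha.trans ht.1, ht.2.trans_le hb⟩,
    fun t ht => hf.left t ⟨ha.trans_lt ht.1, ht.2.trans hb⟩⟩

theorem comp_add (hf : HasAnalyticGerms a b f) (c : ℝ) :
    HasAnalyticGerms (a - c) (b - c) (fun s => f (c + s)) := by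
  have hc : ∀ t, ContinuousAt (fun s : ℝ => c + s) t := fun t => by fun_prop
  refine ⟨fun t ht => ?_, fun t ht => ?_⟩
  · obtain ⟨g, h1, h2⟩ := hf.right (c + t) ⟨by linarith [ht.1], by linarith [ht.2]⟩
    refine ⟨fun s => g (c + s), h1.comp_of_eq (by fun_prop) rfl, ?_⟩
    refine ((hc t).continuousWithinAt.tendsto_nhdsWithin (fun s hs => ?_)).eventually h2
    exact add_le_add_right (mem_Ici.1 hs) c
  · obtain ⟨g, h1, h2⟩ := hf.left (c + t) ⟨by linarith [ht.1], by linarith [ht.2]⟩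
    refine ⟨fun s => g (c + s), h1.comp_of_eq (by fun_prop) rfl, ?_⟩
    refine ((hc t).continuousWithinAt.tendsto_nhdsWithin (fun s hs => ?_)).eventually h2
    exact add_lt_add_right (mem_Iio.1 hs) c

theorem continuousWithinAt (hf : HasAnalyticGerms a b f) {t : ℝ} (ht : t ∈ Ico a b) :
    ContinuousWithinAt f (Ici t) t := by
  obtain ⟨g, h1, h2⟩ := hf.right t ht
  exact h1.continuousAt.continuousWithinAt.congr_of_eventuallyEq h2
    (h2.self_of_nhdsWithin self_mem_Ici)

/-- Being equal, on the half-open interval, to a function that is analytic near the closed one. -/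
def _root_.AnalyticPiece (h : ℝ → ℝ) (s t : ℝ) : Prop :=
  ∃ ε > 0, ∃ g, AnalyticOnNhd ℝ g (Ioo (s - ε) (t + ε)) ∧ EqOn g h (Ico s t)

theorem locallyHolds_analyticPiece (hf : HasAnalyticGerms a b f) :
    LocallyHolds a b (AnalyticPiece f) where
  mono := by
    rintro s t s' t' h1 h2 h3 ⟨ε, hε, g, hg, hgf⟩
    exact ⟨ε, hε, g, hg.mono (Ioo_subset_Ioo (by linarith) (by linarith)),
      hgf.mono (Ico_subset_Ico h1 h3)⟩
  right := fun t ht => by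
    obtain ⟨g, h1, h2⟩ := hf.right t ht
    obtain ⟨δ, hδ, hg⟩ := Metric.eventually_nhds_iff.1 h1.eventually_analyticAt
    filter_upwards [eventually_right_of_nhdsGE h2, Ioo_mem_nhdsGT (show t < t + δ / 2 by linarith)]
      with c hc hct
    refine ⟨δ / 2, by linarith, g, fun s hs => hg ?_, fun s hs => (hc s (Ico_subset_Icc_self hs)).symm⟩
    rw [Real.dist_eq, abs_lt]
    constructor <;> linarith [hs.1, hs.2, hct.1, hct.2]
  left := fun t ht => by
    obtain ⟨g, h1, h2⟩ := hf.left t ht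
    obtain ⟨δ, hδ, hg⟩ := Metric.eventually_nhds_iff.1 h1.eventually_analyticAt
    filter_upwards [eventually_left_of_nhdsLT h2, Ioo_mem_nhdsLT (show t - δ / 2 < t by linarith)]
      with c hc hct
    refine ⟨δ / 2, by linarith, g, fun s hs => hg ?_, fun s hs => (hc s hs).symm⟩
    rw [Real.dist_eq, abs_lt]
    constructor <;> linarith [hs.1, hs.2, hct.1, hct.2]

theorem piecewiseAnalytic {T : ℝ} (hT : 0 ≤ T) (hf : HasAnalyticGerms 0 T f) :
    PiecewiseAnalytic T f := by
  obtain ⟨m, t, h0, hm, ht⟩ := hf.locallyHolds_analyticPiece.exists_partition hT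
  choose! ε hε g hg hgf using fun j hj => (ht j hj).2
  obtain ⟨δ, hδ, hδ0⟩ : ∃ δ, (∀ j : Fin m, δ ≤ ε j) ∧ 0 < δ := by
    have h1 : ∀ j : Fin m, ∀ᶠ δ in 𝓝[>] (0 : ℝ), δ ≤ ε j := fun j => by
      filter_upwards [Ioc_mem_nhdsGT (hε j j.2)] with _ h using h.2
    exact ((eventually_all.2 h1).and self_mem_nhdsWithin).exists
  refine ⟨m, fun j => t j, δ, fun j => g j, Fin.strictMono_iff_lt_succ.2 fun j => ?_, by simpa using h0,
    by simpa using hm, hδ0, fun k => ⟨?_, ?_⟩⟩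
  · simpa using (ht j j.2).1
  · exact (hg k k.2).mono (Ioo_subset_Ioo (sub_le_sub_left (hδ k) _) (add_le_add_right (hδ k) _))
  · simpa using hgf k k.2

end HasAnalyticGerms

theorem PiecewiseAnalytic.hasAnalyticGerms {T : ℝ} {h : ℝ → ℝ} (hh : PiecewiseAnalytic T h) :
    HasAnalyticGerms 0 T h := by
  obtain ⟨m, t, ε, g, hmono, h0, hm, hε, hg⟩ := hh
  refine ⟨fun s hs => ?_, fun s hs => ?_⟩
  · obtain ⟨k, hk1, hk2⟩ : ∃ k : Fin m, t k.castSucc ≤ s ∧ s < t k.succ := by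
      by_contra! hcon
      have : ∀ k : Fin (m + 1), t k ≤ s := fun k => by
        induction k using Fin.induction with
        | zero => exact h0 ▸ hs.1
        | succ i ih => exact hcon i ih
      exact absurd hs.2 (not_lt.2 (hm ▸ this _))
    refine ⟨g k, (hg k).1 s ⟨by linarith, by linarith⟩, ?_⟩
    filter_upwards [Ico_mem_nhdsGE hk2] with r hr
    exact ((hg k).2 ⟨hk1.trans hr.1, hr.2⟩).symm
  · obtain ⟨k, hk1, hk2⟩ : ∃ k : Fin m, t k.castSucc < s ∧ s ≤ t k.succ := by
      by_contra! hcon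
      have : ∀ k : Fin (m + 1), t k < s := fun k => by
        induction k using Fin.induction with
        | zero => exact h0 ▸ hs.1
        | succ i ih => exact hcon i ih
      exact absurd hs.2 (not_le.2 (hm ▸ this _))
    refine ⟨g k, (hg k).1 s ⟨by linarith, by linarith⟩, ?_⟩
    filter_upwards [Ioo_mem_nhdsLT hk1] with r hr
    exact ((hg k).2 ⟨hr.1.le, hr.2.trans_le hk2⟩).symm

namespace HasAnalyticGerms

variable {a b : ℝ} {f : ℝ → ℝ}

theorem intervalIntegrable (hab : a ≤ b) (hf : HasAnalyticGerms a b f) :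
    IntervalIntegrable f volume a b := by
  obtain ⟨m, t, h0, hm, ht⟩ := hf.locallyHolds_analyticPiece.exists_partition hab
  rw [← h0, ← hm]
  refine IntervalIntegrable.trans_iterate fun j hj => ?_
  obtain ⟨hlt, ε, hε, g, hg, hgf⟩ := ht j hj
  have hgi : IntervalIntegrable g volume (t j) (t (j + 1)) :=
    ContinuousOn.intervalIntegrable_of_Icc hlt.le fun s hs =>
      (hg s ⟨by linarith [hs.1], by linarith [hs.2]⟩).continuousAt.continuousWithinAt
  rw [intervalIntegrable_iff_integrableOn_Ico_of_le hlt.le] at hgi ⊢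
  exact hgi.congr_fun hgf measurableSet_Ico

theorem boundedVariationOn (hab : a ≤ b) (hf : HasAnalyticGerms a b f) :
    BoundedVariationOn f (Icc a b) := by
  obtain ⟨m, t, h0, hm, ht⟩ := hf.locallyHolds_analyticPiece.exists_partition hab
  have key : ∀ j ≤ m, a ≤ t j ∧ BoundedVariationOn f (Icc a (t j)) := by
    intro j
    induction j with
    | zero =>
      intro _
      rw [h0]
      exact ⟨le_rfl, BoundedVariationOn.of_subsingleton (by simp)⟩
    | succ j ih =>
      intro hj
      obtain ⟨h1, h2⟩ := ih (by omega)
      obtain ⟨hlt, ε, hε, g, hg, hgf⟩ := ht j hj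
      refine ⟨h1.trans hlt.le, ?_⟩
      have hgan : ∀ s ∈ Icc (t j) (t (j + 1)), AnalyticAt ℝ g s := fun s hs =>
        hg s ⟨by linarith [hs.1], by linarith [hs.2]⟩
      have hgbv : BoundedVariationOn g (Icc (t j) (t (j + 1))) := by
        rw [← uIcc_of_le hlt.le]
        refine (ContDiffOn.absolutelyContinuousOnInterval ?_).boundedVariationOn
        rw [uIcc_of_le hlt.le]
        exact fun s hs => (hgan s hs).contDiffAt.contDiffWithinAt
      have hpiece : BoundedVariationOn f (Icc (t j) (t (j + 1))) := by
        have hset1 : Icc (t j) (t (j + 1)) ∩ Iic (t (j + 1)) = Icc (t j) (t (j + 1)) := by grind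
        have hset2 : Icc (t j) (t (j + 1)) ∩ Iio (t (j + 1)) = Ico (t j) (t (j + 1)) := by grind
        have hne : (𝓝[Icc (t j) (t (j + 1)) ∩ Iio (t (j + 1))] (t (j + 1))).NeBot := by
          rw [hset2, nhdsWithin_Ico_eq_nhdsLT hlt]; infer_instance
        have hlim : Tendsto f (𝓝[Icc (t j) (t (j + 1)) ∩ Iio (t (j + 1))] (t (j + 1)))
            (𝓝 (g (t (j + 1)))) := by
          rw [hset2]
          refine (((hgan _ ⟨hlt.le, le_rfl⟩).continuousAt.tendsto).mono_left
            nhdsWithin_le_nhds).congr' ?_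
          filter_upwards [self_mem_nhdsWithin] with s hs using hgf hs
        have := eVariationOn.eVariationOn_on_inter_Iic_eq_Iio_add_edist hne
          (right_mem_Icc.2 hlt.le) hlim
        rw [hset1, hset2] at this
        rw [BoundedVariationOn, this]
        refine ENNReal.add_ne_top.2 ⟨?_, edist_ne_top _ _⟩
        rw [← eVariationOn.congr hgf]
        exact hgbv.mono Ico_subset_Icc_self
      have := eVariationOn.Icc_add_Icc f (s := univ) h1 hlt.le (mem_univ _)
      simp only [univ_inter] at this
      rw [BoundedVariationOn, ← this]
      exact ENNReal.add_ne_top.2 ⟨h2, hpiece⟩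
  simpa [hm] using (key m le_rfl).2

end HasAnalyticGerms

/-! ### Jordan decomposition and strict monotonicity at a point -/

section Jordan

variable {T : ℝ} {f : ℝ → ℝ}

theorem variationOnFromTo_neg (s : Set ℝ) (a b : ℝ) :
    variationOnFromTo (fun t => -f t) s a b = variationOnFromTo f s a b := by
  have : ∀ u : Set ℝ, eVariationOn (fun t => -f t) u = eVariationOn f u := fun u => by
    simp only [eVariationOn, edist_neg_neg]
  simp only [variationOnFromTo, this]

theorem jordanNeg_eq_jordanPos_neg (θ : ℝ) :
    jordanNeg T f θ = jordanPos T (fun t => -f t) θ + f 0 := by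
  simp only [jordanNeg, jordanPos, variationOnFromTo_neg]
  ring

theorem strictDecAt_iff {θ : ℝ} : StrictDecAt T f θ ↔ StrictIncAt T (fun t => -f t) θ := by
  simp only [StrictDecAt, StrictIncAt, MonoStrictIncAt, jordanNeg_eq_jordanPos_neg]
  simp

theorem boundedVariationOn_neg {s : Set ℝ} (hf : BoundedVariationOn f s) :
    BoundedVariationOn (fun t => -f t) s := by
  simpa only [BoundedVariationOn, eVariationOn, edist_neg_neg] using hf

theorem jordanPos_monotoneOn (hf : BoundedVariationOn f (Icc 0 T)) (hT : 0 ≤ T) :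
    MonotoneOn (jordanPos T f) (Icc 0 T) := by
  intro p hp q hq hpq
  have := variationOnFromTo.abs_sub_le_sub_of_le hf.locallyBoundedVariationOn
    (left_mem_Icc.2 hT) hp hq hpq
  have h2 := neg_le_abs (f q - f p)
  simp only [jordanPos]
  linarith

/-- The positive variation increases strictly across any increase of the function. -/
theorem jordanPos_lt (hf : BoundedVariationOn f (Icc 0 T)) {θ₁ p q θ₂ : ℝ}
    (h1 : 0 ≤ θ₁) (h1p : θ₁ ≤ p) (hpq : p < q) (hq2 : q ≤ θ₂) (h2 : θ₂ ≤ T) (hlt : f p < f q) :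
    jordanPos T f θ₁ < jordanPos T f θ₂ := by
  have hT : 0 ≤ T := by linarith
  have hp : p ∈ Icc 0 T := ⟨by linarith, by linarith⟩
  have hq : q ∈ Icc 0 T := ⟨by linarith, by linarith⟩
  have m := jordanPos_monotoneOn hf hT
  have a1 := m ⟨h1, by linarith⟩ hp h1p
  have a2 := m hq ⟨by linarith, h2⟩ hq2
  have a3 := variationOnFromTo.abs_sub_le_sub_of_le hf.locallyBoundedVariationOn
    (left_mem_Icc.2 hT) hp hq hpq.le
  have a4 := abs_nonneg (f q - f p)
  have a5 : jordanPos T f p < jordanPos T f q := by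
    simp only [jordanPos]
    linarith
  linarith

theorem strictIncAt_of_frequently_left (hf : BoundedVariationOn f (Icc 0 T)) {θ : ℝ}
    (hθ : θ ∈ Ioc 0 T) (h : ∃ᶠ p in 𝓝[<] θ, f p < f θ) : StrictIncAt T f θ := by
  have key : ∀ θ₁, 0 ≤ θ₁ → θ₁ < θ → ∀ θ₂, θ ≤ θ₂ → θ₂ ≤ T →
      jordanPos T f θ₁ < jordanPos T f θ₂ := fun θ₁ h0 h1 θ₂ h2 h3 => by
    obtain ⟨p, hp, hp'⟩ := (h.and_eventually (Ioo_mem_nhdsLT h1)).exists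
    exact jordanPos_lt hf h0 hp'.1.le hp'.2 h2 h3 hp
  exact ⟨fun _ θ₁ h1 θ₂ h2 h3 h4 => key θ₁ h1.1 h3 θ₂ h4.le h2.2,
    fun h0 => absurd hθ.1 (by simp [h0]),
    fun hT θ₁ h1 => key θ₁ h1.1 (hT ▸ h1.2) T (hT ▸ le_rfl) le_rfl⟩

theorem strictIncAt_of_frequently_right (hf : BoundedVariationOn f (Icc 0 T)) {θ : ℝ}
    (hθ : θ ∈ Ioo 0 T) (h : ∃ᶠ q in 𝓝[>] θ, f θ < f q) : StrictIncAt T f θ := by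
  refine ⟨fun _ θ₁ h1 θ₂ h2 h3 h4 => ?_, fun h0 => absurd hθ.1 (by simp [h0]),
    fun h0 => absurd hθ.2 (by simp [h0])⟩
  obtain ⟨q, hq, hq'⟩ := (h.and_eventually (Ioo_mem_nhdsGT h4)).exists
  exact jordanPos_lt hf h1.1 h3.le hq'.1 hq'.2.le h2.2 hq

/-- The positive variation is constant where the function is antitone. -/
theorem jordanPos_eq_of_antitoneOn (hf : BoundedVariationOn f (Icc 0 T)) {θ₁ θ₂ : ℝ} (h1 : 0 ≤ θ₁)
    (h12 : θ₁ ≤ θ₂) (h2 : θ₂ ≤ T) (h : AntitoneOn f (Icc θ₁ θ₂)) :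
    jordanPos T f θ₁ = jordanPos T f θ₂ := by
  have hm1 : θ₁ ∈ Icc 0 T := ⟨h1, h12.trans h2⟩
  have hm2 : θ₂ ∈ Icc 0 T := ⟨h1.trans h12, h2⟩
  have hadd := variationOnFromTo.add hf.locallyBoundedVariationOn
    (left_mem_Icc.2 (h1.trans hm1.2)) hm1 hm2
  have hv : variationOnFromTo f (Icc 0 T) θ₁ θ₂ = f θ₁ - f θ₂ := by
    rw [← variationOnFromTo_neg, variationOnFromTo.eq_of_le _ _ h12,
      show Icc 0 T ∩ Icc θ₁ θ₂ = Icc θ₁ θ₂ ∩ Icc θ₁ θ₂ by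
        rw [inter_self, inter_eq_right]; exact Icc_subset_Icc h1 h2,
      MonotoneOn.eVariationOn_eq (f := fun t => -f t) (fun x hx y hy hxy => neg_le_neg (h hx hy hxy))
        (left_mem_Icc.2 h12) (right_mem_Icc.2 h12), ENNReal.toReal_ofReal]
    · ring
    · linarith [h (left_mem_Icc.2 h12) (right_mem_Icc.2 h12) h12]
  simp only [jordanPos]
  linarith

/-- A function that is antitone near a point of `[0,T]` does not increase strictly there. -/
theorem not_strictIncAt_of_antitoneOn (hT : 0 < T) (hf : BoundedVariationOn f (Icc 0 T)) {θ l r : ℝ}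
    (hθ : θ ∈ Icc 0 T) (hl : l < θ) (hr : θ < r) (h : AntitoneOn f (Icc l r ∩ Icc 0 T)) :
    ¬ StrictIncAt T f θ := by
  rintro ⟨hi, h0, h1⟩
  have key : ∀ θ₁ θ₂, 0 ≤ θ₁ → l ≤ θ₁ → θ₁ ≤ θ₂ → θ₂ ≤ r → θ₂ ≤ T →
      jordanPos T f θ₁ = jordanPos T f θ₂ := fun θ₁ θ₂ a1 a2 a3 a4 a5 =>
    jordanPos_eq_of_antitoneOn hf a1 a3 a5
      (h.mono fun x hx => ⟨⟨a2.trans hx.1, hx.2.trans a4⟩, ⟨a1.trans hx.1, hx.2.trans a5⟩⟩)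
  rcases hθ.1.eq_or_lt with h2 | h2
  · have a1 : 0 < min r T := lt_min (h2 ▸ hr) hT
    exact (h0 h2.symm (min r T) ⟨a1, min_le_right _ _⟩).ne
      (key _ _ le_rfl (h2 ▸ hl.le) a1.le (min_le_left _ _) (min_le_right _ _))
  rcases hθ.2.eq_or_lt with h3 | h3
  · have a1 : max l 0 < T := max_lt (h3 ▸ hl) hT
    exact (h1 h3 (max l 0) ⟨le_max_right _ _, a1⟩).ne
      (key _ _ (le_max_right _ _) (le_max_left _ _) a1.le (h3 ▸ hr.le) le_rfl)
  · have a1 : max l 0 < θ := max_lt hl h2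
    have a2 : θ < min r T := lt_min hr h3
    exact (hi ⟨h2, h3⟩ (max l 0) ⟨le_max_right _ _, a1.le.trans h3.le⟩ (min r T)
      ⟨h2.le.trans a2.le, min_le_right _ _⟩ a1 a2).ne
      (key _ _ (le_max_right _ _) (le_max_left _ _) (a1.trans a2).le (min_le_left _ _)
        (min_le_right _ _))

/-- The mirror image of `not_strictIncAt_of_antitoneOn`. -/
theorem not_strictDecAt_of_monotoneOn (hT : 0 < T) (hf : BoundedVariationOn f (Icc 0 T)) {θ l r : ℝ}
    (hθ : θ ∈ Icc 0 T) (hl : l < θ) (hr : θ < r) (h : MonotoneOn f (Icc l r ∩ Icc 0 T)) :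
    ¬ StrictDecAt T f θ := by
  rw [strictDecAt_iff]
  exact not_strictIncAt_of_antitoneOn hT (boundedVariationOn_neg hf) hθ hl hr
    fun x hx y hy hxy => neg_le_neg (h hx hy hxy)

end Jordan

/-! ### Integration by parts against a piecewise analytic function -/

/-- On a piece where `π` is analytic, `∫ π q - π W` does not increase: its absolutely continuous part
has derivative `-π' W`, and a jump of `π` at the right end point contributes `-(jump) * W`. -/
theorem integral_mul_le_of_analyticPiece {T s s' : ℝ} (h0 : 0 ≤ s) (hss : s < s') (hs' : s' ≤ T)
    {π q : ℝ → ℝ} (hbv : BoundedVariationOn π (Icc 0 T)) (hπ : AnalyticPiece π s s')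
    (hq : IntervalIntegrable q volume 0 T)
    (hinc : ∀ θ ∈ Icc 0 T, StrictIncAt T π θ → 0 ≤ ∫ t in (0 : ℝ)..θ, q t)
    (hdec : ∀ θ ∈ Icc 0 T, StrictDecAt T π θ → ∫ t in (0 : ℝ)..θ, q t ≤ 0) :
    ∫ t in s..s', π t * q t ≤ π s' * (∫ t in (0 : ℝ)..s', q t) - π s * ∫ t in (0 : ℝ)..s, q t := by
  obtain ⟨ε, hε, g, hg, hgπ⟩ := hπ
  set W : ℝ → ℝ := fun θ => ∫ t in (0 : ℝ)..θ, q t with hW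
  have hT : 0 ≤ T := by linarith
  have hgan : ∀ t ∈ Icc s s', AnalyticAt ℝ g t := fun t ht => hg t ⟨by linarith [ht.1], by linarith [ht.2]⟩
  have hgac : AbsolutelyContinuousOnInterval g s s' := by
    refine ContDiffOn.absolutelyContinuousOnInterval ?_
    rw [uIcc_of_le hss.le]
    exact fun t ht => (hgan t ht).contDiffAt.contDiffWithinAt
  have hWac : AbsolutelyContinuousOnInterval W s s' := by
    refine (hq.absolutelyContinuousOnInterval_intervalIntegral left_mem_uIcc).mono ?_
    rw [uIcc_of_le hss.le, uIcc_of_le hT]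
    exact Icc_subset_Icc h0 hs'
  have hparts := hgac.integral_mul_deriv_eq_deriv_mul hWac
  have e1 : ∫ t in s..s', π t * q t = ∫ t in s..s', g t * deriv W t := by
    refine intervalIntegral.integral_congr_ae ?_
    filter_upwards [hq.ae_hasDerivAt_integral, compl_mem_ae_iff.2 (measure_singleton s')]
      with t ht hne htm
    rw [uIoc_of_le hss.le] at htm
    have : t ∈ Ico s s' := ⟨htm.1.le, lt_of_le_of_ne htm.2 hne⟩
    rw [hgπ this, (ht (by rw [uIcc_of_le hT]; exact ⟨h0.trans this.1, htm.2.trans hs'⟩) 0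
      left_mem_uIcc).deriv]
  have hloc : ∀ θ ∈ Ioo s s', π =ᶠ[𝓝 θ] g := fun θ hθ => by
    filter_upwards [Ioo_mem_nhds hθ.1 hθ.2] with t ht using (hgπ ⟨ht.1.le, ht.2⟩).symm
  have e2 : 0 ≤ ∫ t in s..s', deriv g t * W t := by
    rw [intervalIntegral.integral_of_le hss.le, ← integral_Ioc_eq_integral_Ioo.symm]
    refine setIntegral_nonneg measurableSet_Ioo fun θ hθ => ?_
    have hθT : θ ∈ Ioo 0 T := ⟨h0.trans_lt hθ.1, hθ.2.trans_le hs'⟩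
    have hd : HasDerivAt π (deriv g θ) θ :=
      ((hgan θ (Ioo_subset_Icc_self hθ)).differentiableAt.hasDerivAt).congr_of_eventuallyEq (hloc θ hθ)
    have grow : ∀ {p : ℝ → ℝ} {p' : ℝ}, HasDerivAt p p' θ → 0 < p' → ∃ᶠ r in 𝓝[>] θ, p θ < p r := by
      intro p p' hp hp'
      have := hp.hasDerivWithinAt (s := Ioi θ)
      rw [hasDerivWithinAt_iff_tendsto_slope' (by simp)] at this
      refine Eventually.frequently ?_
      filter_upwards [this.eventually (lt_mem_nhds hp'), self_mem_nhdsWithin] with r hr hr2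
      rw [slope_def_field] at hr
      have h3 : 0 < r - θ := sub_pos.2 hr2
      have := (div_pos_iff_of_pos_right h3).1 hr
      linarith
    rcases lt_trichotomy (deriv g θ) 0 with h | h | h
    · refine mul_nonneg_of_nonpos_of_nonpos h.le (hdec θ (Ioo_subset_Icc_self hθT) ?_)
      rw [strictDecAt_iff]
      exact strictIncAt_of_frequently_right (boundedVariationOn_neg hbv) hθT
        (grow hd.neg (neg_pos.2 h))
    · simp [h]
    · exact mul_nonneg h.le (hinc θ (Ioo_subset_Icc_self hθT)
        (strictIncAt_of_frequently_right hbv hθT (grow hd h)))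
  have e3 : g s' * W s' ≤ π s' * W s' := by
    have hs'T : s' ∈ Ioc 0 T := ⟨h0.trans_lt hss, hs'⟩
    have hlim : Tendsto π (𝓝[<] s') (𝓝 (g s')) := by
      refine ((hgan s' ⟨hss.le, le_rfl⟩).continuousAt.tendsto.mono_left nhdsWithin_le_nhds).congr' ?_
      filter_upwards [Ioo_mem_nhdsLT hss] with t ht using hgπ ⟨ht.1.le, ht.2⟩
    rcases lt_trichotomy (g s') (π s') with h | h | h
    · exact mul_le_mul_of_nonneg_right h.le (hinc s' (Ioc_subset_Icc_self hs'T)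
        (strictIncAt_of_frequently_left hbv hs'T (hlim.eventually (gt_mem_nhds h)).frequently))
    · rw [h]
    · refine mul_le_mul_of_nonpos_right h.le (hdec s' (Ioc_subset_Icc_self hs'T) ?_)
      rw [strictDecAt_iff]
      refine strictIncAt_of_frequently_left (boundedVariationOn_neg hbv) hs'T
        (Eventually.frequently ?_)
      filter_upwards [hlim.eventually (lt_mem_nhds h)] with t ht using neg_lt_neg ht
  rw [e1, hparts, hgπ (left_mem_Ico.2 hss)] at *
  linarith

/-- If `W = ∫ q` is nonnegative wherever `π` increases strictly and nonpositive wherever `π` decreases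
strictly, and `π T = 0`, then `∫ π q = -∫ W dπ ≤ 0`. -/
theorem integral_mul_nonpos_of_strictIncAt {T : ℝ} (hT : 0 ≤ T) {π q : ℝ → ℝ}
    (hπ : HasAnalyticGerms 0 T π) (hπT : π T = 0) (hq : IntervalIntegrable q volume 0 T)
    (hπq : IntervalIntegrable (fun t => π t * q t) volume 0 T)
    (hinc : ∀ θ ∈ Icc 0 T, StrictIncAt T π θ → 0 ≤ ∫ t in (0 : ℝ)..θ, q t)
    (hdec : ∀ θ ∈ Icc 0 T, StrictDecAt T π θ → ∫ t in (0 : ℝ)..θ, q t ≤ 0) :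
    ∫ t in (0 : ℝ)..T, π t * q t ≤ 0 := by
  obtain ⟨m, t, h0, hm, ht⟩ := hπ.locallyHolds_analyticPiece.exists_partition hT
  have hbv := hπ.boundedVariationOn hT
  have hmono : ∀ i j, i ≤ j → j ≤ m → t i ≤ t j := by
    intro i j hij
    induction hij with
    | refl => exact fun _ => le_rfl
    | step h ih => exact fun hj => (ih (by omega)).trans (ht _ hj).1.le
  have key : ∀ j ≤ m, ∫ s in (0 : ℝ)..t j, π s * q s ≤ π (t j) * ∫ s in (0 : ℝ)..t j, q s := by
    intro j
    induction j with
    | zero => simp [h0]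
    | succ j ih =>
      intro hj
      have a0 : 0 ≤ t j := h0 ▸ hmono 0 j (by omega) (by omega)
      have a2 : t (j + 1) ≤ T := hm ▸ hmono (j + 1) m hj le_rfl
      have a1 := (ht j hj).1
      have := integral_mul_le_of_analyticPiece a0 a1 a2 hbv (ht j hj).2 hq hinc hdec
      have hadd := intervalIntegral.integral_add_adjacent_intervals (μ := volume)
        (f := fun s => π s * q s) (a := 0) (b := t j) (c := t (j + 1))
        (hπq.mono_set (by rw [uIcc_of_le a0, uIcc_of_le hT]; exact Icc_subset_Icc_right (by linarith)))
        (hπq.mono_set (by rw [uIcc_of_le a1.le, uIcc_of_le hT]; exact Icc_subset_Icc a0 a2))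
      have := ih (by omega)
      linarith
  simpa [hm, hπT] using key m le_rfl

/-! ### Weak duality -/

namespace FlowNetwork

variable {V E : Type*} (N : FlowNetwork V E)

/-- The flow rate extended by zero outside `[0,T)`. -/
noncomputable def extend (x : E → ℝ → ℝ) (e : E) : ℝ → ℝ := (Ico 0 N.T).indicator (x e)

variable {N} {x : E → ℝ → ℝ} {e : E}

theorem extend_of_mem {θ : ℝ} (h : θ ∈ Ico 0 N.T) : N.extend x e θ = x e θ := indicator_of_mem h _

theorem extend_of_notMem {θ : ℝ} (h : θ ∉ Ico 0 N.T) : N.extend x e θ = 0 := indicator_of_notMem h _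

theorem integrableOn_of_memLp (h : MemLp (x e) ⊤ (volume.restrict (Ico 0 N.T))) :
    IntegrableOn (x e) (Ico 0 N.T) :=
  memLp_one_iff_integrable.1 (h.mono_exponent le_top)

theorem memLp_extend (h : MemLp (x e) ⊤ (volume.restrict (Ico 0 N.T))) :
    MemLp (N.extend x e) ⊤ volume := (memLp_indicator_iff_restrict measurableSet_Ico).2 h

theorem integrable_extend (h : IntegrableOn (x e) (Ico 0 N.T)) : Integrable (N.extend x e) :=
  (integrable_indicator_iff measurableSet_Ico).2 h

theorem X_eq_integral_extend (h : IntegrableOn (x e) (Ico 0 N.T)) (θ : ℝ) :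
    N.X x e θ = ∫ t in (0 : ℝ)..θ, N.extend x e t := by
  have hT := N.T_pos
  have hne : ∀ s : ℝ, ∀ᵐ t : ℝ, t ≠ s := fun s => compl_mem_ae_iff.2 (measure_singleton s)
  have hle : ∀ r, 0 ≤ r → r ≤ N.T → ∫ t in (0 : ℝ)..r, x e t = ∫ t in (0 : ℝ)..r, N.extend x e t := by
    intro r h0 hr
    refine intervalIntegral.integral_congr_ae ?_
    filter_upwards [hne r] with t ht htm
    rw [uIoc_of_le h0] at htm
    exact (extend_of_mem ⟨htm.1.le, (lt_of_le_of_ne htm.2 ht).trans_le hr⟩).symm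
  unfold X
  rcases lt_or_ge θ 0 with h1 | h1
  · rw [show clamp N.T θ = 0 from max_eq_left ((min_le_left _ _).trans h1.le),
      intervalIntegral.integral_same, eq_comm]
    refine intervalIntegral.integral_zero_ae ?_
    filter_upwards [hne 0] with t ht htm
    rw [uIoc_of_ge h1.le] at htm
    exact extend_of_notMem fun h => ht (le_antisymm htm.2 h.1)
  rcases le_or_gt θ N.T with h2 | h2
  · rw [show clamp N.T θ = θ by simp [clamp, h1, h2]]
    exact hle θ h1 h2
  · rw [show clamp N.T θ = N.T by simp [clamp, h2.le, hT.le], hle N.T hT.le le_rfl,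
      ← intervalIntegral.integral_add_adjacent_intervals (b := N.T) (c := θ)
        (integrable_extend h).intervalIntegrable (integrable_extend h).intervalIntegrable,
      left_eq_add]
    refine intervalIntegral.integral_zero_ae (Eventually.of_forall fun t htm => ?_)
    rw [uIoc_of_le h2.le] at htm
    exact extend_of_notMem fun h => absurd h.2 (not_lt.2 htm.1.le)

variable [Fintype E] [DecidableEq V]

theorem Feasible.extend_eq_zero_of_early (hx : N.Feasible x)
    (hearly : ∀ e, ∀ θ ∈ Ico 0 N.T, θ + N.τ e < 0 → N.u e θ = 0) (e : E) :
    ∀ᵐ θ, θ + N.τ e < 0 → N.extend x e θ = 0 := by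
  filter_upwards [(ae_restrict_iff' measurableSet_Ico).1 (hx.capacity e)] with θ h1 h2
  by_cases h : θ ∈ Ico 0 N.T
  · rw [extend_of_mem h]
    have := hearly e θ h h2
    linarith [(h1 h).1, (h1 h).2]
  · exact extend_of_notMem h

/-- The amount that has left an arc is the integral of the delayed flow rate, because no flow arrives
before time `0`. -/
theorem Feasible.X_sub_eq_integral (hx : N.Feasible x)
    (hearly : ∀ e, ∀ θ ∈ Ico 0 N.T, θ + N.τ e < 0 → N.u e θ = 0) (e : E) (θ : ℝ) :
    N.X x e (θ - N.τ e) = ∫ t in (0 : ℝ)..θ, N.extend x e (t - N.τ e) := by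
  have hi := integrableOn_of_memLp (hx.memLp e)
  rw [X_eq_integral_extend hi, intervalIntegral.integral_comp_sub_right (N.extend x e) (N.τ e),
    ← intervalIntegral.integral_add_adjacent_intervals (a := 0 - N.τ e) (b := 0) (c := θ - N.τ e)
        (integrable_extend hi).intervalIntegrable (integrable_extend hi).intervalIntegrable,
      right_eq_add]
  refine intervalIntegral.integral_zero_ae ?_
  filter_upwards [hx.extend_eq_zero_of_early hearly e, compl_mem_ae_iff.2 (measure_singleton 0),
    compl_mem_ae_iff.2 (measure_singleton (0 - N.τ e))] with t h1 h2 h3 ht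
  rcases le_total (0 - N.τ e) 0 with h | h
  · rw [uIoc_of_le h] at ht
    exact extend_of_notMem fun h' => h2 (le_antisymm ht.2 h'.1)
  · rw [uIoc_of_ge h] at ht
    have : t ≠ 0 - N.τ e := h3
    exact h1 (by linarith [lt_of_le_of_ne ht.2 this])

theorem Feasible.Y_eq (hx : N.Feasible x)
    (hearly : ∀ e, ∀ θ ∈ Ico 0 N.T, θ + N.τ e < 0 → N.u e θ = 0) (v : V) (θ : ℝ) :
    N.Y x v θ = N.B v θ + ∫ t in (0 : ℝ)..θ, (∑ e with N.tgt e = v, N.extend x e (t - N.τ e)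
      - ∑ e with N.src e = v, N.extend x e t) := by
  have hi := fun e => integrable_extend (integrableOn_of_memLp (hx.memLp e))
  have hi' := fun e => (hi e).comp_sub_right (N.τ e)
  rw [intervalIntegral.integral_sub, intervalIntegral.integral_finsetSum,
    intervalIntegral.integral_finsetSum]
  · simp only [Y, fun e => hx.X_sub_eq_integral hearly e θ,
      fun e => X_eq_integral_extend (integrableOn_of_memLp (hx.memLp e)) θ]
    ring
  · exact fun e _ => (hi e).intervalIntegrable
  · exact fun e _ => (hi' e).intervalIntegrable
  · exact (integrable_finsetSum _ fun e _ => hi' e).intervalIntegrable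
  · exact (integrable_finsetSum _ fun e _ => hi e).intervalIntegrable

theorem cost_eq (hc : ∀ e, PiecewiseAnalytic N.T (N.c e)) (hx : N.Feasible x) :
    N.cost x = ∑ e, ∫ θ in Ico 0 N.T, N.c e θ * x e θ := by
  have hi : ∀ e, IntervalIntegrable (fun θ => N.c e θ * x e θ) volume 0 N.T := fun e => by
    have h1 := (hc e).hasAnalyticGerms.intervalIntegrable N.T_pos.le
    rw [intervalIntegrable_iff_integrableOn_Ico_of_le N.T_pos.le] at h1 ⊢
    exact h1.mul_of_top_left (hx.memLp e)
  unfold cost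
  rw [intervalIntegral.integral_finsetSum fun e _ => hi e]
  refine Finset.sum_congr rfl fun e _ => ?_
  rw [intervalIntegral.integral_of_le N.T_pos.le, integral_Ico_eq_integral_Ioc]

/-- Weak duality: with a complementary slack dual function, every feasible flow costs at least as
much. -/
theorem cost_le_of_complementarySlack (hc : ∀ e, PiecewiseAnalytic N.T (N.c e))
    (hearly : ∀ e, ∀ θ ∈ Ico 0 N.T, θ + N.τ e < 0 → N.u e θ = 0)
    [Fintype V] (hx : N.Feasible x) {π : V → ℝ → ℝ} (hπ : ∀ v, HasAnalyticGerms 0 N.T (π v))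
    (hπT : ∀ v, π v N.T = 0) (hcs : N.ComplementarySlack x π) {x' : E → ℝ → ℝ}
    (hx' : N.Feasible x') : N.cost x ≤ N.cost x' := by
  have hT := N.T_pos
  set D : E → ℝ → ℝ := fun e θ => N.extend x' e θ - N.extend x e θ with hD
  set πI : V → ℝ → ℝ := fun v => (Ico 0 N.T).indicator (π v) with hπI
  have hDm : ∀ e, MemLp (D e) ⊤ volume := fun e =>
    (memLp_extend (hx'.memLp e)).sub (memLp_extend (hx.memLp e))
  have hDms : ∀ e, MemLp (fun s => D e (s - N.τ e)) ⊤ volume := fun e =>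
    (hDm e).comp_measurePreserving (measurePreserving_sub_right volume (N.τ e))
  have hDi : ∀ e, Integrable (D e) := fun e =>
    (integrable_extend (integrableOn_of_memLp (hx'.memLp e))).sub
      (integrable_extend (integrableOn_of_memLp (hx.memLp e)))
  have hDis : ∀ e, Integrable (fun s => D e (s - N.τ e)) := fun e => (hDi e).comp_sub_right (N.τ e)
  have hD0 : ∀ e, ∀ θ ∉ Ico 0 N.T, D e θ = 0 := fun e θ h => by
    simp [hD, extend_of_notMem h]
  have hπi : ∀ v, Integrable (πI v) := fun v => by
    rw [hπI, integrable_indicator_iff measurableSet_Ico,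
      ← intervalIntegrable_iff_integrableOn_Ico_of_le hT.le]
    exact (hπ v).intervalIntegrable hT.le
  have hcD : ∀ e, Integrable (fun θ => N.c e θ * D e θ) := fun e => by
    have h1 := (hc e).hasAnalyticGerms.intervalIntegrable hT.le
    rw [intervalIntegrable_iff_integrableOn_Ico_of_le hT.le] at h1
    refine (((integrable_indicator_iff measurableSet_Ico).2 h1).mul_of_top_left (hDm e)).congr
      (Eventually.of_forall fun θ => ?_)
    by_cases h : θ ∈ Ico 0 N.T
    · simp [h]
    · simp [h, hD0 e θ h]
  have hP : ∀ v e, Integrable (fun θ => πI v θ * D e θ) := fun v e =>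
    (hπi v).mul_of_top_left (hDm e)
  have hQ : ∀ v e, Integrable (fun θ => πI v θ * D e (θ - N.τ e)) := fun v e =>
    (hπi v).mul_of_top_left (hDms e)
  -- the cost difference, with the cost split into the reduced cost and the potentials
  have hcost : N.cost x' - N.cost x = ∑ e, ∫ θ, N.c e θ * D e θ := by
    rw [cost_eq hc hx, cost_eq hc hx', ← Finset.sum_sub_distrib]
    refine Finset.sum_congr rfl fun e _ => ?_
    have h1 := (hc e).hasAnalyticGerms.intervalIntegrable hT.le
    rw [intervalIntegrable_iff_integrableOn_Ico_of_le hT.le] at h1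
    have h2 : IntegrableOn (fun θ => N.c e θ * x e θ) (Ico 0 N.T) := h1.mul_of_top_left (hx.memLp e)
    have h3 : IntegrableOn (fun θ => N.c e θ * x' e θ) (Ico 0 N.T) := h1.mul_of_top_left (hx'.memLp e)
    rw [← integral_sub h3 h2,
      ← setIntegral_eq_integral_of_forall_compl_eq_zero (s := Ico 0 N.T)
        (f := fun θ => N.c e θ * D e θ) fun θ h => by rw [hD0 e θ h, mul_zero]]
    refine setIntegral_congr_fun measurableSet_Ico fun θ h => ?_
    simp only [hD, extend_of_mem h]
    ring
  have hred : ∀ e, (∫ θ, πI (N.src e) θ * D e θ) - ∫ θ, πI (N.tgt e) θ * D e (θ - N.τ e)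
      ≤ ∫ θ, N.c e θ * D e θ := by
    intro e
    have hshift : ∫ θ, πI (N.tgt e) θ * D e (θ - N.τ e)
        = ∫ θ, πI (N.tgt e) (θ + N.τ e) * D e θ := by
      rw [← integral_sub_right_eq_self (fun θ => πI (N.tgt e) (θ + N.τ e) * D e θ) (N.τ e)]
      simp
    have hQ' : Integrable (fun θ => πI (N.tgt e) (θ + N.τ e) * D e θ) := by
      simpa using (hQ (N.tgt e) e).comp_add_right (N.τ e)
    rw [hshift, ← integral_sub (hP _ _) hQ']
    refine integral_mono_ae ((hP _ _).sub hQ') (hcD e) ?_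
    filter_upwards [hx.extend_eq_zero_of_early hearly e, hx'.extend_eq_zero_of_early hearly e,
      (ae_restrict_iff' measurableSet_Ico).1 (hx.capacity e),
      (ae_restrict_iff' measurableSet_Ico).1 (hx'.capacity e)] with θ h1 h2 h3 h4
    by_cases h : θ ∈ Ico 0 N.T
    swap
    · simp [hD0 e θ h]
    rcases lt_or_ge (θ + N.τ e) 0 with h5 | h5
    · simp [hD, h1 h5, h2 h5]
    have h6 : πI (N.tgt e) (θ + N.τ e) = π (N.tgt e) (clamp N.T (θ + N.τ e)) := by
      rcases lt_or_ge (θ + N.τ e) N.T with h7 | h7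
      · simp [hπI, clamp, h5, h7, h7.le]
      · simp [hπI, clamp, h5, h7, hT.le, hπT, not_lt.2 h7]
    have h7 : πI (N.src e) θ = π (N.src e) θ := indicator_of_mem h _
    have h8 : D e θ = x' e θ - x e θ := by simp only [hD, extend_of_mem h]
    have h9 : 0 ≤ N.redCost π e θ * D e θ := by
      rw [h8]
      rcases lt_trichotomy (N.redCost π e θ) 0 with hr | hr | hr
      · refine mul_nonneg_of_nonpos_of_nonpos hr.le ?_
        rw [hcs.cs2 e θ h hr]
        linarith [(h4 h).2]
      · simp [hr]
      · refine mul_nonneg hr.le ?_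
        rw [hcs.cs1 e θ h hr]
        linarith [(h4 h).1]
    simp only [redCost] at h9
    rw [h6, h7]
    nlinarith [h9]
  have hnode : ∀ v, ∑ e with N.tgt e = v, (∫ θ, πI v θ * D e (θ - N.τ e))
      - ∑ e with N.src e = v, ∫ θ, πI v θ * D e θ ≤ 0 := by
    intro v
    set q : ℝ → ℝ := fun t => ∑ e with N.tgt e = v, D e (t - N.τ e) - ∑ e with N.src e = v, D e t
      with hq
    have hqi : Integrable q := (integrable_finsetSum _ fun e _ => hDis e).sub
      (integrable_finsetSum _ fun e _ => hDi e)
    have e1 : ∀ t, πI v t * q t = ∑ e with N.tgt e = v, πI v t * D e (t - N.τ e)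
        - ∑ e with N.src e = v, πI v t * D e t := fun t => by
      simp only [hq, mul_sub, Finset.mul_sum]
    have e2 : ∑ e with N.tgt e = v, (∫ θ, πI v θ * D e (θ - N.τ e))
        - ∑ e with N.src e = v, ∫ θ, πI v θ * D e θ = ∫ θ, πI v θ * q θ := by
      simp only [e1]
      rw [integral_sub (integrable_finsetSum _ fun e _ => hQ v e)
        (integrable_finsetSum _ fun e _ => hP v e),
        integral_finsetSum _ fun e _ => hQ v e, integral_finsetSum _ fun e _ => hP v e]
    have hqI : Integrable (fun θ => πI v θ * q θ) := by
      simp only [e1]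
      exact (integrable_finsetSum _ fun e _ => hQ v e).sub (integrable_finsetSum _ fun e _ => hP v e)
    have hW : ∀ θ, ∫ t in (0 : ℝ)..θ, q t = N.Y x' v θ - N.Y x v θ := by
      intro θ
      have hint : ∀ {z : E → ℝ → ℝ}, N.Feasible z → IntervalIntegrable
          (fun t => ∑ e with N.tgt e = v, N.extend z e (t - N.τ e)
            - ∑ e with N.src e = v, N.extend z e t) volume 0 θ := fun hz =>
        ((integrable_finsetSum _ fun e _ =>
          (integrable_extend (integrableOn_of_memLp (hz.memLp e))).comp_sub_right (N.τ e)).sub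
          (integrable_finsetSum _ fun e _ =>
            integrable_extend (integrableOn_of_memLp (hz.memLp e)))).intervalIntegrable
      rw [hx.Y_eq hearly, hx'.Y_eq hearly, add_sub_add_left_eq_sub,
        ← intervalIntegral.integral_sub (hint hx') (hint hx)]
      refine intervalIntegral.integral_congr fun t _ => ?_
      simp only [hq, hD, Finset.sum_sub_distrib]
      ring
    have e3 : ∫ θ, πI v θ * q θ = ∫ t in (0 : ℝ)..N.T, π v t * q t := by
      rw [intervalIntegral.integral_of_le hT.le, ← integral_Ico_eq_integral_Ioc,
        ← integral_indicator measurableSet_Ico]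
      refine integral_congr_ae (Eventually.of_forall fun t => ?_)
      simp only [hπI]
      exact (indicator_mul_left _ _ _).symm
    rw [e2, e3]
    refine integral_mul_nonpos_of_strictIncAt hT.le (hπ v) (hπT v) hqi.intervalIntegrable ?_ ?_ ?_
    · rw [intervalIntegrable_iff_integrableOn_Ico_of_le hT.le]
      refine hqI.integrableOn.congr_fun (fun t ht => ?_) measurableSet_Ico
      simp [hπI, ht]
    · intro θ hθ h
      rw [hW, hcs.cs3 v θ hθ h]
      linarith [(hx'.storage v θ hθ).1]
    · intro θ hθ h
      rw [hW, hcs.cs4 v θ hθ h]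
      linarith [(hx'.storage v θ hθ).2]
  have hsum1 := Finset.sum_fiberwise Finset.univ N.src fun e => ∫ θ, πI (N.src e) θ * D e θ
  have hsum2 := Finset.sum_fiberwise Finset.univ N.tgt
    fun e => ∫ θ, πI (N.tgt e) θ * D e (θ - N.τ e)
  have hsum3 := Finset.sum_nonpos fun v (_ : v ∈ Finset.univ) => hnode v
  have hsum4 := Finset.sum_le_sum fun e (_ : e ∈ Finset.univ) => hred e
  rw [Finset.sum_sub_distrib] at hsum3 hsum4
  have c1 : ∑ v, ∑ e with N.src e = v, ∫ θ, πI v θ * D e θ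
      = ∑ v, ∑ e with N.src e = v, ∫ θ, πI (N.src e) θ * D e θ :=
    Finset.sum_congr rfl fun v _ => Finset.sum_congr rfl fun e he => by
      rw [(Finset.mem_filter.1 he).2]
  have c2 : ∑ v, ∑ e with N.tgt e = v, ∫ θ, πI v θ * D e (θ - N.τ e)
      = ∑ v, ∑ e with N.tgt e = v, ∫ θ, πI (N.tgt e) θ * D e (θ - N.τ e) :=
    Finset.sum_congr rfl fun v _ => Finset.sum_congr rfl fun e he => by
      rw [(Finset.mem_filter.1 he).2]
  rw [c1, c2, hsum1, hsum2] at hsum3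
  linarith

end FlowNetwork

/-! ### Walks and potentials in finite directed graphs -/

section Walks

variable {I A : Type*} {src tgt : A → I}

/-- The list `l` of arcs forms a walk from `i` to `j`. -/
def IsWalk (src tgt : A → I) : I → List A → I → Prop
  | i, [], j => i = j
  | i, a :: l, j => src a = i ∧ IsWalk src tgt (tgt a) l j

theorem isWalk_append {l₁ l₂ : List A} {i k : I} :
    IsWalk src tgt i (l₁ ++ l₂) k ↔ ∃ j, IsWalk src tgt i l₁ j ∧ IsWalk src tgt j l₂ k := by
  induction l₁ generalizing i with
  | nil => simp [IsWalk]
  | cons a l ih => simp [IsWalk, ih, and_assoc]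

theorem IsWalk.sum_sub {l : List A} {i j : I} (h : IsWalk src tgt i l j) (p : I → ℝ) :
    (l.map fun a => p (src a) - p (tgt a)).sum = p i - p j := by
  induction l generalizing i with
  | nil => simp [show i = j from h]
  | cons a l ih =>
    obtain ⟨rfl, h⟩ := h
    simp [ih h]

theorem IsWalk.sub_le_sum {l : List A} {i j : I} (h : IsWalk src tgt i l j) {p : I → ℝ} {w : A → ℝ}
    (hp : ∀ a, p (src a) - p (tgt a) ≤ w a) : p i - p j ≤ (l.map w).sum := by
  rw [← h.sum_sub p]
  exact List.sum_le_sum fun a _ => hp a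

/-- If no closed walk without repeated arcs has negative weight, every walk can be replaced by one
without repeated arcs that is not heavier. -/
theorem IsWalk.exists_nodup {w : A → ℝ}
    (hcyc : ∀ i l, IsWalk src tgt i l i → l.Nodup → 0 ≤ (l.map w).sum) {l : List A} {i j : I}
    (h : IsWalk src tgt i l j) :
    ∃ l', IsWalk src tgt i l' j ∧ l'.Nodup ∧ (l'.map w).sum ≤ (l.map w).sum := by
  induction l generalizing i with
  | nil => exact ⟨[], h, List.nodup_nil, le_rfl⟩
  | cons a l ih =>
    obtain ⟨rfl, h⟩ := h
    obtain ⟨l', h1, h2, h3⟩ := ih h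
    by_cases ha : a ∈ l'
    · obtain ⟨s, t, rfl⟩ := List.append_of_mem ha
      obtain ⟨k, hk1, hk2, hk3⟩ := isWalk_append.1 h1
      subst hk2
      have hn := List.nodup_middle.1 h2
      rw [List.nodup_cons, List.mem_append, not_or] at hn
      have hc := hcyc (src a) (a :: s) ⟨rfl, hk1⟩
        (List.nodup_cons.2 ⟨hn.1.1, (List.nodup_append.1 hn.2).1⟩)
      refine ⟨a :: t, ⟨rfl, hk3⟩, List.nodup_cons.2 ⟨hn.1.2, (List.nodup_append.1 hn.2).2.1⟩, ?_⟩
      simp only [List.map_append, List.map_cons, List.sum_append, List.sum_cons] at h3 hc ⊢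
      linarith
    · refine ⟨a :: l', ⟨rfl, h1⟩, List.nodup_cons.2 ⟨ha, h2⟩, ?_⟩
      simp only [List.map_cons, List.sum_cons]
      linarith

theorem finite_setOf_nodup [Finite A] : {l : List A | l.Nodup}.Finite := by
  have := Fintype.ofFinite A
  exact (List.finite_length_le A (Fintype.card A)).subset fun l hl => List.Nodup.length_le_card hl

/-- Either a weighted finite directed graph has a feasible potential (the distances along lightest
walks), or it carries a nonnegative circulation of negative weight (a negative closed walk).
Conservation of the circulation is stated in dual form, by pairing with arbitrary node functions. -/
theorem exists_potential_or_circulation [Fintype A] (w : A → ℝ) :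
    (∃ p : I → ℝ, ∀ a, p (src a) - p (tgt a) ≤ w a) ∨
    ∃ y : A → ℝ, (∀ a, 0 ≤ y a) ∧ (∀ p : I → ℝ, ∑ a, y a * (p (src a) - p (tgt a)) = 0) ∧
      ∑ a, y a * w a < 0 := by
  classical
  by_cases hcyc : ∀ i l, IsWalk src tgt i l i → l.Nodup → 0 ≤ (l.map w).sum
  · left
    let S : I → Set ℝ := fun i => {r | ∃ l j, IsWalk src tgt i l j ∧ r = (l.map w).sum}
    obtain ⟨B, hB⟩ := ((finite_setOf_nodup (A := A)).image fun l => (l.map w).sum).bddBelow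
    have hS : ∀ i, BddBelow (S i) := fun i => by
      refine ⟨B, ?_⟩
      rintro _ ⟨l, j, h, rfl⟩
      obtain ⟨l', -, h2, h3⟩ := h.exists_nodup hcyc
      exact (hB (mem_image_of_mem _ h2)).trans h3
    refine ⟨fun i => sInf (S i), fun a => ?_⟩
    have : sInf (S (src a)) - w a ≤ sInf (S (tgt a)) := by
      refine le_csInf ⟨0, [], tgt a, rfl, rfl⟩ ?_
      rintro _ ⟨l, j, h, rfl⟩
      have := csInf_le (hS (src a)) ⟨a :: l, j, ⟨rfl, h⟩, rfl⟩
      simp only [List.map_cons, List.sum_cons] at this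
      linarith
    linarith
  · right
    push Not at hcyc
    obtain ⟨i, l, hl, -, hneg⟩ := hcyc
    have key : ∀ f : A → ℝ, ∑ a, (l.count a : ℝ) * f a = (l.map f).sum := fun f => by
      rw [Finset.sum_list_map_count]
      simp only [nsmul_eq_mul]
      refine (Finset.sum_subset (Finset.subset_univ _) fun a _ ha => ?_).symm
      rw [List.count_eq_zero_of_not_mem (by simpa using ha)]
      simp
    refine ⟨fun a => l.count a, fun a => Nat.cast_nonneg _, fun p => ?_, by rwa [key]⟩
    rw [key, hl.sum_sub, sub_self]

/-- End node of a walk starting in `i`. -/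
def walkEnd (tgt : A → I) : I → List A → I
  | i, [] => i
  | _, a :: l => walkEnd tgt (tgt a) l

theorem IsWalk.walkEnd_eq {l : List A} {i j : I} (h : IsWalk src tgt i l j) :
    walkEnd tgt i l = j := by
  induction l generalizing i with
  | nil => exact h
  | cons a l ih => exact ih h.2

theorem HasAnalyticGerms.finset_inf' {ι : Type*} {s : Finset ι} (hs : s.Nonempty) {a b : ℝ}
    {f : ι → ℝ → ℝ} (hf : ∀ i ∈ s, HasAnalyticGerms a b (f i)) :
    HasAnalyticGerms a b (s.inf' hs f) :=
  Finset.inf'_induction hs f (p := HasAnalyticGerms a b) (fun _ h₁ _ h₂ => h₁.min h₂) hf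

theorem analyticAt_list_sum {c : A → ℝ → ℝ} {t : ℝ} (hc : ∀ a, AnalyticAt ℝ (c a) t) (l : List A) :
    AnalyticAt ℝ (fun s => (l.map fun a => c a s).sum) t := by
  induction l with
  | nil => exact analyticAt_const
  | cons a l ih =>
    simp only [List.map_cons, List.sum_cons]
    exact (hc a).add ih

/-- Interpolation of potentials. Let the arc weights vary with `θ ∈ [α, β]` so that the weight of every
walk without repeated arcs is monotone or antitone. Feasible potentials `p⁻`, `p⁺` for the weights at
the two ends extend to feasible potentials in between, each of which is monotone if `p⁻ ≤ p⁺` at its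
node and antitone if `p⁺ ≤ p⁻`. One takes the lightest walk, where stopping in `j` costs
`max (p⁻ j) (p⁺ j)`. -/
theorem exists_interpolated_potential [Finite A] {c : A → ℝ → ℝ} {α β : ℝ} (hαβ : α ≤ β)
    (hc : ∀ a, ∀ θ ∈ Icc α β, AnalyticAt ℝ (c a) θ)
    (hmono : ∀ l : List A, l.Nodup → MonotoneOn (fun θ => (l.map fun a => c a θ).sum) (Icc α β) ∨
      AntitoneOn (fun θ => (l.map fun a => c a θ).sum) (Icc α β))
    {p₀ p₁ : I → ℝ} (h₀ : ∀ a, p₀ (src a) - p₀ (tgt a) ≤ c a α)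
    (h₁ : ∀ a, p₁ (src a) - p₁ (tgt a) ≤ c a β) :
    ∃ π : I → ℝ → ℝ, (∀ i, HasAnalyticGerms α β (π i)) ∧
      (∀ a, ∀ θ ∈ Icc α β, π (src a) θ - π (tgt a) θ ≤ c a θ) ∧
      (∀ i, ∀ θ ∈ Icc α β, min (p₀ i) (p₁ i) ≤ π i θ ∧ π i θ ≤ max (p₀ i) (p₁ i)) ∧
      (∀ i, p₀ i ≤ p₁ i → MonotoneOn (π i) (Icc α β)) ∧
      (∀ i, p₁ i ≤ p₀ i → AntitoneOn (π i) (Icc α β)) := by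
  classical
  have hα : α ∈ Icc α β := left_mem_Icc.2 hαβ
  have hβ : β ∈ Icc α β := right_mem_Icc.2 hαβ
  set cost : List A → ℝ → ℝ := fun l θ => (l.map fun a => c a θ).sum with hcost
  set q : I → ℝ := fun i => max (p₀ i) (p₁ i) with hq
  have hcyc : ∀ θ ∈ Icc α β, ∀ i l, IsWalk src tgt i l i → l.Nodup →
      0 ≤ (l.map fun a => c a θ).sum := by
    intro θ hθ i l hl hn
    have e0 := hl.sub_le_sum h₀
    have e1 := hl.sub_le_sum h₁
    rw [sub_self] at e0 e1
    rcases hmono l hn with h | h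
    · exact e0.trans (h hα hθ hθ.1)
    · exact e1.trans (h hθ hβ hθ.2)
  have hfin : ∀ i, {l : List A | l.Nodup ∧ ∃ j, IsWalk src tgt i l j}.Finite := fun i =>
    finite_setOf_nodup.subset fun l hl => hl.1
  have hne : ∀ i, (hfin i).toFinset.Nonempty := fun i =>
    ⟨[], by simp [IsWalk]⟩
  set π : I → ℝ → ℝ := fun i => (hfin i).toFinset.inf' (hne i)
    fun l θ => cost l θ + q (walkEnd tgt i l) with hπ
  have hle : ∀ θ ∈ Icc α β, ∀ i l j, IsWalk src tgt i l j → π i θ ≤ cost l θ + q j := by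
    intro θ hθ i l j hl
    obtain ⟨l', h1, h2, h3⟩ := hl.exists_nodup (hcyc θ hθ)
    have : π i θ ≤ cost l' θ + q (walkEnd tgt i l') := by
      simp only [hπ, Finset.inf'_apply]
      exact Finset.inf'_le (fun l => cost l θ + q (walkEnd tgt i l)) (by simpa using ⟨h2, j, h1⟩)
    rw [h1.walkEnd_eq] at this
    exact this.trans (add_le_add_left h3 _)
  have hex : ∀ i θ, ∃ l j, IsWalk src tgt i l j ∧ l.Nodup ∧ π i θ = cost l θ + q j := by
    intro i θ
    obtain ⟨l, hl, h⟩ := Finset.exists_mem_eq_inf' (hne i) (fun l => cost l θ + q (walkEnd tgt i l))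
    simp only [Finite.mem_toFinset, mem_ofPred_eq] at hl
    obtain ⟨hn, j, hj⟩ := hl
    refine ⟨l, j, hj, hn, ?_⟩
    rw [← hj.walkEnd_eq, ← h]
    simp only [hπ, Finset.inf'_apply]
  have hself : ∀ i, ∀ θ ∈ Icc α β, π i θ ≤ q i := fun i θ hθ => by
    simpa [hcost] using hle θ hθ i [] i rfl
  -- a monotone weight is bounded below by its value at `α`, an antitone one by its value at `β`
  have hlow₀ : ∀ i l j, IsWalk src tgt i l j → ∀ θ ∈ Icc α β, MonotoneOn (cost l) (Icc α β) →
      p₀ i ≤ cost l θ + q j := fun i l j hl θ hθ h => by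
    have e0 := hl.sub_le_sum h₀
    have e1 : cost l α ≤ cost l θ := h hα hθ hθ.1
    have e2 : p₀ j ≤ q j := le_max_left _ _
    linarith
  have hlow₁ : ∀ i l j, IsWalk src tgt i l j → ∀ θ ∈ Icc α β, AntitoneOn (cost l) (Icc α β) →
      p₁ i ≤ cost l θ + q j := fun i l j hl θ hθ h => by
    have e0 := hl.sub_le_sum h₁
    have e1 : cost l β ≤ cost l θ := h hθ hβ hθ.2
    have e2 : p₁ j ≤ q j := le_max_right _ _
    linarith
  refine ⟨π, fun i => ?_, fun a θ hθ => ?_, fun i θ hθ => ⟨?_, hself i θ hθ⟩,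
    fun i hi θ hθ θ' hθ' hlt => ?_, fun i hi θ hθ θ' hθ' hlt => ?_⟩
  · exact HasAnalyticGerms.finset_inf' _ fun l _ => (HasAnalyticGerms.of_analyticAt
      fun t ht => analyticAt_list_sum (fun a => hc a t ht) l).add (.const _)
  · obtain ⟨l, j, hl, -, he⟩ := hex (tgt a) θ
    have := hle θ hθ (src a) (a :: l) j ⟨rfl, hl⟩
    simp only [hcost, List.map_cons, List.sum_cons] at this he
    linarith
  · obtain ⟨l, j, hl, hn, he⟩ := hex i θ
    rw [he]
    rcases hmono l hn with h | h
    · exact (min_le_left _ _).trans (hlow₀ i l j hl θ hθ h)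
    · exact (min_le_right _ _).trans (hlow₁ i l j hl θ hθ h)
  · obtain ⟨l, j, hl, hn, he⟩ := hex i θ'
    rw [he]
    rcases hmono l hn with h | h
    · exact (hle θ hθ i l j hl).trans (add_le_add_left (h hθ hθ' hlt) _)
    · exact (hself i θ hθ).trans ((max_eq_right hi).trans_le (hlow₁ i l j hl θ' hθ' h))
  · obtain ⟨l, j, hl, hn, he⟩ := hex i θ
    rw [he]
    rcases hmono l hn with h | h
    · exact (hself i θ' hθ').trans ((max_eq_left hi).trans_le (hlow₀ i l j hl θ hθ h))
    · exact (hle θ' hθ' i l j hl).trans (add_le_add_left (h hθ hθ' hlt) _)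

end Walks

/-! ### Local normal forms of the data -/

theorem LocallyHolds.restrict {a b a' b' : ℝ} {G : ℝ → ℝ → Prop} (hG : LocallyHolds a b G)
    (ha : a ≤ a') (hb : b' ≤ b) : LocallyHolds a' b' G where
  mono := hG.mono
  right := fun t ht => hG.right t ⟨ha.trans ht.1, ht.2.trans_le hb⟩
  left := fun t ht => hG.left t ⟨ha.trans_lt ht.1, ht.2.trans hb⟩

theorem LocallyHolds.comp_add {a b : ℝ} {G : ℝ → ℝ → Prop} (hG : LocallyHolds a b G) (c : ℝ) :
    LocallyHolds (a - c) (b - c) (fun s t => G (s + c) (t + c)) where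
  mono := fun _ _ _ _ h1 h2 h3 h =>
    hG.mono (add_le_add_left h1 c) (add_lt_add_left h2 c) (add_le_add_left h3 c) h
  right := fun t ht => by
    have hc : ContinuousAt (fun s : ℝ => s + c) t := by fun_prop
    exact (hc.continuousWithinAt.tendsto_nhdsWithin fun s hs => add_lt_add_left (mem_Ioi.1 hs) c).eventually
      (hG.right (t + c) ⟨by linarith [ht.1], by linarith [ht.2]⟩)
  left := fun t ht => by
    have hc : ContinuousAt (fun s : ℝ => s + c) t := by fun_prop
    exact (hc.continuousWithinAt.tendsto_nhdsWithin fun s hs => add_lt_add_left (mem_Iio.1 hs) c).eventually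
      (hG.left (t + c) ⟨by linarith [ht.1], by linarith [ht.2]⟩)

/-- Orientation of a residual arc: `false` is forward, `true` is backward. -/
def dirSign : Bool → ℝ
  | false => 1
  | true => -1

/-- Finitely many piecewise analytic functions locally extend to analytic functions on closed
intervals, on which moreover all signed sums without repetition are monotone or antitone. -/
theorem locallyHolds_analytic_extension {A : Type*} [Finite A] {a b : ℝ} {f : A → ℝ → ℝ}
    (hf : ∀ i, HasAnalyticGerms a b (f i)) :
    LocallyHolds a b (fun s t => ∃ C : A → ℝ → ℝ, (∀ i, EqOn (C i) (f i) (Ico s t)) ∧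
      (∀ i, ∀ θ ∈ Icc s t, AnalyticAt ℝ (C i) θ) ∧
      ∀ l : List (A × Bool), l.Nodup →
        MonotoneOn (fun θ => (l.map fun p => dirSign p.2 * C p.1 θ).sum) (Icc s t) ∨
        AntitoneOn (fun θ => (l.map fun p => dirSign p.2 * C p.1 θ).sum) (Icc s t)) where
  mono := by
    rintro s t s' t' h1 h2 h3 ⟨C, hC1, hC2, hC3⟩
    have := Icc_subset_Icc h1 h3
    exact ⟨C, fun i => (hC1 i).mono (Ico_subset_Ico h1 h3), fun i θ hθ => hC2 i θ (this hθ),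
      fun l hl => (hC3 l hl).imp (fun h => h.mono this) fun h => h.mono this⟩
  right := fun t ht => by
    choose C hC1 hC2 using fun i => (hf i).right t ht
    have hfin : ∀ᶠ s in 𝓝[>] t, ∀ l ∈ {l : List (A × Bool) | l.Nodup},
        MonotoneOn (fun θ => (l.map fun p => dirSign p.2 * C p.1 θ).sum) (Icc t s) ∨
        AntitoneOn (fun θ => (l.map fun p => dirSign p.2 * C p.1 θ).sum) (Icc t s) :=
      (eventually_all_finite finite_setOf_nodup).2 fun l _ => (analyticAt_list_sum
        (fun p => analyticAt_const.mul (hC1 p.1)) l).eventually_monotoneOn_right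
    filter_upwards [hfin, eventually_all.2 fun i => eventually_right_of_nhdsGE (hC2 i),
      eventually_all.2 fun i => eventually_right_of_nhds (hC1 i).eventually_analyticAt] with s h1 h2 h3
    exact ⟨C, fun i θ hθ => (h2 i θ (Ico_subset_Icc_self hθ)).symm, h3, h1⟩
  left := fun t ht => by
    choose C hC1 hC2 using fun i => (hf i).left t ht
    have hfin : ∀ᶠ s in 𝓝[<] t, ∀ l ∈ {l : List (A × Bool) | l.Nodup},
        MonotoneOn (fun θ => (l.map fun p => dirSign p.2 * C p.1 θ).sum) (Icc s t) ∨
        AntitoneOn (fun θ => (l.map fun p => dirSign p.2 * C p.1 θ).sum) (Icc s t) :=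
      (eventually_all_finite finite_setOf_nodup).2 fun l _ => (analyticAt_list_sum
        (fun p => analyticAt_const.mul (hC1 p.1)) l).eventually_monotoneOn_left
    filter_upwards [hfin, eventually_all.2 fun i => eventually_left_of_nhdsLT (hC2 i),
      eventually_all.2 fun i => eventually_left_of_nhds (hC1 i).eventually_analyticAt] with s h1 h2 h3
    exact ⟨C, fun i θ hθ => (h2 i θ hθ).symm, h3, h1⟩

theorem HasAnalyticGerms.locallyHolds_continuousOn {a b : ℝ} {f : ℝ → ℝ}
    (hf : HasAnalyticGerms a b f) : LocallyHolds a b (fun s t => ContinuousOn f (Ioo s t)) where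
  mono := fun _ _ _ _ h1 _ h3 h => h.mono (Ioo_subset_Ioo h1 h3)
  right := fun t ht => by
    obtain ⟨g, h1, h2⟩ := hf.right t ht
    filter_upwards [eventually_right_of_nhdsGE h2, eventually_right_of_nhds h1.eventually_analyticAt]
      with s h3 h4
    exact ContinuousOn.congr (fun θ hθ => (h4 θ (Ioo_subset_Icc_self hθ)).continuousAt.continuousWithinAt)
      fun θ hθ => h3 θ (Ioo_subset_Icc_self hθ)
  left := fun t ht => by
    obtain ⟨g, h1, h2⟩ := hf.left t ht
    filter_upwards [eventually_left_of_nhdsLT h2, eventually_left_of_nhds h1.eventually_analyticAt]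
      with s h3 h4
    exact ContinuousOn.congr (fun θ hθ => (h4 θ (Ioo_subset_Icc_self hθ)).continuousAt.continuousWithinAt)
      fun θ hθ => h3 θ (Ioo_subset_Ico_self hθ)

/-- A nonnegative piecewise analytic function locally vanishes or is positive. -/
theorem HasAnalyticGerms.locallyHolds_sign {a b : ℝ} {f : ℝ → ℝ}
    (hf : HasAnalyticGerms a b f) (h0 : ∀ θ ∈ Ico a b, 0 ≤ f θ) :
    LocallyHolds a b (fun s t => (∀ θ ∈ Ico s t, f θ = 0) ∨ ∀ θ ∈ Ioo s t, 0 < f θ) where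
  mono := fun _ _ _ _ h1 _ h3 h => h.imp (fun h θ hθ => h θ (Ico_subset_Ico h1 h3 hθ))
    fun h θ hθ => h θ (Ioo_subset_Ioo h1 h3 hθ)
  right := fun t ht => by
    obtain ⟨g, h1, h2⟩ := hf.right t ht
    filter_upwards [eventually_right_of_nhdsGE h2, h1.eventually_constSign_right,
      Ioo_mem_nhdsGT ht.2] with s h3 h4 hs
    have h5 : ∀ θ ∈ Ioo t s, f θ = g θ := fun θ hθ => h3 θ (Ioo_subset_Icc_self hθ)
    rcases h4 with h | h | h
    · left
      intro θ hθ
      rcases hθ.1.eq_or_lt with h6 | h6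
      · subst h6
        rw [h2.self_of_nhdsWithin self_mem_Ici]
        refine tendsto_nhds_unique (h1.continuousAt.tendsto.mono_left nhdsWithin_le_nhds)
          (tendsto_const_nhds.congr' ?_ : Tendsto g (𝓝[>] t) _)
        filter_upwards [Ioo_mem_nhdsGT hs.1] with r hr using (h r hr).symm
      · rw [h5 θ ⟨h6, hθ.2⟩, h θ ⟨h6, hθ.2⟩]
    · exact .inr fun θ hθ => by rw [h5 θ hθ]; exact h θ hθ
    · obtain ⟨θ, hθ⟩ := exists_between hs.1
      have := h θ hθ
      rw [← h5 θ hθ] at this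
      exact absurd (h0 θ ⟨ht.1.trans hθ.1.le, hθ.2.trans hs.2⟩) (not_le.2 this)
  left := fun t ht => by
    obtain ⟨g, h1, h2⟩ := hf.left t ht
    obtain ⟨r, ⟨h3, h4⟩, hr⟩ := ((eventually_left_of_nhdsLT h2).and h1.eventually_constSign_left).and
      (Ioo_mem_nhdsLT ht.1) |>.exists
    have h5 : ∀ θ ∈ Ioo r t, f θ = g θ := fun θ hθ => h3 θ (Ioo_subset_Ico_self hθ)
    filter_upwards [Ioo_mem_nhdsLT hr.2] with s hs
    rcases h4 with h | h | h
    · left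
      intro θ hθ
      have : θ ∈ Ioo r t := ⟨hs.1.trans_le hθ.1, hθ.2⟩
      rw [h5 θ this, h θ this]
    · refine .inr fun θ hθ => ?_
      have : θ ∈ Ioo r t := ⟨hs.1.trans hθ.1, hθ.2⟩
      rw [h5 θ this]
      exact h θ this
    · have := h s hs
      rw [← h5 s hs] at this
      exact absurd (h0 s ⟨hr.1.le.trans hs.1.le, hs.2.trans_le ht.2⟩) (not_le.2 this)

/-- The function is differentiable on one-sided punctured neighbourhoods of every point, with a
derivative that is analytic up to the point. -/
structure HasDerivGerms (a b : ℝ) (F : ℝ → ℝ) : Prop where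
  right : ∀ t ∈ Ico a b, ∃ g, AnalyticAt ℝ g t ∧ ∀ᶠ s in 𝓝[>] t, HasDerivAt F (g s) s
  left : ∀ t ∈ Ioc a b, ∃ g, AnalyticAt ℝ g t ∧ ∀ᶠ s in 𝓝[<] t, HasDerivAt F (g s) s

theorem HasDerivGerms.sub {a b : ℝ} {F G : ℝ → ℝ} (hF : HasDerivGerms a b F)
    (hG : HasDerivGerms a b G) : HasDerivGerms a b (fun s => F s - G s) := by
  refine ⟨fun t ht => ?_, fun t ht => ?_⟩
  · obtain ⟨f, h1, h2⟩ := hF.right t ht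
    obtain ⟨g, h3, h4⟩ := hG.right t ht
    exact ⟨_, h1.sub h3, by filter_upwards [h2, h4] with s h5 h6 using h5.sub h6⟩
  · obtain ⟨f, h1, h2⟩ := hF.left t ht
    obtain ⟨g, h3, h4⟩ := hG.left t ht
    exact ⟨_, h1.sub h3, by filter_upwards [h2, h4] with s h5 h6 using h5.sub h6⟩

theorem HasAnalyticGerms.hasDerivGerms {a b : ℝ} {F : ℝ → ℝ} (hF : HasAnalyticGerms a b F) :
    HasDerivGerms a b F := by
  refine ⟨fun t ht => ?_, fun t ht => ?_⟩
  · obtain ⟨f, h1, h2⟩ := hF.right t ht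
    refine ⟨deriv f, h1.deriv, ?_⟩
    filter_upwards [eventually_eventually_nhdsWithin.2
      (h2.filter_mono (nhdsWithin_mono _ Ioi_subset_Ici_self)),
      h1.eventually_analyticAt.filter_mono nhdsWithin_le_nhds, self_mem_nhdsWithin] with s h3 h4 h5
    rw [isOpen_Ioi.nhdsWithin_eq h5] at h3
    exact h4.differentiableAt.hasDerivAt.congr_of_eventuallyEq h3
  · obtain ⟨f, h1, h2⟩ := hF.left t ht
    refine ⟨deriv f, h1.deriv, ?_⟩
    filter_upwards [eventually_eventually_nhdsWithin.2 h2,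
      h1.eventually_analyticAt.filter_mono nhdsWithin_le_nhds, self_mem_nhdsWithin] with s h3 h4 h5
    rw [isOpen_Iio.nhdsWithin_eq h5] at h3
    exact h4.differentiableAt.hasDerivAt.congr_of_eventuallyEq h3

theorem HasAnalyticGerms.hasDerivGerms_integral {a b : ℝ} {f F : ℝ → ℝ} (hf : HasAnalyticGerms a b f)
    {c : ℝ} (hF : ∀ θ ∈ Icc a b, F θ = c + ∫ t in a..θ, f t) : HasDerivGerms a b F := by
  have key : ∀ s ∈ Ioo a b, ∀ g : ℝ → ℝ, AnalyticAt ℝ g s → f =ᶠ[𝓝 s] g → HasDerivAt F (g s) s := by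
    intro s hs g hg hfg
    have hi := hf.intervalIntegrable (hs.1.trans hs.2).le
    have hi' : IntervalIntegrable f volume a s := hi.mono_set (by
      rw [uIcc_of_le hs.1.le, uIcc_of_le (hs.1.trans hs.2).le]
      exact Icc_subset_Icc_right hs.2.le)
    have hcont : ContinuousAt f s := hg.continuousAt.congr hfg.symm
    have hmeas : StronglyMeasurableAtFilter f (𝓝 s) := by
      refine ⟨Ioo a b, Ioo_mem_nhds hs.1 hs.2, ?_⟩
      rw [intervalIntegrable_iff_integrableOn_Ioo_of_le (hs.1.trans hs.2).le] at hi
      exact hi.aestronglyMeasurable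
    have := (intervalIntegral.integral_hasDerivAt_right hi' hmeas hcont).const_add c
    rw [hfg.self_of_nhds] at this
    refine this.congr_of_eventuallyEq ?_
    filter_upwards [Ioo_mem_nhds hs.1 hs.2] with r hr using hF r (Ioo_subset_Icc_self hr)
  refine ⟨fun t ht => ?_, fun t ht => ?_⟩
  · obtain ⟨g, h1, h2⟩ := hf.right t ht
    refine ⟨g, h1, ?_⟩
    filter_upwards [eventually_eventually_nhdsWithin.2
      (h2.filter_mono (nhdsWithin_mono _ Ioi_subset_Ici_self)),
      h1.eventually_analyticAt.filter_mono nhdsWithin_le_nhds, Ioo_mem_nhdsGT ht.2] with s h3 h4 h5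
    rw [isOpen_Ioi.nhdsWithin_eq h5.1] at h3
    exact key s ⟨ht.1.trans_lt h5.1, h5.2⟩ g h4 h3
  · obtain ⟨g, h1, h2⟩ := hf.left t ht
    refine ⟨g, h1, ?_⟩
    filter_upwards [eventually_eventually_nhdsWithin.2 h2,
      h1.eventually_analyticAt.filter_mono nhdsWithin_le_nhds, Ioo_mem_nhdsLT ht.1] with s h3 h4 h5
    rw [isOpen_Iio.nhdsWithin_eq h5.2] at h3
    exact key s ⟨h5.1, h5.2.trans_le ht.2⟩ g h4 h3

theorem zero_or_pos_of_forall_ne {a b : ℝ} {F f : ℝ → ℝ} (hd : ∀ s ∈ Ioo a b, HasDerivAt F (f s) s)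
    (h0 : ∀ s ∈ Ioo a b, 0 ≤ F s) (hs : ConstSign a b f) :
    (∀ s ∈ Ioo a b, F s = 0) ∨ ∃ z, ∀ s ∈ Ioo a b, s ≠ z → 0 < F s :=
  (exists_forall_ne_of_constSign_deriv hd hs).imp_right fun ⟨z, hz⟩ =>
    ⟨z, fun s hs hne => (h0 s hs).lt_of_ne' (hz s hs hne)⟩

/-- A nonnegative function with piecewise analytic derivative locally vanishes or is positive. -/
theorem HasDerivGerms.locallyHolds_sign {a b : ℝ} {F : ℝ → ℝ} (hF : HasDerivGerms a b F)
    (h0 : ∀ θ ∈ Icc a b, 0 ≤ F θ) :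
    LocallyHolds a b (fun s t => (∀ θ ∈ Ioo s t, F θ = 0) ∨ ∀ θ ∈ Ioo s t, 0 < F θ) where
  mono := fun _ _ _ _ h1 _ h3 h => h.imp (fun h θ hθ => h θ (Ioo_subset_Ioo h1 h3 hθ))
    fun h θ hθ => h θ (Ioo_subset_Ioo h1 h3 hθ)
  right := fun t ht => by
    obtain ⟨g, h1, h2⟩ := hF.right t ht
    obtain ⟨r, ⟨h3, h4⟩, hr⟩ := ((eventually_right_of_nhdsGT h2).and
      h1.eventually_constSign_right).and (Ioo_mem_nhdsGT ht.2) |>.exists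
    rcases zero_or_pos_of_forall_ne (fun s hs => h3 s (Ioo_subset_Ioc_self hs))
      (fun s hs => h0 s ⟨ht.1.trans hs.1.le, hs.2.le.trans hr.2.le⟩) h4 with h | ⟨z, hz⟩
    · filter_upwards [Ioo_mem_nhdsGT hr.1] with s hs
      exact .inl fun θ hθ => h θ ⟨hθ.1, hθ.2.trans hs.2⟩
    · have hne : ∀ᶠ s in 𝓝[>] t, s ≠ z := by
        rcases eq_or_ne z t with rfl | h
        · exact eventually_nhdsWithin_of_forall fun s hs => (mem_Ioi.1 hs).ne'
        · exact (eventually_ne_nhds h.symm).filter_mono nhdsWithin_le_nhds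
      filter_upwards [Ioo_mem_nhdsGT hr.1, eventually_right_of_nhdsGT hne] with s hs h5
      exact .inr fun θ hθ => hz θ ⟨hθ.1, hθ.2.trans hs.2⟩ (h5 θ (Ioo_subset_Ioc_self hθ))
  left := fun t ht => by
    obtain ⟨g, h1, h2⟩ := hF.left t ht
    obtain ⟨r, ⟨h3, h4⟩, hr⟩ := ((eventually_left_of_nhdsLT h2).and
      h1.eventually_constSign_left).and (Ioo_mem_nhdsLT ht.1) |>.exists
    rcases zero_or_pos_of_forall_ne (fun s hs => h3 s (Ioo_subset_Ico_self hs))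
      (fun s hs => h0 s ⟨hr.1.le.trans hs.1.le, hs.2.le.trans ht.2⟩) h4 with h | ⟨z, hz⟩
    · filter_upwards [Ioo_mem_nhdsLT hr.2] with s hs
      exact .inl fun θ hθ => h θ ⟨hs.1.trans hθ.1, hθ.2⟩
    · have hne : ∀ᶠ s in 𝓝[<] t, s ≠ z := by
        rcases eq_or_ne z t with rfl | h
        · exact eventually_nhdsWithin_of_forall fun s hs => (mem_Iio.1 hs).ne
        · exact (eventually_ne_nhds h.symm).filter_mono nhdsWithin_le_nhds
      filter_upwards [Ioo_mem_nhdsLT hr.2, eventually_left_of_nhdsLT hne] with s hs h5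
      exact .inr fun θ hθ => hz θ ⟨hs.1.trans hθ.1, hθ.2⟩ (h5 θ (Ioo_subset_Ico_self hθ))

theorem HasAnalyticGerms.finset_sum {ι : Type*} {s : Finset ι} {a b : ℝ} {f : ι → ℝ → ℝ}
    (hf : ∀ i ∈ s, HasAnalyticGerms a b (f i)) : HasAnalyticGerms a b (fun t => ∑ i ∈ s, f i t) := by
  classical
  induction s using Finset.induction_on with
  | empty => simpa using HasAnalyticGerms.const 0
  | insert i s hi ih =>
    simp only [Finset.sum_insert hi]
    exact (hf i (Finset.mem_insert_self i s)).add (ih fun j hj => hf j (Finset.mem_insert_of_mem hj))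

/-- A right-continuous function that is nonnegative almost everywhere is nonnegative. -/
theorem HasAnalyticGerms.nonneg_of_ae {a b : ℝ} {f : ℝ → ℝ} (hf : HasAnalyticGerms a b f)
    (h : ∀ᵐ θ ∂volume.restrict (Ico a b), 0 ≤ f θ) : ∀ θ ∈ Ico a b, 0 ≤ f θ := by
  intro θ hθ
  by_contra! hneg
  have h1 : ∀ᶠ s in 𝓝[≥] θ, f s < 0 := (hf.continuousWithinAt hθ).eventually (gt_mem_nhds hneg)
  obtain ⟨r, h2, hr⟩ := ((eventually_right_of_nhdsGE h1).and (Ioo_mem_nhdsGT hθ.2)).exists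
  rw [ae_restrict_iff' measurableSet_Ico] at h
  have h3 : volume (Ioo θ r) = 0 := by
    refine measure_mono_null (fun s hs => ?_) h
    simp only [mem_compl_iff, mem_ofPred_eq, Classical.not_imp, not_le]
    exact ⟨⟨hθ.1.trans hs.1.le, hs.2.trans hr.2⟩, h2 s (Ioo_subset_Icc_self hs)⟩
  rw [Real.volume_Ioo, ENNReal.ofReal_eq_zero] at h3
  linarith [hr.1]

/-! ### The time grid -/

namespace FlowNetwork

variable {V E : Type*} {N : FlowNetwork V E} {x : E → ℝ → ℝ}

theorem hasAnalyticGerms_extend {e : E} (hx : HasAnalyticGerms 0 N.T (x e)) (a b : ℝ) :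
    HasAnalyticGerms a b (N.extend x e) := by
  refine ⟨fun t _ => ?_, fun t _ => ?_⟩
  · rcases lt_or_ge t 0 with h | h
    · refine ⟨fun _ => 0, analyticAt_const, ?_⟩
      filter_upwards [mem_nhdsWithin_of_mem_nhds (Iio_mem_nhds h)] with s hs
      exact extend_of_notMem fun h' => absurd h'.1 (not_le.2 hs)
    rcases lt_or_ge t N.T with h' | h'
    · obtain ⟨g, h1, h2⟩ := hx.right t ⟨h, h'⟩
      refine ⟨g, h1, EventuallyEq.trans ?_ h2⟩
      filter_upwards [Ico_mem_nhdsGE h'] with s hs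
      exact extend_of_mem ⟨h.trans hs.1, hs.2⟩
    · refine ⟨fun _ => 0, analyticAt_const, ?_⟩
      filter_upwards [self_mem_nhdsWithin] with s hs
      exact extend_of_notMem fun h'' => absurd h''.2 (not_lt.2 (h'.trans hs))
  · rcases le_or_gt t 0 with h | h
    · refine ⟨fun _ => 0, analyticAt_const, ?_⟩
      filter_upwards [self_mem_nhdsWithin] with s hs
      exact extend_of_notMem fun h' => absurd h'.1 (not_le.2 ((mem_Iio.1 hs).trans_le h))
    rcases le_or_gt t N.T with h' | h'
    · obtain ⟨g, h1, h2⟩ := hx.left t ⟨h, h'⟩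
      refine ⟨g, h1, EventuallyEq.trans ?_ h2⟩
      filter_upwards [Ioo_mem_nhdsLT h] with s hs
      exact extend_of_mem ⟨hs.1.le, hs.2.trans_le h'⟩
    · refine ⟨fun _ => 0, analyticAt_const, ?_⟩
      filter_upwards [Ioo_mem_nhdsLT h'] with s hs
      exact extend_of_notMem fun h'' => absurd h''.2 (not_lt.2 hs.1.le)

/-- By rationality, `T` and the transit times are integer multiples of a common time unit. -/
theorem exists_common_time_unit [Finite E] (hT : ∃ q : ℚ, (q : ℝ) = N.T)
    (hτ : ∀ e, ∃ q : ℚ, (q : ℝ) = N.τ e) :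
    ∃ (Δ : ℝ) (K : ℕ) (r : E → ℤ), 0 < Δ ∧ 0 < K ∧ N.T = K * Δ ∧ ∀ e, N.τ e = r e * Δ := by
  have := Fintype.ofFinite E
  obtain ⟨q, hq⟩ := hT
  choose p hp using hτ
  set D : ℕ := q.den * ∏ e, (p e).den with hD
  have hD0 : (0 : ℝ) < D := by
    rw [hD]
    exact_mod_cast Nat.mul_pos q.den_pos (Finset.prod_pos fun e _ => (p e).den_pos)
  have key : ∀ s : ℚ, s.den ∣ D → ∃ z : ℤ, (s : ℝ) = z * (1 / D) := by
    rintro s ⟨k, hk⟩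
    refine ⟨s.num * k, ?_⟩
    have hs : (s : ℝ) = s.num / s.den := by exact_mod_cast (Rat.num_div_den s).symm
    have h1 : (s.den : ℝ) ≠ 0 := by exact_mod_cast s.den_nz
    have h2 : (D : ℝ) = s.den * k := by exact_mod_cast hk
    have h3 : (k : ℝ) ≠ 0 := fun h => hD0.ne' (by rw [h2, h, mul_zero])
    rw [hs, h2]
    push_cast
    field_simp
  obtain ⟨z, hz⟩ := key q (dvd_mul_right _ _)
  choose r hr using fun e => key (p e) ((Finset.dvd_prod_of_mem _ (Finset.mem_univ e)).mul_left _)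
  have hz0 : 0 < z := by
    have h1 := N.T_pos
    rw [← hq, hz] at h1
    have : (0 : ℝ) < z := by
      by_contra! h
      have := mul_nonpos_of_nonpos_of_nonneg h (one_div_pos.2 hD0).le
      linarith
    exact_mod_cast this
  refine ⟨1 / D, z.toNat, r, one_div_pos.2 hD0, by omega, ?_, fun e => by rw [← hp, hr]⟩
  rw [← hq, hz]
  congr 1
  exact_mod_cast (Int.toNat_of_nonneg hz0.le).symm

variable [Fintype E] [DecidableEq V]

/-- A subdivision of the time axis adapted to the flow `x`. The grid points `d i` are invariant under
translation by the common time unit `Δ`, of which `T` and all transit times are multiples; on each cell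
`[d i, d (i + 1))` of `[0,T)` the constraints are either tight or slack throughout the interior, and the
costs `c e` coincide with analytic functions `C e i`. -/
structure TimeGrid (N : FlowNetwork V E) (x : E → ℝ → ℝ) where
  /-- number of cells in a time unit -/
  m : ℕ
  /-- number of time units in `[0,T]` -/
  K : ℕ
  /-- time unit -/
  Δ : ℝ
  /-- grid points -/
  d : ℤ → ℝ
  /-- transit times in time units -/
  r : E → ℤ
  /-- analytic extensions of the costs on the closed cells -/
  C : E → ℤ → ℝ → ℝ
  m_pos : 0 < m
  d_lt : ∀ i, d i < d (i + 1)
  d_zero : d 0 = 0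
  d_add : ∀ i k : ℤ, d (i + k * m) = d i + k * Δ
  d_end : d (K * m) = N.T
  τ_eq : ∀ e, N.τ e = r e * Δ
  C_eq : ∀ e, ∀ i ∈ Ico (0 : ℤ) (K * m), EqOn (C e i) (N.c e) (Ico (d i) (d (i + 1)))
  C_analytic : ∀ e, ∀ i ∈ Ico (0 : ℤ) (K * m), ∀ θ ∈ Icc (d i) (d (i + 1)), AnalyticAt ℝ (C e i) θ
  /-- The costs of residual walks are monotone or antitone on each class of simultaneous cells. -/
  C_mono : ∀ j ∈ Ico (0 : ℤ) m, ∀ l : List ((E × Fin K) × Bool), l.Nodup →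
    MonotoneOn (fun σ => (l.map fun p => dirSign p.2 *
      C p.1.1 (j + (p.1.2 : ℕ) * m) (σ + (p.1.2 : ℕ) * Δ)).sum) (Icc (d j) (d (j + 1))) ∨
    AntitoneOn (fun σ => (l.map fun p => dirSign p.2 *
      C p.1.1 (j + (p.1.2 : ℕ) * m) (σ + (p.1.2 : ℕ) * Δ)).sum) (Icc (d j) (d (j + 1)))
  x_cont : ∀ e, ∀ i ∈ Ico (0 : ℤ) (K * m), ContinuousOn (x e) (Ioo (d i) (d (i + 1)))
  u_cont : ∀ e, ∀ i ∈ Ico (0 : ℤ) (K * m), ContinuousOn (N.u e) (Ioo (d i) (d (i + 1)))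
  x_sign : ∀ e, ∀ i ∈ Ico (0 : ℤ) (K * m),
    (∀ θ ∈ Ico (d i) (d (i + 1)), x e θ = 0) ∨ ∀ θ ∈ Ioo (d i) (d (i + 1)), 0 < x e θ
  u_sign : ∀ e, ∀ i ∈ Ico (0 : ℤ) (K * m),
    (∀ θ ∈ Ico (d i) (d (i + 1)), x e θ = N.u e θ) ∨ ∀ θ ∈ Ioo (d i) (d (i + 1)), x e θ < N.u e θ
  Y_sign : ∀ v, ∀ i ∈ Ico (0 : ℤ) (K * m),
    (∀ θ ∈ Ioo (d i) (d (i + 1)), N.Y x v θ = 0) ∨ ∀ θ ∈ Ioo (d i) (d (i + 1)), 0 < N.Y x v θ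
  U_sign : ∀ v, ∀ i ∈ Ico (0 : ℤ) (K * m),
    (∀ θ ∈ Ioo (d i) (d (i + 1)), N.Y x v θ = N.U v θ) ∨
      ∀ θ ∈ Ioo (d i) (d (i + 1)), N.Y x v θ < N.U v θ

theorem Feasible.nonneg (hx : N.Feasible x) (hxa : ∀ e, PiecewiseAnalytic N.T (x e)) (e : E) :
    ∀ θ ∈ Ico 0 N.T, 0 ≤ x e θ :=
  (hxa e).hasAnalyticGerms.nonneg_of_ae ((hx.capacity e).mono fun _ h => h.1)

theorem Feasible.le_capacity (hx : N.Feasible x) (hxa : ∀ e, PiecewiseAnalytic N.T (x e))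
    (hu : ∀ e, PiecewiseAnalytic N.T (N.u e)) (e : E) : ∀ θ ∈ Ico 0 N.T, x e θ ≤ N.u e θ := by
  intro θ hθ
  have := ((hu e).hasAnalyticGerms.sub (hxa e).hasAnalyticGerms).nonneg_of_ae
    ((hx.capacity e).mono fun _ h => sub_nonneg.2 h.2) θ hθ
  exact sub_nonneg.1 this

theorem Feasible.hasDerivGerms_Y (hx : N.Feasible x) (hxa : ∀ e, PiecewiseAnalytic N.T (x e))
    (hb : ∀ v, PiecewiseAnalytic N.T (N.b v))
    (hearly : ∀ e, ∀ θ ∈ Ico 0 N.T, θ + N.τ e < 0 → N.u e θ = 0) (v : V) :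
    HasDerivGerms 0 N.T (N.Y x v) := by
  have hshift : ∀ e, HasAnalyticGerms 0 N.T (fun t => N.extend x e (t - N.τ e)) := fun e => by
    have := (hasAnalyticGerms_extend (hxa e).hasAnalyticGerms (0 + -N.τ e) (N.T + -N.τ e)).comp_add
      (-N.τ e)
    simpa [← sub_eq_neg_add] using this
  have hq : HasAnalyticGerms 0 N.T (fun t => ∑ e with N.tgt e = v, N.extend x e (t - N.τ e)
      - ∑ e with N.src e = v, N.extend x e t) :=
    (HasAnalyticGerms.finset_sum fun e _ => hshift e).sub (HasAnalyticGerms.finset_sum fun e _ =>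
      hasAnalyticGerms_extend (hxa e).hasAnalyticGerms 0 N.T)
  have hbg := (hb v).hasAnalyticGerms
  refine (hbg.add hq).hasDerivGerms_integral (c := N.s v) fun θ hθ => ?_
  have hsub : uIcc 0 θ ⊆ uIcc 0 N.T := by
    rw [uIcc_of_le hθ.1, uIcc_of_le N.T_pos.le]
    exact Icc_subset_Icc_right hθ.2
  rw [hx.Y_eq hearly, intervalIntegral.integral_add
    ((hbg.intervalIntegrable N.T_pos.le).mono_set hsub)
    ((hq.intervalIntegrable N.T_pos.le).mono_set hsub), B, add_assoc]

/-- All local requirements on the cells are collected, for all time units simultaneously, into one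
requirement on subintervals of a single time unit `[0,Δ]`; a partition of `[0,Δ]` that meets it is
continued periodically. -/
theorem exists_timeGrid (hT : ∃ q : ℚ, (q : ℝ) = N.T) (hτ : ∀ e, ∃ q : ℚ, (q : ℝ) = N.τ e)
    (hc : ∀ e, PiecewiseAnalytic N.T (N.c e)) (hu : ∀ e, PiecewiseAnalytic N.T (N.u e))
    (hb : ∀ v, PiecewiseAnalytic N.T (N.b v)) (hU : ∀ v, PiecewiseAnalytic N.T (N.U v))
    (hearly : ∀ e, ∀ θ ∈ Ico 0 N.T, θ + N.τ e < 0 → N.u e θ = 0) [Finite V]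
    (hx : N.Feasible x) (hxa : ∀ e, PiecewiseAnalytic N.T (x e)) : Nonempty (TimeGrid N x) := by
  obtain ⟨Δ, K, r, hΔ, hK, hTK, hτr⟩ := exists_common_time_unit (N := N) hT hτ
  -- transport a local property on `[0,T]` to all time units at once
  have fold : ∀ {G : ℝ → ℝ → Prop}, LocallyHolds 0 N.T G →
      LocallyHolds 0 Δ (fun s t => ∀ k : Fin K, G (s + (k : ℕ) * Δ) (t + (k : ℕ) * Δ)) := by
    refine fun hG => LocallyHolds.forall fun k => (hG.comp_add ((k : ℕ) * Δ)).restrict ?_ ?_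
    · have : (0 : ℝ) ≤ (k : ℕ) * Δ := by positivity
      linarith
    · have : ((k : ℕ) : ℝ) + 1 ≤ K := by exact_mod_cast k.2
      rw [hTK]
      nlinarith
  have hcg : ∀ a : E × Fin K, HasAnalyticGerms 0 Δ (fun σ => N.c a.1 ((a.2 : ℕ) * Δ + σ)) := fun a => by
    refine ((hc a.1).hasAnalyticGerms.comp_add ((a.2 : ℕ) * Δ)).mono ?_ ?_
    · have : (0 : ℝ) ≤ (a.2 : ℕ) * Δ := by positivity
      linarith
    · have : ((a.2 : ℕ) : ℝ) + 1 ≤ K := by exact_mod_cast a.2.2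
      rw [hTK]
      nlinarith
  have hUY : ∀ v, LocallyHolds 0 N.T (fun s t => (∀ θ ∈ Ioo s t, N.U v θ - N.Y x v θ = 0) ∨
      ∀ θ ∈ Ioo s t, 0 < N.U v θ - N.Y x v θ) := fun v =>
    ((hU v).hasAnalyticGerms.hasDerivGerms.sub (hx.hasDerivGerms_Y hxa hb hearly v)).locallyHolds_sign
      fun θ hθ => sub_nonneg.2 (hx.storage v θ hθ).2
  have hYs : ∀ v, LocallyHolds 0 N.T (fun s t => (∀ θ ∈ Ioo s t, N.Y x v θ = 0) ∨
      ∀ θ ∈ Ioo s t, 0 < N.Y x v θ) := fun v =>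
    (hx.hasDerivGerms_Y hxa hb hearly v).locallyHolds_sign fun θ hθ => (hx.storage v θ hθ).1
  have hux : ∀ e, LocallyHolds 0 N.T (fun s t => (∀ θ ∈ Ico s t, N.u e θ - x e θ = 0) ∨
      ∀ θ ∈ Ioo s t, 0 < N.u e θ - x e θ) := fun e =>
    ((hu e).hasAnalyticGerms.sub (hxa e).hasAnalyticGerms).locallyHolds_sign
      fun θ hθ => sub_nonneg.2 (hx.le_capacity hxa hu e θ hθ)
  have hxs : ∀ e, LocallyHolds 0 N.T (fun s t => (∀ θ ∈ Ico s t, x e θ = 0) ∨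
      ∀ θ ∈ Ioo s t, 0 < x e θ) := fun e =>
    (hxa e).hasAnalyticGerms.locallyHolds_sign (hx.nonneg hxa e)
  obtain ⟨m, t, ht0, htm, hcell⟩ := ((locallyHolds_analytic_extension hcg).and
    ((LocallyHolds.forall fun e => fold (((hxa e).hasAnalyticGerms.locallyHolds_continuousOn).and
      (((hu e).hasAnalyticGerms.locallyHolds_continuousOn).and ((hxs e).and (hux e))))).and
    (LocallyHolds.forall fun v => fold ((hYs v).and (hUY v))))).exists_partition hΔ.le
  have hm : 0 < m := by
    rcases Nat.eq_zero_or_pos m with rfl | h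
    · rw [ht0] at htm
      exact absurd htm hΔ.ne
    · exact h
  choose! C' hC' using fun j hj => (hcell j hj).2.1
  have hE := fun j hj => (hcell j hj).2.2.1
  have hV := fun j hj => (hcell j hj).2.2.2
  have hm0 : (m : ℤ) ≠ 0 := by positivity
  have hmz : (0 : ℤ) < m := by exact_mod_cast hm
  set d : ℤ → ℝ := fun i => t (i % m).toNat + (i / m : ℤ) * Δ with hd
  have hd1 : ∀ j < m, ∀ k : ℤ, d (j + k * m) = t j + k * Δ := by
    intro j hj k
    have h1 : ((j : ℤ) + k * m) % m = j := by
      rw [Int.add_mul_emod_self_right, Int.emod_eq_of_lt (by positivity) (by exact_mod_cast hj)]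
    have h2 : ((j : ℤ) + k * m) / m = k := by
      rw [Int.add_mul_ediv_right _ _ hm0, Int.ediv_eq_zero_of_lt (by positivity) (by exact_mod_cast hj),
        zero_add]
    simp only [hd, h1, h2, Int.toNat_natCast]
  have hd2 : ∀ j < m, ∀ k : ℤ, d (j + k * m + 1) = t (j + 1) + k * Δ := by
    intro j hj k
    rcases Nat.lt_or_ge (j + 1) m with h | h
    · rw [← hd1 (j + 1) h k]
      congr 1
      push_cast
      ring
    · have h' : j + 1 = m := by omega
      have := hd1 0 hm (k + 1)
      rw [ht0] at this
      rw [show (j : ℤ) + k * m + 1 = ((0 : ℕ) : ℤ) + (k + 1) * m by rw [← h']; push_cast; ring, this, h',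
        htm]
      push_cast
      ring
  have hdecomp : ∀ i : ℤ, ∃ j < m, ∃ k : ℤ, i = j + k * m := fun i => by
    refine ⟨(i % m).toNat, ?_, i / m, ?_⟩
    · have := Int.emod_lt_of_pos i hmz
      have := Int.emod_nonneg i hm0
      omega
    · rw [Int.toNat_of_nonneg (Int.emod_nonneg i hm0)]
      linarith [Int.emod_add_ediv_mul i m]
  have hdecomp' : ∀ i ∈ Ico (0 : ℤ) (K * m), ∃ j < m, ∃ k : Fin K, i = j + ((k : ℕ) : ℤ) * m := by
    intro i hi
    obtain ⟨j, hj, k, rfl⟩ := hdecomp i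
    have hjz : (j : ℤ) < m := by exact_mod_cast hj
    have hk0 : 0 ≤ k := by
      by_contra! h
      have := hi.1
      nlinarith
    have hkK : k < K := by
      by_contra! h
      have h1 := hi.2
      have : (K : ℤ) * m ≤ k * m := by gcongr
      omega
    exact ⟨j, hj, ⟨k.toNat, by omega⟩, by simp [Int.toNat_of_nonneg hk0]⟩
  have ediv : ∀ j < m, ∀ k : ℤ, ((j : ℤ) + k * m) / m = k := fun j hj k => by
    rw [Int.add_mul_ediv_right _ _ hm0, Int.ediv_eq_zero_of_lt (by positivity) (by exact_mod_cast hj),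
      zero_add]
  have emod : ∀ j < m, ∀ k : ℤ, ((j : ℤ) + k * m) % m = j := fun j hj k => by
    rw [Int.add_mul_emod_self_right, Int.emod_eq_of_lt (by positivity) (by exact_mod_cast hj)]
  set C : E → ℤ → ℝ → ℝ := fun e i θ => if h : (i / m).toNat < K then
    C' (i % m).toNat (e, ⟨(i / m).toNat, h⟩) (θ - (i / m : ℤ) * Δ) else 0 with hC
  have hCv : ∀ e, ∀ j < m, ∀ k : Fin K, ∀ θ,
      C e (j + ((k : ℕ) : ℤ) * m) θ = C' j (e, k) (θ - (k : ℕ) * Δ) := by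
    intro e j hj k θ
    simp only [hC, ediv j hj, emod j hj, Int.toNat_natCast, k.2, dif_pos, Int.cast_natCast]
  refine ⟨⟨m, K, Δ, d, r, C, hm, ?_, ?_, ?_, ?_, hτr, ?_, ?_, ?_, ?_, ?_, ?_, ?_, ?_, ?_⟩⟩
  · intro i
    obtain ⟨j, hj, k, rfl⟩ := hdecomp i
    rw [hd1 j hj, hd2 j hj]
    linarith [(hcell j hj).1]
  · have := hd1 0 hm 0
    rw [ht0] at this
    simpa using this
  · intro i k
    obtain ⟨j, hj, k', rfl⟩ := hdecomp i
    rw [add_assoc, ← add_mul, hd1 j hj, hd1 j hj]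
    push_cast
    ring
  · have := hd1 0 hm K
    rw [ht0] at this
    rw [hTK]
    simpa using this
  · intro e i hi θ hθ
    obtain ⟨j, hj, k, rfl⟩ := hdecomp' i hi
    rw [hd1 j hj, hd2 j hj] at hθ
    push_cast at hθ
    rw [hCv e j hj, (hC' j hj).1 (e, k) ⟨by linarith [hθ.1], by linarith [hθ.2]⟩]
    exact congrArg (N.c e) (add_sub_cancel _ _)
  · intro e i hi θ hθ
    obtain ⟨j, hj, k, rfl⟩ := hdecomp' i hi
    rw [hd1 j hj, hd2 j hj] at hθ
    push_cast at hθ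
    have h1 : C e (j + ((k : ℕ) : ℤ) * m) = fun θ => C' j (e, k) (θ - (k : ℕ) * Δ) :=
      funext (hCv e j hj k)
    rw [h1]
    exact ((hC' j hj).2.1 (e, k) (θ - (k : ℕ) * Δ) ⟨by linarith [hθ.1], by linarith [hθ.2]⟩).comp_of_eq
      (by fun_prop) rfl
  · intro j hj l hl
    obtain ⟨j, rfl⟩ := Int.eq_ofNat_of_zero_le hj.1
    have hj' : j < m := by exact_mod_cast hj.2
    have e1 := hd1 j hj' 0
    have e2 := hd2 j hj' 0
    simp only [zero_mul, add_zero, Int.cast_zero] at e1 e2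
    rw [e1, e2]
    simpa only [hCv _ j hj', add_sub_cancel_right] using (hC' j hj').2.2 l hl
  · intro e i hi
    obtain ⟨j, hj, k, rfl⟩ := hdecomp' i hi
    rw [hd1 j hj, hd2 j hj]
    exact_mod_cast (hE j hj e k).1
  · intro e i hi
    obtain ⟨j, hj, k, rfl⟩ := hdecomp' i hi
    rw [hd1 j hj, hd2 j hj]
    exact_mod_cast (hE j hj e k).2.1
  · intro e i hi
    obtain ⟨j, hj, k, rfl⟩ := hdecomp' i hi
    rw [hd1 j hj, hd2 j hj]
    exact_mod_cast (hE j hj e k).2.2.1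
  · intro e i hi
    obtain ⟨j, hj, k, rfl⟩ := hdecomp' i hi
    rw [hd1 j hj, hd2 j hj]
    exact (hE j hj e k).2.2.2.imp (fun h θ hθ => (sub_eq_zero.1 (h θ (by exact_mod_cast hθ))).symm)
      fun h θ hθ => sub_pos.1 (h θ (by exact_mod_cast hθ))
  · intro v i hi
    obtain ⟨j, hj, k, rfl⟩ := hdecomp' i hi
    rw [hd1 j hj, hd2 j hj]
    exact_mod_cast (hV j hj v k).1
  · intro v i hi
    obtain ⟨j, hj, k, rfl⟩ := hdecomp' i hi
    rw [hd1 j hj, hd2 j hj]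
    exact (hV j hj v k).2.imp (fun h θ hθ => (sub_eq_zero.1 (h θ (by exact_mod_cast hθ))).symm)
      fun h θ hθ => sub_pos.1 (h θ (by exact_mod_cast hθ))

end FlowNetwork

/-! ### Bump functions and domination by slack -/

/-- The function rising linearly from `0` at `α` to `1` at `α + h`. -/
noncomputable def ramp (h α θ : ℝ) : ℝ := max 0 (min 1 ((θ - α) / h))

/-- The density of the uniform distribution on `[α, α + h)`, the derivative of `ramp`. -/
noncomputable def bump (h α : ℝ) : ℝ → ℝ := (Ico α (α + h)).indicator fun _ => 1 / h

theorem ramp_nonneg (h α θ : ℝ) : 0 ≤ ramp h α θ := le_max_left _ _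

theorem ramp_le_one (h α θ : ℝ) : ramp h α θ ≤ 1 := max_le zero_le_one (min_le_left _ _)

theorem ramp_of_le {h α θ : ℝ} (hh : 0 < h) (hθ : θ ≤ α) : ramp h α θ = 0 :=
  max_eq_left ((min_le_right _ _).trans (div_nonpos_of_nonpos_of_nonneg (sub_nonpos.2 hθ) hh.le))

theorem ramp_of_ge {h α θ : ℝ} (hh : 0 < h) (hθ : α + h ≤ θ) : ramp h α θ = 1 := by
  have : 1 ≤ (θ - α) / h := by rw [le_div_iff₀ hh]; linarith
  simp [ramp, min_eq_left this]

theorem ramp_anti {h α β θ : ℝ} (hh : 0 < h) (hαβ : α ≤ β) : ramp h β θ ≤ ramp h α θ := by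
  unfold ramp
  gcongr

theorem ramp_add (h α c θ : ℝ) : ramp h (α + c) θ = ramp h α (θ - c) := by
  unfold ramp
  congr 3
  ring

theorem bump_nonneg {h : ℝ} (hh : 0 < h) (α θ : ℝ) : 0 ≤ bump h α θ :=
  indicator_nonneg (fun _ _ => (one_div_pos.2 hh).le) θ

theorem bump_le {h : ℝ} (hh : 0 < h) (α θ : ℝ) : bump h α θ ≤ 1 / h :=
  indicator_le_self' (fun _ _ => (one_div_pos.2 hh).le) θ

theorem bump_of_notMem {h α θ : ℝ} (hθ : θ ∉ Icc α (α + h)) : bump h α θ = 0 :=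
  indicator_of_notMem (fun h' => hθ (Ico_subset_Icc_self h')) _

theorem measurable_bump (h α : ℝ) : Measurable (bump h α) :=
  measurable_const.indicator measurableSet_Ico

theorem integrable_bump (h α : ℝ) : Integrable (bump h α) :=
  (integrable_indicator_iff measurableSet_Ico).2 (by simp)

theorem memLp_bump {h : ℝ} (hh : 0 < h) (α : ℝ) (μ : Measure ℝ) : MemLp (bump h α) ⊤ μ := by
  refine memLp_top_of_bound (measurable_bump h α).aestronglyMeasurable (1 / h)
    (Eventually.of_forall fun θ => ?_)
  rw [Real.norm_of_nonneg (bump_nonneg hh α θ)]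
  exact bump_le hh α θ

theorem integral_bump {h α c : ℝ} (hh : 0 < h) (hα : 0 ≤ α) (hc : 0 ≤ c) :
    ∫ t in (0 : ℝ)..c, bump h α t = ramp h α c := by
  have hset : Ico 0 c ∩ Ico α (α + h) = Ico α (min c (α + h)) := by
    rw [Ico_inter_Ico, sup_of_le_right hα]
  rw [intervalIntegral.integral_of_le hc, ← integral_Ico_eq_integral_Ioc, bump,
    setIntegral_indicator measurableSet_Ico, hset, setIntegral_const, Real.volume_real_Ico, smul_eq_mul]
  rcases le_total c α with h1 | h1
  · rw [ramp_of_le hh h1, max_eq_right (sub_nonpos.2 ((min_le_left _ _).trans h1)), zero_mul]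
  rcases le_total (α + h) c with h2 | h2
  · rw [ramp_of_ge hh h2, min_eq_right h2, add_sub_cancel_left, max_eq_left hh.le,
      mul_one_div_cancel hh.ne']
  · have h3 : (c - α) / h ≤ 1 := by rw [div_le_one hh]; linarith
    rw [min_eq_left h2, max_eq_left (sub_nonneg.2 h1), ramp, min_eq_right h3,
      max_eq_right (div_nonneg (sub_nonneg.2 h1) hh.le), mul_one_div]

theorem integral_bump_clamp {T h α : ℝ} (hT : 0 ≤ T) (hh : 0 < h) (hα : 0 ≤ α) (hαT : α + h ≤ T)
    (θ : ℝ) : ∫ t in (0 : ℝ)..clamp T θ, bump h α t = ramp h α θ := by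
  rw [integral_bump hh hα (show 0 ≤ clamp T θ from le_max_left _ _)]
  rcases le_total θ 0 with h1 | h1
  · rw [show clamp T θ = 0 from max_eq_left ((min_le_left _ _).trans h1), ramp_of_le hh hα,
      ramp_of_le hh (h1.trans hα)]
  rcases le_total θ T with h2 | h2
  · rw [show clamp T θ = θ by simp [clamp, h1, h2]]
  · rw [show clamp T θ = T by simp [clamp, h2, hT], ramp_of_ge hh hαT, ramp_of_ge hh (hαT.trans h2)]

/-- A bounded function supported in a compact set on which `g` is positive is dominated by a multiple
of `g`. -/
theorem exists_le_mul_of_compact {S J : Set ℝ} {f g : ℝ → ℝ} {M : ℝ} (hM : 0 ≤ M)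
    (hf : ∀ θ ∈ S, f θ ≤ M) (hJ : IsCompact J) (hfJ : ∀ θ ∈ S, θ ∉ J → f θ = 0)
    (hg : ContinuousOn g J) (hgpos : ∀ θ ∈ J, 0 < g θ) (hg0 : ∀ θ ∈ S, 0 ≤ g θ) :
    ∃ κ, 0 ≤ κ ∧ ∀ θ ∈ S, f θ ≤ κ * g θ := by
  rcases J.eq_empty_or_nonempty with rfl | hne
  · exact ⟨0, le_rfl, fun θ hθ => by rw [hfJ θ hθ (notMem_empty θ), zero_mul]⟩
  obtain ⟨z, hz, hmin⟩ := hJ.exists_isMinOn hne hg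
  have hz0 := hgpos z hz
  refine ⟨M / g z, by positivity, fun θ hθ => ?_⟩
  by_cases h : θ ∈ J
  · rw [div_mul_eq_mul_div, le_div_iff₀ hz0]
    have h1 : g z ≤ g θ := hmin h
    calc f θ * g z ≤ M * g z := mul_le_mul_of_nonneg_right (hf θ hθ) hz0.le
      _ ≤ M * g θ := mul_le_mul_of_nonneg_left h1 hM
  · rw [hfJ θ hθ h]
    have := hg0 θ hθ
    positivity

/-- A function `a * f` is dominated by the slack of the constraint towards which it moves, if that slack
is positive on the support of `f`. -/
theorem exists_signed_le_mul {S J : Set ℝ} {f : ℝ → ℝ} {g : Bool → ℝ → ℝ} {M a : ℝ} (hM : 0 ≤ M)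
    (hf0 : ∀ θ ∈ S, 0 ≤ f θ) (hf : ∀ θ ∈ S, f θ ≤ M) (hJ : IsCompact J)
    (hfJ : ∀ θ ∈ S, θ ∉ J → f θ = 0) (hg : ∀ s, ContinuousOn (g s) J)
    (hg0 : ∀ s, ∀ θ ∈ S, 0 ≤ g s θ)
    (hpos : 0 < a → ∀ θ ∈ J, 0 < g false θ) (hneg : a < 0 → ∀ θ ∈ J, 0 < g true θ) :
    ∃ κ, 0 ≤ κ ∧ ∀ θ ∈ S, a * f θ ≤ κ * g false θ ∧ -(a * f θ) ≤ κ * g true θ := by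
  have key : ∀ s, (a ≠ 0 → ∀ θ ∈ J, 0 < g s θ) →
      ∃ κ, 0 ≤ κ ∧ ∀ θ ∈ S, |a| * f θ ≤ κ * g s θ := by
    intro s hs
    rcases eq_or_ne a 0 with rfl | ha
    · exact ⟨0, le_rfl, fun θ _ => by simp⟩
    · exact exists_le_mul_of_compact (f := fun θ => |a| * f θ) (M := |a| * M) (by positivity)
        (fun θ hθ => mul_le_mul_of_nonneg_left (hf θ hθ) (abs_nonneg a)) hJ
        (fun θ hθ h => by rw [hfJ θ hθ h, mul_zero]) (hg s) (hs ha) (hg0 s)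
  rcases lt_trichotomy a 0 with h | h | h
  · obtain ⟨κ, h1, h2⟩ := key true fun _ => hneg h
    refine ⟨κ, h1, fun θ hθ => ⟨?_, ?_⟩⟩
    · exact (mul_nonpos_of_nonpos_of_nonneg h.le (hf0 θ hθ)).trans (mul_nonneg h1 (hg0 _ θ hθ))
    · have := h2 θ hθ
      rwa [abs_of_neg h, neg_mul] at this
  · exact ⟨0, le_rfl, fun θ _ => by simp [h]⟩
  · obtain ⟨κ, h1, h2⟩ := key false fun _ => hpos h
    refine ⟨κ, h1, fun θ hθ => ⟨?_, ?_⟩⟩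
    · have := h2 θ hθ
      rwa [abs_of_pos h] at this
    · have := mul_nonneg h.le (hf0 θ hθ)
      have := mul_nonneg h1 (hg0 true θ hθ)
      linarith

/-- Averages over windows `[p + β h, p + (β + 1) h]` shrinking to a point `p` of continuity. -/
theorem tendsto_average_window {f : ℝ → ℝ} {p : ℝ} (hf : ∀ᶠ θ in 𝓝 p, ContinuousAt f θ) (β : ℝ) :
    Tendsto (fun h => (1 / h) * ∫ t in (p + β * h)..(p + β * h + h), f t) (𝓝[>] 0) (𝓝 (f p)) := by
  rw [Metric.tendsto_nhds]
  intro ε hε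
  have hclose : ∀ᶠ θ in 𝓝 p, |f θ - f p| < ε / 2 ∧ ContinuousAt f θ :=
    (hf.self_of_nhds.eventually (Metric.ball_mem_nhds (f p) (half_pos hε))).and hf
  obtain ⟨r, hr, hball⟩ := Metric.eventually_nhds_iff.1 hclose
  filter_upwards [Ioo_mem_nhdsGT (show (0 : ℝ) < r / (|β| + 1) by positivity)] with h hh
  have hh0 : 0 < h := hh.1
  have hwin : ∀ t ∈ Icc (p + β * h) (p + β * h + h), |f t - f p| < ε / 2 ∧ ContinuousAt f t := by
    intro t ht
    refine hball ?_
    have h1 : h * (|β| + 1) < r := (lt_div_iff₀ (by positivity)).1 hh.2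
    have h2 : β * h ≤ |β| * h := mul_le_mul_of_nonneg_right (le_abs_self β) hh0.le
    have h3 : -(|β| * h) ≤ β * h := by
      have := mul_le_mul_of_nonneg_right (neg_abs_le β) hh0.le
      linarith
    rw [Real.dist_eq, abs_lt]
    constructor <;> linarith [ht.1, ht.2]
  have hle : p + β * h ≤ p + β * h + h := by linarith
  have hint : IntervalIntegrable f volume (p + β * h) (p + β * h + h) :=
    ContinuousOn.intervalIntegrable_of_Icc hle fun t ht => (hwin t ht).2.continuousWithinAt
  have h4 : ‖∫ t in (p + β * h)..(p + β * h + h), (f t - f p)‖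
      ≤ ε / 2 * |p + β * h + h - (p + β * h)| := by
    refine intervalIntegral.norm_integral_le_of_norm_le_const fun t ht => ?_
    rw [uIoc_of_le hle] at ht
    exact (hwin t (Ioc_subset_Icc_self ht)).1.le
  rw [intervalIntegral.integral_sub hint (by simp), intervalIntegral.integral_const,
    add_sub_cancel_left, smul_eq_mul, abs_of_pos hh0, Real.norm_eq_abs] at h4
  rw [Real.dist_eq]
  have h5 : (1 / h) * (∫ t in (p + β * h)..(p + β * h + h), f t) - f p
      = (1 / h) * ((∫ t in (p + β * h)..(p + β * h + h), f t) - h * f p) := by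
    field_simp
  rw [h5, abs_mul, abs_of_pos (one_div_pos.2 hh0)]
  calc 1 / h * |(∫ t in (p + β * h)..(p + β * h + h), f t) - h * f p| ≤ 1 / h * (ε / 2 * h) := by
        gcongr
    _ = ε / 2 := by field_simp
    _ < ε := half_lt_self hε

/-! ### The residual network on the time grid -/

namespace FlowNetwork

variable {V E : Type*} {N : FlowNetwork V E} {x : E → ℝ → ℝ}

/-- By how much the flow rate on an arc can be increased (`false`) or decreased (`true`). -/
def flowSlack (N : FlowNetwork V E) (x : E → ℝ → ℝ) (e : E) : Bool → ℝ → ℝ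
  | false => fun θ => N.u e θ - x e θ
  | true => x e

variable [Fintype E] [DecidableEq V]

/-- By how much the storage in a node can be increased (`false`) or decreased (`true`). -/
noncomputable def storageSlack (N : FlowNetwork V E) (x : E → ℝ → ℝ) (v : V) : Bool → ℝ → ℝ
  | false => fun θ => N.U v θ - N.Y x v θ
  | true => N.Y x v

theorem Feasible.continuousOn_Y (hx : N.Feasible x) (hb : ∀ v, PiecewiseAnalytic N.T (N.b v))
    (hearly : ∀ e, ∀ θ ∈ Ico 0 N.T, θ + N.τ e < 0 → N.u e θ = 0) (v : V) :
    ContinuousOn (N.Y x v) (Icc 0 N.T) := by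
  have hi := fun e => integrable_extend (integrableOn_of_memLp (hx.memLp e))
  have hB : ContinuousOn (N.B v) (Icc 0 N.T) := by
    have hbi := (hb v).hasAnalyticGerms.intervalIntegrable N.T_pos.le
    have := intervalIntegral.continuousOn_primitive_interval
      (μ := volume) (f := N.b v) (a := 0) (b := N.T) (by
        rw [uIcc_of_le N.T_pos.le]
        exact (intervalIntegrable_iff_integrableOn_Icc_of_le N.T_pos.le).1 hbi)
    rw [uIcc_of_le N.T_pos.le] at this
    exact continuousOn_const.add this
  refine (hB.add (Continuous.continuousOn (f := fun θ => ∫ t in (0 : ℝ)..θ,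
    (∑ e with N.tgt e = v, N.extend x e (t - N.τ e) - ∑ e with N.src e = v, N.extend x e t)) ?_)).congr
    fun θ _ => hx.Y_eq hearly v θ
  exact intervalIntegral.continuous_primitive (fun a b => ((integrable_finsetSum _ fun e _ =>
    (hi e).comp_sub_right (N.τ e)).sub (integrable_finsetSum _ fun e _ => hi e)).intervalIntegrable) 0

namespace TimeGrid

variable (G : TimeGrid N x)

/-- Number of windows: two for each cell, near its left and its right end. The window `n` belongs to
the cell `n / 2` and lies near the grid point `d ((n + 1) / 2)`. -/
def size : ℕ := 2 * (G.K * G.m)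

/-- The node `v` in window `n`; all windows from time `T` on are merged into a sink `none`. -/
def node (v : V) (n : ℤ) : Option (V × ℤ) := if n < G.size then some (v, n) else none

/-- The arcs of the time-expanded network: an arc `e` used in window `n`, or storage in a node from
window `n` to window `n + 1`. -/
abbrev BaseArc := (E × Fin G.size) ⊕ (V × Fin G.size)

/-- tail of an arc of the time-expanded network -/
def tail : G.BaseArc → Option (V × ℤ)
  | .inl (e, n) => some (N.src e, (n : ℕ))
  | .inr (v, n) => some (v, (n : ℕ))

/-- head of an arc of the time-expanded network -/
def head : G.BaseArc → Option (V × ℤ)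
  | .inl (e, n) => G.node (N.tgt e) ((n : ℕ) + 2 * (G.r e * G.m))
  | .inr (v, n) => G.node v ((n : ℕ) + 1)

/-- cost of an arc of the time-expanded network, the limit of the transit cost in the cell at the grid
point near the window -/
def weight : G.BaseArc → ℝ
  | .inl (e, n) => G.C e ((n : ℕ) / 2 : ℤ) (G.d (((n : ℕ) + 1) / 2 : ℤ))
  | .inr _ => 0

/-- The times at which flow stored from window `n` to window `n + 1` needs slack: the open cell if both
windows lie in the same cell, and the grid point between the windows otherwise. -/
def holdSet (n : ℤ) : Set ℝ :=
  if n % 2 = 0 then Ioo (G.d (n / 2)) (G.d (n / 2 + 1)) else {G.d (n / 2 + 1)}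

/-- Residual arcs: `(b, false)` if the flow along `b` can be increased, `(b, true)` if it can be
decreased. -/
def Residual : G.BaseArc × Bool → Prop
  | (.inl (e, n), s) => ∀ θ ∈ Ioo (G.d ((n : ℕ) / 2 : ℤ)) (G.d ((n : ℕ) / 2 + 1 : ℤ)),
      0 < N.flowSlack x e s θ
  | (.inr (v, n), s) => ∀ θ ∈ G.holdSet (n : ℕ), 0 < N.storageSlack x v s θ

variable {G}

theorem d_strictMono : StrictMono G.d := strictMono_int_of_lt_succ G.d_lt

theorem div_two_mem (n : Fin G.size) : ((n : ℕ) / 2 : ℤ) ∈ Ico (0 : ℤ) (G.K * G.m) := by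
  have := n.2
  simp only [size] at this
  have h2 : ((n : ℕ) : ℤ) < 2 * (G.K * G.m) := by exact_mod_cast this
  exact ⟨by positivity, by omega⟩

theorem d_mem_Icc {i : ℤ} (h0 : 0 ≤ i) (h1 : i ≤ G.K * G.m) : G.d i ∈ Icc 0 N.T :=
  ⟨G.d_zero ▸ d_strictMono.monotone h0, G.d_end ▸ d_strictMono.monotone h1⟩

theorem cell_subset {i : ℤ} (hi : i ∈ Ico (0 : ℤ) (G.K * G.m)) :
    Ico (G.d i) (G.d (i + 1)) ⊆ Ico 0 N.T := fun _ hθ =>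
  ⟨(d_mem_Icc hi.1 hi.2.le).1.trans hθ.1, hθ.2.trans_le (d_mem_Icc (by linarith [hi.1]) hi.2).2⟩

theorem eventually_spacing : ∀ᶠ h in 𝓝[>] (0 : ℝ), ∀ i, 4 * h < G.d (i + 1) - G.d i := by
  have h1 : ∀ᶠ h in 𝓝[>] (0 : ℝ), ∀ j ∈ Ico (0 : ℤ) G.m, 4 * h < G.d (j + 1) - G.d j := by
    refine (eventually_all_finite (finite_Ico 0 (G.m : ℤ))).2 fun j _ => ?_
    have : (0 : ℝ) < (G.d (j + 1) - G.d j) / 4 := by linarith [G.d_lt j]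
    filter_upwards [Ioo_mem_nhdsGT this] with h hh
    linarith [hh.2]
  filter_upwards [h1] with h hh i
  have hm : (0 : ℤ) < G.m := by exact_mod_cast G.m_pos
  have h2 := hh (i % G.m) ⟨Int.emod_nonneg _ hm.ne', Int.emod_lt_of_pos _ hm⟩
  have h3 : i = i % G.m + i / G.m * G.m := by linarith [Int.emod_add_ediv_mul i G.m]
  have h4 := G.d_add (i % G.m) (i / G.m)
  have h5 := G.d_add (i % G.m + 1) (i / G.m)
  rw [← h3] at h4
  rw [add_right_comm, ← h3] at h5
  linarith

variable (G) in
/-- Start of window `n`, for windows of length `h`. Window `2 i` is `[d i + h, d i + 2 h]` and window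
`2 i + 1` is `[d (i + 1) - 2 h, d (i + 1) - h]`; both keep the distance `h` from the grid points, at
which capacities need not be continuous and slack may vanish. -/
noncomputable def start (h : ℝ) (n : ℤ) : ℝ :=
  G.d ((n + 1) / 2) + (if n % 2 = 0 then 1 else -2) * h

theorem start_even (h : ℝ) (i : ℤ) : G.start h (2 * i) = G.d i + h := by
  rw [start, show (2 * i + 1) / 2 = i by omega, if_pos (by omega), one_mul]

theorem start_odd (h : ℝ) (i : ℤ) : G.start h (2 * i + 1) = G.d (i + 1) - 2 * h := by
  rw [start, show (2 * i + 1 + 1) / 2 = i + 1 by omega, if_neg (by omega)]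
  ring

theorem start_add (h : ℝ) (n k : ℤ) :
    G.start h (n + 2 * (k * G.m)) = G.start h n + k * G.Δ := by
  rw [start, start, show (n + 2 * (k * G.m) + 1) / 2 = (n + 1) / 2 + k * G.m by omega,
    show (n + 2 * (k * G.m)) % 2 = n % 2 by omega, G.d_add]
  ring

theorem even_or_odd_eq (n : ℤ) : (∃ i, n = 2 * i) ∨ ∃ i, n = 2 * i + 1 := by
  rcases Int.emod_two_eq_zero_or_one n with h | h
  · exact .inl ⟨n / 2, by omega⟩
  · exact .inr ⟨n / 2, by omega⟩

theorem start_le_start_succ {h : ℝ} (hh : 0 < h) (hsp : ∀ i, 4 * h < G.d (i + 1) - G.d i) (n : ℤ) :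
    G.start h n ≤ G.start h (n + 1) := by
  rcases even_or_odd_eq n with ⟨i, rfl⟩ | ⟨i, rfl⟩
  · rw [start_even, start_odd]
    linarith [hsp i]
  · rw [start_odd, show 2 * i + 1 + 1 = 2 * (i + 1) by ring, start_even]
    linarith

theorem window_subset {h : ℝ} (hh : 0 < h) (hsp : ∀ i, 4 * h < G.d (i + 1) - G.d i) (n : ℤ) :
    Icc (G.start h n) (G.start h n + h) ⊆ Ioo (G.d (n / 2)) (G.d (n / 2 + 1)) := by
  intro θ hθ
  rcases even_or_odd_eq n with ⟨i, rfl⟩ | ⟨i, rfl⟩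
  · rw [start_even] at hθ
    rw [show 2 * i / 2 = i by omega]
    constructor <;> linarith [hsp i, hθ.1, hθ.2]
  · rw [start_odd] at hθ
    rw [show (2 * i + 1) / 2 = i by omega]
    constructor <;> linarith [hsp i, hθ.1, hθ.2]

theorem le_start_of_size_le {h : ℝ} (hh : 0 < h) (hsp : ∀ i, 4 * h < G.d (i + 1) - G.d i) {n : ℤ}
    (hn : G.size ≤ n) : N.T ≤ G.start h n := by
  have h1 := window_subset hh hsp n (left_mem_Icc.2 (by linarith))
  have h2 : (G.K * G.m : ℤ) ≤ n / 2 := by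
    simp only [size] at hn
    push_cast at hn
    omega
  have := d_strictMono.monotone (f := G.d) h2
  rw [G.d_end] at this
  linarith [h1.1]

theorem continuousOn_storageSlack (hx : N.Feasible x) (hb : ∀ v, PiecewiseAnalytic N.T (N.b v))
    (hUcont : ∀ v, ContinuousOn (N.U v) (Icc 0 N.T))
    (hearly : ∀ e, ∀ θ ∈ Ico 0 N.T, θ + N.τ e < 0 → N.u e θ = 0) (v : V) (s : Bool) :
    ContinuousOn (N.storageSlack x v s) (Icc 0 N.T) := by
  have := hx.continuousOn_Y hb hearly v
  cases s
  · exact (hUcont v).sub this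
  · exact this

/-- For short windows, storage slack extends from `holdSet n` to the whole time span between the
windows `n` and `n + 1`. -/
theorem eventually_hold [Finite V]
    (hcont : ∀ v s, ContinuousOn (N.storageSlack x v s) (Icc 0 N.T)) :
    ∀ᶠ h in 𝓝[>] (0 : ℝ), ∀ (v : V) (n : Fin G.size) (s : Bool),
      (∀ θ ∈ G.holdSet (n : ℕ), 0 < N.storageSlack x v s θ) →
      ∀ θ ∈ Icc (G.start h (n : ℕ)) (G.start h ((n : ℕ) + 1) + h) ∩ Icc 0 N.T,
        0 < N.storageSlack x v s θ := by
  refine eventually_all.2 fun v => eventually_all.2 fun n => eventually_all.2 fun s => ?_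
  by_cases hs : ∀ θ ∈ G.holdSet (n : ℕ), 0 < N.storageSlack x v s θ
  swap
  · exact Eventually.of_forall fun h h' => absurd h' hs
  have hn := div_two_mem n
  rcases even_or_odd_eq ((n : ℕ) : ℤ) with ⟨i, hi⟩ | ⟨i, hi⟩
  · rw [hi] at hs ⊢
    filter_upwards [self_mem_nhdsWithin] with h (hh : 0 < h) _ θ hθ
    refine hs θ ?_
    rw [start_even, start_odd] at hθ
    rw [holdSet, if_pos (by omega), show 2 * i / 2 = i by omega]
    constructor <;> linarith [hθ.1.1, hθ.1.2]
  · rw [hi] at hs hn ⊢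
    rw [holdSet, if_neg (by omega), show (2 * i + 1) / 2 = i by omega] at hs
    rw [show (2 * i + 1) / 2 = i by omega] at hn
    have h1 := hs _ rfl
    have h2 := (hcont v s _ (d_mem_Icc (by linarith [hn.1]) hn.2)).eventually (lt_mem_nhds h1)
    obtain ⟨ε, hε, hball⟩ := Metric.mem_nhdsWithin_iff.1 h2
    filter_upwards [Ioo_mem_nhdsGT (show (0 : ℝ) < ε / 2 by positivity)] with h hh _ θ hθ
    refine hball ⟨?_, hθ.2⟩
    rw [start_odd, show 2 * i + 1 + 1 = 2 * (i + 1) by ring, start_even] at hθ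
    rw [Metric.mem_ball, Real.dist_eq, abs_lt]
    constructor <;> linarith [hθ.1.1, hθ.1.2, hh.2]

end TimeGrid

end FlowNetwork

/-! ### Optimal flows admit no negative residual circulation -/

theorem exists_signed_sum_le_mul {ι : Type*} [Fintype ι] {S : Set ℝ} {f : ι → ℝ → ℝ}
    {g : Bool → ℝ → ℝ}
    (h : ∀ i, ∃ κ, 0 ≤ κ ∧ ∀ θ ∈ S, f i θ ≤ κ * g false θ ∧ -f i θ ≤ κ * g true θ) :
    ∃ κ, 0 ≤ κ ∧ ∀ θ ∈ S, ∑ i, f i θ ≤ κ * g false θ ∧ -∑ i, f i θ ≤ κ * g true θ := by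
  choose κ h0 h1 using h
  refine ⟨∑ i, κ i, Finset.sum_nonneg fun i _ => h0 i, fun θ hθ => ⟨?_, ?_⟩⟩
  · rw [Finset.sum_mul]
    exact Finset.sum_le_sum fun i _ => (h1 i θ hθ).1
  · rw [Finset.sum_mul, ← Finset.sum_neg_distrib]
    exact Finset.sum_le_sum fun i _ => (h1 i θ hθ).2

namespace FlowNetwork

variable {V E : Type*} {N : FlowNetwork V E} {x : E → ℝ → ℝ} [Fintype E] [DecidableEq V]

namespace TimeGrid

variable {G : TimeGrid N x}

section Perturbation

variable (G) in
/-- The flow variation that sends `a (e, n)` units of flow into `e` during window `n`. -/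
noncomputable def variation (h : ℝ) (a : G.BaseArc → ℝ) (e : E) (θ : ℝ) : ℝ :=
  ∑ n : Fin G.size, a (.inl (e, n)) * bump h (G.start h (n : ℕ)) θ

variable (G) in
/-- The storage variation in `v`: `a (v, n)` units are stored from window `n` to window `n + 1`. Storage
builds up at constant rate during the first window and is released during the second one. -/
noncomputable def storageVariation (h : ℝ) (a : G.BaseArc → ℝ) (v : V) (θ : ℝ) : ℝ :=
  ∑ n : Fin G.size, a (.inr (v, n)) *
    (ramp h (G.start h (n : ℕ)) θ - ramp h (G.start h ((n : ℕ) + 1)) θ)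

variable {h : ℝ} {a : G.BaseArc → ℝ}

theorem memLp_variation (hh : 0 < h) (e : E) (μ : Measure ℝ) : MemLp (G.variation h a e) ⊤ μ :=
  memLp_finsetSum _ fun _ _ => (memLp_bump hh _ μ).const_mul _

/-- On each window the flow varies only in a direction in which there is slack throughout. -/
theorem variation_dominated (hh : 0 < h) (hsp : ∀ i, 4 * h < G.d (i + 1) - G.d i)
    (hx0 : ∀ e, ∀ θ ∈ Ico 0 N.T, 0 ≤ x e θ) (hxu : ∀ e, ∀ θ ∈ Ico 0 N.T, x e θ ≤ N.u e θ)
    (hpos : ∀ b, 0 < a b → G.Residual (b, false)) (hneg : ∀ b, a b < 0 → G.Residual (b, true))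
    (e : E) : ∃ κ, 0 ≤ κ ∧ ∀ θ ∈ Ico 0 N.T,
      G.variation h a e θ ≤ κ * N.flowSlack x e false θ ∧
      -G.variation h a e θ ≤ κ * N.flowSlack x e true θ := by
  refine exists_signed_sum_le_mul fun n => ?_
  have hsub := window_subset hh hsp ((n : ℕ) : ℤ)
  have hn := div_two_mem n
  refine exists_signed_le_mul (M := 1 / h) (one_div_pos.2 hh).le (fun θ _ => bump_nonneg hh _ θ)
    (fun θ _ => bump_le hh _ θ) isCompact_Icc (fun θ _ h' => bump_of_notMem h') (fun s => ?_)
    (fun s θ hθ => ?_) (fun h' θ hθ => hpos _ h' θ (hsub hθ)) (fun h' θ hθ => hneg _ h' θ (hsub hθ))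
  · have h1 := (G.x_cont e _ hn).mono hsub
    have h2 := (G.u_cont e _ hn).mono hsub
    cases s
    · exact h2.sub h1
    · exact h1
  · cases s
    · exact sub_nonneg.2 (hxu e θ hθ)
    · exact hx0 e θ hθ

theorem storageVariation_dominated (hh : 0 < h) (hsp : ∀ i, 4 * h < G.d (i + 1) - G.d i)
    (hcont : ∀ v s, ContinuousOn (N.storageSlack x v s) (Icc 0 N.T))
    (hst : ∀ v s, ∀ θ ∈ Icc 0 N.T, 0 ≤ N.storageSlack x v s θ)
    (hhold : ∀ (v : V) (n : Fin G.size) (s : Bool),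
      (∀ θ ∈ G.holdSet (n : ℕ), 0 < N.storageSlack x v s θ) →
      ∀ θ ∈ Icc (G.start h (n : ℕ)) (G.start h ((n : ℕ) + 1) + h) ∩ Icc 0 N.T,
        0 < N.storageSlack x v s θ)
    (hpos : ∀ b, 0 < a b → G.Residual (b, false)) (hneg : ∀ b, a b < 0 → G.Residual (b, true))
    (v : V) : ∃ κ, 0 ≤ κ ∧ ∀ θ ∈ Icc 0 N.T,
      G.storageVariation h a v θ ≤ κ * N.storageSlack x v false θ ∧
      -G.storageVariation h a v θ ≤ κ * N.storageSlack x v true θ := by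
  refine exists_signed_sum_le_mul fun n => ?_
  have hle := start_le_start_succ hh hsp ((n : ℕ) : ℤ)
  refine exists_signed_le_mul (M := 1) zero_le_one
    (f := fun θ => ramp h (G.start h (n : ℕ)) θ - ramp h (G.start h ((n : ℕ) + 1)) θ)
    (fun θ _ => sub_nonneg.2 (ramp_anti hh hle)) (fun θ _ => ?_)
    (isCompact_Icc.inter isCompact_Icc) (fun θ hθ h' => ?_)
    (fun s => (hcont v s).mono inter_subset_right) (fun s θ hθ => hst v s θ hθ)
    (fun h' => hhold v n false (hpos _ h')) (fun h' => hhold v n true (hneg _ h'))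
  · linarith [ramp_le_one h (G.start h (n : ℕ)) θ, ramp_nonneg h (G.start h ((n : ℕ) + 1)) θ]
  rcases lt_or_ge θ (G.start h (n : ℕ)) with h1 | h1
  · rw [ramp_of_le hh h1.le, ramp_of_le hh (h1.le.trans hle), sub_self]
  rcases lt_or_ge (G.start h ((n : ℕ) + 1) + h) θ with h2 | h2
  · rw [ramp_of_ge hh h2.le, ramp_of_ge hh (by linarith), sub_self]
  · exact absurd ⟨⟨h1, h2⟩, hθ⟩ h'

theorem start_mem (hh : 0 < h) (hsp : ∀ i, 4 * h < G.d (i + 1) - G.d i) (n : Fin G.size) :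
    0 ≤ G.start h (n : ℕ) ∧ G.start h (n : ℕ) + h ≤ N.T := by
  have hsub := window_subset hh hsp ((n : ℕ) : ℤ)
  have hc := (Ioo_subset_Ico_self).trans (cell_subset (G := G) (div_two_mem n))
  exact ⟨(hc (hsub (left_mem_Icc.2 (by linarith)))).1, (hc (hsub (right_mem_Icc.2 (by linarith)))).2.le⟩

theorem X_variation (hh : 0 < h) (hsp : ∀ i, 4 * h < G.d (i + 1) - G.d i) {δ : ℝ} {e : E}
    (hx : IntegrableOn (x e) (Ico 0 N.T)) (θ : ℝ) :
    N.X (fun e θ => x e θ + δ * G.variation h a e θ) e θ = N.X x e θ + δ *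
      ∑ n : Fin G.size, a (.inl (e, n)) * ramp h (G.start h (n : ℕ)) θ := by
  have hT := N.T_pos.le
  have hcl : clamp N.T θ ∈ Icc 0 N.T := ⟨le_max_left _ _, max_le hT (min_le_right _ _)⟩
  have hxi : IntervalIntegrable (x e) volume 0 (clamp N.T θ) := by
    rw [intervalIntegrable_iff_integrableOn_Ico_of_le hcl.1]
    exact hx.mono_set (Ico_subset_Ico_right hcl.2)
  have hbi : ∀ n : Fin G.size, IntervalIntegrable
      (fun θ => a (.inl (e, n)) * bump h (G.start h (n : ℕ)) θ) volume 0 (clamp N.T θ) := fun n =>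
    ((integrable_bump h _).const_mul _).intervalIntegrable
  unfold X variation
  have hvi : IntervalIntegrable (fun θ => δ * ∑ n : Fin G.size,
      a (.inl (e, n)) * bump h (G.start h (n : ℕ)) θ) volume 0 (clamp N.T θ) :=
    ((integrable_finsetSum _ fun _ _ => (integrable_bump h _).const_mul _).const_mul δ).intervalIntegrable
  rw [intervalIntegral.integral_add hxi hvi, intervalIntegral.integral_const_mul,
    intervalIntegral.integral_finsetSum fun n _ => hbi n]
  congr 2
  refine Finset.sum_congr rfl fun n _ => ?_
  obtain ⟨h1, h2⟩ := start_mem hh hsp n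
  rw [intervalIntegral.integral_const_mul, integral_bump_clamp hT hh h1 h2]

/-- Conservation of the circulation `a` turns the net inflow into a node into storage: pair `a` with the
node function that is the ramp of window `n` at `(v, n)` and zero at the other nodes. -/
theorem net_inflow_eq_storageVariation [Fintype V] (hh : 0 < h)
    (hsp : ∀ i, 4 * h < G.d (i + 1) - G.d i)
    (hcons : ∀ p : Option (V × ℤ) → ℝ, ∑ b, a b * (p (G.tail b) - p (G.head b)) = 0) (v : V) {θ : ℝ}
    (hθ : θ ≤ N.T) :
    ∑ e with N.tgt e = v, ∑ n : Fin G.size, a (.inl (e, n)) * ramp h (G.start h (n : ℕ)) (θ - N.τ e)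
      - ∑ e with N.src e = v, ∑ n : Fin G.size, a (.inl (e, n)) * ramp h (G.start h (n : ℕ)) θ
      = G.storageVariation h a v θ := by
  set p : Option (V × ℤ) → ℝ := fun o => o.elim 0 fun q =>
    if q.1 = v then ramp h (G.start h q.2) θ else 0 with hp
  have hnode : ∀ (w : V) (n : ℤ), p (G.node w n) = if w = v then ramp h (G.start h n) θ else 0 := by
    intro w n
    unfold node
    split_ifs with h1 h2 h2
    · simp [hp, h2]
    · simp [hp, h2]
    · simp only [hp, Option.elim_none]
      rw [ramp_of_le hh (hθ.trans (le_start_of_size_le hh hsp (not_lt.1 h1)))]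
    · rfl
  have hsome : ∀ (w : V) (n : ℤ), p (some (w, n)) = if w = v then ramp h (G.start h n) θ else 0 :=
    fun _ _ => rfl
  have hsum := hcons p
  rw [Fintype.sum_sum_type, Fintype.sum_prod_type, Fintype.sum_prod_type] at hsum
  simp only [tail, head, hsome, hnode, start_add, ramp_add, ← G.τ_eq] at hsum
  have e1 : ∑ e, ∑ n : Fin G.size, a (.inl (e, n)) *
      ((if N.src e = v then ramp h (G.start h (n : ℕ)) θ else 0)
        - if N.tgt e = v then ramp h (G.start h (n : ℕ)) (θ - N.τ e) else 0)
      = ∑ e with N.src e = v, ∑ n : Fin G.size, a (.inl (e, n)) * ramp h (G.start h (n : ℕ)) θ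
      - ∑ e with N.tgt e = v, ∑ n : Fin G.size,
          a (.inl (e, n)) * ramp h (G.start h (n : ℕ)) (θ - N.τ e) := by
    rw [Finset.sum_filter, Finset.sum_filter, ← Finset.sum_sub_distrib]
    refine Finset.sum_congr rfl fun e _ => ?_
    split_ifs <;> simp [mul_sub, Finset.sum_sub_distrib]
  have e2 : ∑ w, ∑ n : Fin G.size, a (.inr (w, n)) *
      ((if w = v then ramp h (G.start h (n : ℕ)) θ else 0)
        - if w = v then ramp h (G.start h ((n : ℕ) + 1)) θ else 0) = G.storageVariation h a v θ := by
    rw [Finset.sum_eq_single v]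
    · simp [storageVariation]
    · intro w _ hw
      simp [hw]
    · simp
  rw [e1, e2] at hsum
  linarith

theorem Y_variation [Fintype V] (hh : 0 < h) (hsp : ∀ i, 4 * h < G.d (i + 1) - G.d i)
    (hcons : ∀ p : Option (V × ℤ) → ℝ, ∑ b, a b * (p (G.tail b) - p (G.head b)) = 0) {δ : ℝ}
    (hx : ∀ e, IntegrableOn (x e) (Ico 0 N.T)) (v : V) {θ : ℝ} (hθ : θ ≤ N.T) :
    N.Y (fun e θ => x e θ + δ * G.variation h a e θ) v θ
      = N.Y x v θ + δ * G.storageVariation h a v θ := by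
  rw [← net_inflow_eq_storageVariation hh hsp hcons v hθ]
  simp only [Y, X_variation hh hsp (hx _), Finset.sum_add_distrib, ← Finset.mul_sum]
  ring

/-- The cost of a bump is the average of the transit cost over its window. -/
theorem integral_cost_variation (hh : 0 < h) (hsp : ∀ i, 4 * h < G.d (i + 1) - G.d i)
    (hc : ∀ e, PiecewiseAnalytic N.T (N.c e)) (e : E) :
    ∫ θ in Ico 0 N.T, N.c e θ * G.variation h a e θ = ∑ n : Fin G.size, a (.inl (e, n)) *
      ((1 / h) * ∫ t in (G.start h (n : ℕ))..(G.start h (n : ℕ) + h), G.C e ((n : ℕ) / 2 : ℤ) t) := by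
  have hci : IntegrableOn (N.c e) (Ico 0 N.T) := by
    rw [← intervalIntegrable_iff_integrableOn_Ico_of_le N.T_pos.le]
    exact (hc e).hasAnalyticGerms.intervalIntegrable N.T_pos.le
  have hcb : ∀ n : Fin G.size, IntegrableOn
      (fun θ => a (.inl (e, n)) * (N.c e θ * bump h (G.start h (n : ℕ)) θ)) (Ico 0 N.T) := fun n =>
    (hci.mul_of_top_left (memLp_bump hh _ _)).const_mul _
  have e1 : ∀ θ, N.c e θ * G.variation h a e θ
      = ∑ n : Fin G.size, a (.inl (e, n)) * (N.c e θ * bump h (G.start h (n : ℕ)) θ) := fun θ => by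
    rw [variation, Finset.mul_sum]
    exact Finset.sum_congr rfl fun n _ => by ring
  simp only [e1]
  rw [integral_finsetSum _ fun n _ => hcb n]
  refine Finset.sum_congr rfl fun n _ => ?_
  rw [integral_const_mul]
  congr 1
  obtain ⟨h1, h2⟩ := start_mem hh hsp n
  have e2 : ∀ θ, N.c e θ * bump h (G.start h (n : ℕ)) θ
      = (Ico (G.start h (n : ℕ)) (G.start h (n : ℕ) + h)).indicator (fun θ => 1 / h * N.c e θ) θ :=
    fun θ => by
      by_cases hθ : θ ∈ Ico (G.start h (n : ℕ)) (G.start h (n : ℕ) + h)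
      · rw [bump, indicator_of_mem hθ, indicator_of_mem hθ, mul_comm]
      · rw [bump, indicator_of_notMem hθ, indicator_of_notMem hθ, mul_zero]
  simp only [e2]
  rw [setIntegral_indicator measurableSet_Ico,
    inter_eq_right.2 (Ico_subset_Ico h1 h2), integral_const_mul,
    intervalIntegral.integral_of_le (by linarith), ← integral_Ico_eq_integral_Ioc]
  congr 1
  refine setIntegral_congr_fun measurableSet_Ico fun θ hθ => ?_
  exact (G.C_eq e _ (div_two_mem n) (Ioo_subset_Ico_self
    (window_subset hh hsp _ (Ico_subset_Icc_self hθ)))).symm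

end Perturbation

/-- Pushing flow along a residual circulation, spread over short windows, keeps an optimal flow
feasible, so the circulation cannot have negative cost. -/
theorem circulation_weight_nonneg [Fintype V] (hopt : N.Optimal x)
    (hc : ∀ e, PiecewiseAnalytic N.T (N.c e)) (hu : ∀ e, PiecewiseAnalytic N.T (N.u e))
    (hb : ∀ v, PiecewiseAnalytic N.T (N.b v)) (hUcont : ∀ v, ContinuousOn (N.U v) (Icc 0 N.T))
    (hearly : ∀ e, ∀ θ ∈ Ico 0 N.T, θ + N.τ e < 0 → N.u e θ = 0)
    (hxa : ∀ e, PiecewiseAnalytic N.T (x e)) {a : G.BaseArc → ℝ}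
    (hpos : ∀ b, 0 < a b → G.Residual (b, false)) (hneg : ∀ b, a b < 0 → G.Residual (b, true))
    (hcons : ∀ p : Option (V × ℤ) → ℝ, ∑ b, a b * (p (G.tail b) - p (G.head b)) = 0) :
    0 ≤ ∑ b, a b * G.weight b := by
  by_contra! hlt
  obtain ⟨hx, hmin⟩ := hopt
  have hxi := fun e => integrableOn_of_memLp (hx.memLp e)
  have hcont := continuousOn_storageSlack hx hb hUcont hearly
  -- the cost of the perturbation tends to the weight of the circulation as the windows shrink
  have hlim : ∀ᶠ h in 𝓝[>] (0 : ℝ), ∑ e, ∑ n : Fin G.size, a (.inl (e, n)) *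
      ((1 / h) * ∫ t in (G.start h (n : ℕ))..(G.start h (n : ℕ) + h), G.C e ((n : ℕ) / 2 : ℤ) t) < 0 := by
    rw [Fintype.sum_sum_type, Fintype.sum_prod_type] at hlt
    simp only [weight, mul_zero, Finset.sum_const_zero, add_zero] at hlt
    refine Tendsto.eventually_lt_const hlt
      (tendsto_finsetSum _ fun e _ => tendsto_finsetSum _ fun n _ => Tendsto.const_mul _ ?_)
    refine tendsto_average_window ?_ _
    refine ((G.C_analytic e _ (div_two_mem n) _ ?_).eventually_analyticAt).mono
      fun _ h => h.continuousAt
    have hd := (d_strictMono (G := G)).monotone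
    exact ⟨hd (by omega), hd (by omega)⟩
  obtain ⟨h, hneg', hsp, hhold, hh⟩ := (hlim.and (eventually_spacing (G := G) |>.and
    ((eventually_hold (G := G) hcont).and self_mem_nhdsWithin))).exists
  replace hh : 0 < h := hh
  have hx0 := hx.nonneg hxa
  have hxu := hx.le_capacity hxa hu
  have hst : ∀ v s, ∀ θ ∈ Icc 0 N.T, 0 ≤ N.storageSlack x v s θ := fun v s θ hθ => by
    cases s
    · exact sub_nonneg.2 (hx.storage v θ hθ).2
    · exact (hx.storage v θ hθ).1
  choose κ hκ0 hκ using variation_dominated hh hsp hx0 hxu hpos hneg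
  choose η hη0 hη using storageVariation_dominated hh hsp hcont hst hhold hpos hneg
  set M : ℝ := 1 + ∑ e, κ e + ∑ v, η v with hM
  have hs1 : 0 ≤ ∑ e, κ e := Finset.sum_nonneg fun e _ => hκ0 e
  have hs2 : 0 ≤ ∑ v, η v := Finset.sum_nonneg fun v _ => hη0 v
  have hM0 : 0 < M := by linarith
  have hκM : ∀ e, κ e ≤ M := fun e => by
    have := Finset.single_le_sum (fun e _ => hκ0 e) (Finset.mem_univ e)
    linarith
  have hηM : ∀ v, η v ≤ M := fun v => by
    have := Finset.single_le_sum (fun v _ => hη0 v) (Finset.mem_univ v)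
    linarith
  have scale : ∀ {z k g : ℝ}, z ≤ k * g → 0 ≤ g → k ≤ M → 1 / M * z ≤ g := fun {z k g} h1 h2 h3 => by
    rw [one_div_mul_eq_div, div_le_iff₀ hM0]
    nlinarith
  set x' : E → ℝ → ℝ := fun e θ => x e θ + 1 / M * G.variation h a e θ with hx'
  have hfeas : N.Feasible x' := by
    refine ⟨fun e => (hx.memLp e).add ((memLp_variation hh e _).const_mul _), fun e => ?_,
      fun v θ hθ => ?_⟩
    · refine (ae_restrict_iff' measurableSet_Ico).2 (Eventually.of_forall fun θ hθ => ?_)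
      have h1 := scale (hκ e θ hθ).1 (sub_nonneg.2 (hxu e θ hθ)) (hκM e)
      have h2 := scale (hκ e θ hθ).2 (hx0 e θ hθ) (hκM e)
      simp only [flowSlack] at h1 h2
      simp only [hx']
      constructor <;> linarith
    · rw [Y_variation hh hsp hcons hxi v hθ.2]
      have h1 := scale (hη v θ hθ).1 (hst v false θ hθ) (hηM v)
      have h2 := scale (hη v θ hθ).2 (hst v true θ hθ) (hηM v)
      simp only [storageSlack] at h1 h2
      constructor <;> linarith
  have hcost : N.cost x' = N.cost x + 1 / M * ∑ e, ∑ n : Fin G.size, a (.inl (e, n)) *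
      ((1 / h) * ∫ t in (G.start h (n : ℕ))..(G.start h (n : ℕ) + h), G.C e ((n : ℕ) / 2 : ℤ) t) := by
    rw [cost_eq hc hx, cost_eq hc hfeas, Finset.mul_sum, ← Finset.sum_add_distrib]
    refine Finset.sum_congr rfl fun e _ => ?_
    have hci : IntegrableOn (N.c e) (Ico 0 N.T) := by
      rw [← intervalIntegrable_iff_integrableOn_Ico_of_le N.T_pos.le]
      exact (hc e).hasAnalyticGerms.intervalIntegrable N.T_pos.le
    have h1 : IntegrableOn (fun θ => N.c e θ * x e θ) (Ico 0 N.T) := hci.mul_of_top_left (hx.memLp e)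
    have h2 : IntegrableOn (fun θ => N.c e θ * G.variation h a e θ) (Ico 0 N.T) :=
      hci.mul_of_top_left (memLp_variation hh e _)
    rw [← integral_cost_variation hh hsp hc, ← integral_const_mul,
      ← integral_add h1 (h2.const_mul _)]
    refine integral_congr_ae (Eventually.of_forall fun θ => ?_)
    simp only [hx']
    ring
  have := hmin x' hfeas
  rw [hcost] at this
  have := mul_neg_of_pos_of_neg (one_div_pos.2 hM0) hneg'
  linarith

/-- tail of an oriented residual arc -/
def resSrc (G : TimeGrid N x) : G.BaseArc × Bool → Option (V × ℤ)
  | (b, false) => G.tail b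
  | (b, true) => G.head b

/-- head of an oriented residual arc -/
def resTgt (G : TimeGrid N x) : G.BaseArc × Bool → Option (V × ℤ)
  | (b, false) => G.head b
  | (b, true) => G.tail b

/-- Node potentials on the windows that are compatible with all residual arcs. -/
structure IsPotential (G : TimeGrid N x) (p : Option (V × ℤ) → ℝ) : Prop where
  sink : p none = 0
  le : ∀ b s, G.Residual (b, s) → p (G.resSrc (b, s)) - p (G.resTgt (b, s)) ≤ dirSign s * G.weight b

/-- By duality in the finite residual network: the alternative to a potential is a circulation of
negative weight. -/
theorem exists_isPotential [Fintype V] (G : TimeGrid N x) (hopt : N.Optimal x)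
    (hc : ∀ e, PiecewiseAnalytic N.T (N.c e)) (hu : ∀ e, PiecewiseAnalytic N.T (N.u e))
    (hb : ∀ v, PiecewiseAnalytic N.T (N.b v)) (hUcont : ∀ v, ContinuousOn (N.U v) (Icc 0 N.T))
    (hearly : ∀ e, ∀ θ ∈ Ico 0 N.T, θ + N.τ e < 0 → N.u e θ = 0)
    (hxa : ∀ e, PiecewiseAnalytic N.T (x e)) : ∃ p, G.IsPotential p := by
  classical
  rcases exists_potential_or_circulation (A := {r : G.BaseArc × Bool // G.Residual r})
    (src := fun r => G.resSrc r) (tgt := fun r => G.resTgt r)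
    (fun r => dirSign r.1.2 * G.weight r.1.1) with ⟨p, hp⟩ | ⟨y, hy0, hycons, hyneg⟩
  · refine ⟨fun i => p i - p none, sub_self _, fun b s hr => ?_⟩
    have := hp ⟨(b, s), hr⟩
    simp only at this ⊢
    linarith
  · exfalso
    set z : G.BaseArc × Bool → ℝ := fun r => if hr : G.Residual r then y ⟨r, hr⟩ else 0 with hz
    have hz0 : ∀ r, 0 ≤ z r := fun r => by
      simp only [hz]
      split_ifs
      exacts [hy0 _, le_rfl]
    have hzr : ∀ r, 0 < z r → G.Residual r := fun r hr => by
      by_contra hcon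
      simp [hz, hcon] at hr
    -- opposite residual arcs cancel, so a residual circulation is a signed circulation of base arcs
    have hsum : ∀ f : G.BaseArc × Bool → ℝ,
        ∑ r : {r // G.Residual r}, y r * f r = ∑ b, (z (b, false) * f (b, false)
          + z (b, true) * f (b, true)) := fun f => by
      have h1 : ∑ r : {r // G.Residual r}, y r * f r = ∑ r : {r // G.Residual r}, z r * f r :=
        Finset.sum_congr rfl fun r _ => by simp [hz, r.2]
      have h2 : ∑ r, z r * f r = ∑ b, (z (b, false) * f (b, false) + z (b, true) * f (b, true)) := by
        rw [Fintype.sum_prod_type]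
        exact Finset.sum_congr rfl fun b _ => by rw [Fintype.sum_bool, add_comm]
      rw [h1, ← h2, ← Finset.sum_subtype (Finset.univ.filter G.Residual) (by simp) (fun r => z r * f r)]
      refine Finset.sum_subset (Finset.filter_subset _ _) fun r _ hr => ?_
      have : ¬G.Residual r := fun h => hr (Finset.mem_filter.2 ⟨Finset.mem_univ r, h⟩)
      simp [hz, this]
    have key : ∀ b, (0 < z (b, false) - z (b, true) → G.Residual (b, false)) ∧
        (z (b, false) - z (b, true) < 0 → G.Residual (b, true)) := fun b =>
      ⟨fun h => hzr _ (by linarith [hz0 (b, true)]), fun h => hzr _ (by linarith [hz0 (b, false)])⟩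
    refine absurd (circulation_weight_nonneg (G := G) (a := fun b => z (b, false) - z (b, true)) hopt hc hu
      hb hUcont hearly hxa (fun b => (key b).1) (fun b => (key b).2) fun p => ?_) (not_le.2 ?_)
    · rw [← hycons p, hsum fun r => p (G.resSrc r) - p (G.resTgt r)]
      refine Finset.sum_congr rfl fun b _ => ?_
      simp only [resSrc, resTgt]
      ring
    · refine lt_of_eq_of_lt ?_ hyneg
      rw [hsum fun r => dirSign r.2 * G.weight r.1]
      refine Finset.sum_congr rfl fun b _ => ?_
      simp only [dirSign]
      ring

end TimeGrid

end FlowNetwork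

/-! ### From node potentials to dual functions -/

namespace FlowNetwork

variable {V E : Type*} {N : FlowNetwork V E} {x : E → ℝ → ℝ}

theorem dualFeasible_rho {π : V → ℝ → ℝ} (hπ : ∀ v, HasAnalyticGerms 0 N.T (π v))
    (hπT : ∀ v, π v N.T = 0) : N.DualFeasible π (N.rho π) where
  reduced e θ _ := by
    have := min_le_right 0 (N.redCost π e θ)
    simp only [rho]
    simp only [redCost] at this ⊢
    linarith
  boundedVariation v := (hπ v).boundedVariationOn N.T_pos.le
  rightCont v θ hθ := (hπ v).continuousWithinAt hθ
  terminal := hπT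
  rho_nonpos _ _ _ := min_le_left _ _

variable [Fintype E] [DecidableEq V]

namespace TimeGrid

variable {G : TimeGrid N x}

theorem d_add_mul_r (i : ℤ) (e : E) : G.d (i + G.r e * G.m) = G.d i + N.τ e := by
  rw [G.d_add, G.τ_eq]

theorem exists_mem_cell (θ : ℝ) : ∃ i, θ ∈ Ico (G.d i) (G.d (i + 1)) := by
  have hm : (0 : ℤ) < G.m := by exact_mod_cast G.m_pos
  have hd : ∀ k : ℤ, G.d (k * G.m) = k * G.Δ := fun k => by
    simpa [G.d_zero] using G.d_add 0 k
  have hΔ : 0 < G.Δ := by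
    have := d_strictMono (G := G) (show (0 : ℤ) < 1 * G.m by omega)
    rw [G.d_zero, hd] at this
    simpa using this
  obtain ⟨i, hi, hmax⟩ := Int.exists_greatest_of_bdd (P := fun i => G.d i ≤ θ)
    ⟨(⌊θ / G.Δ⌋ + 1) * G.m, fun i hi => by
      by_contra! hlt
      have h1 := d_strictMono (G := G) hlt
      rw [hd] at h1
      have h2 := Int.lt_floor_add_one (θ / G.Δ)
      rw [div_lt_iff₀ hΔ] at h2
      push_cast at h1
      linarith⟩
    ⟨⌊θ / G.Δ⌋ * G.m, by
      have h2 := Int.floor_le (θ / G.Δ)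
      rw [le_div_iff₀ hΔ] at h2
      rwa [hd]⟩
  refine ⟨i, hi, ?_⟩
  by_contra! h
  have := hmax _ h
  omega

variable (G) in
/-- index of the cell that contains `θ` -/
noncomputable def cell (θ : ℝ) : ℤ := (exists_mem_cell (G := G) θ).choose

theorem mem_cell (θ : ℝ) : θ ∈ Ico (G.d (G.cell θ)) (G.d (G.cell θ + 1)) :=
  (exists_mem_cell (G := G) θ).choose_spec

theorem cell_eq {θ : ℝ} {i : ℤ} (hθ : θ ∈ Ico (G.d i) (G.d (i + 1))) : G.cell θ = i := by
  have h := mem_cell (G := G) θ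
  have h1 := d_strictMono.lt_iff_lt.1 (h.1.trans_lt hθ.2)
  have h2 := d_strictMono.lt_iff_lt.1 (hθ.1.trans_lt h.2)
  omega

theorem cell_mem {θ : ℝ} (hθ : θ ∈ Ico 0 N.T) : G.cell θ ∈ Ico (0 : ℤ) (G.K * G.m) := by
  have h := mem_cell (G := G) θ
  have h1 := h.1.trans_lt hθ.2
  have h2 := hθ.1.trans_lt h.2
  rw [← G.d_end] at h1
  rw [← G.d_zero] at h2
  have h1 := d_strictMono.lt_iff_lt.1 h1
  have h2 := d_strictMono.lt_iff_lt.1 h2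
  exact ⟨by omega, h1⟩

variable (G) in
/-- Functions on the cells that are compatible with the residual arcs at all times and interpolate the
window potentials `p`. -/
structure CellPotential (p : Option (V × ℤ) → ℝ) where
  /-- the function in node `v` on the cell `i` -/
  val : ℤ → V → ℝ → ℝ
  germs : ∀ i v, HasAnalyticGerms (G.d i) (G.d (i + 1)) (val i v)
  arc : ∀ e s, ∀ i ∈ Ico (0 : ℤ) (G.K * G.m),
    (∀ θ ∈ Ioo (G.d i) (G.d (i + 1)), 0 < N.flowSlack x e s θ) →
    ∀ θ ∈ Icc (G.d i) (G.d (i + 1)),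
      dirSign s * (val i (N.src e) θ - val (i + G.r e * G.m) (N.tgt e) (θ + N.τ e))
        ≤ dirSign s * G.C e i θ
  bounds : ∀ i v, ∀ θ ∈ Icc (G.d i) (G.d (i + 1)),
    min (p (G.node v (2 * i))) (p (G.node v (2 * i + 1))) ≤ val i v θ ∧
      val i v θ ≤ max (p (G.node v (2 * i))) (p (G.node v (2 * i + 1)))
  mono : ∀ i v, p (G.node v (2 * i)) ≤ p (G.node v (2 * i + 1)) →
    MonotoneOn (val i v) (Icc (G.d i) (G.d (i + 1)))
  anti : ∀ i v, p (G.node v (2 * i + 1)) ≤ p (G.node v (2 * i)) →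
    AntitoneOn (val i v) (Icc (G.d i) (G.d (i + 1)))

theorem node_of_lt {v : V} {n : ℕ} (hn : n < G.size) : G.node v n = some (v, (n : ℤ)) :=
  if_pos (by exact_mod_cast hn)

variable {p : Option (V × ℤ) → ℝ}

theorem IsPotential.flow_le (hp : G.IsPotential p) (e : E) (n : Fin G.size) (s : Bool)
    (h : G.Residual (.inl (e, n), s)) :
    dirSign s * (p (G.node (N.src e) (n : ℕ)) - p (G.node (N.tgt e) ((n : ℕ) + 2 * (G.r e * G.m))))
      ≤ dirSign s * G.weight (.inl (e, n)) := by
  have := hp.le _ _ h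
  rw [node_of_lt n.2]
  cases s
  · simpa [resSrc, resTgt, tail, head, dirSign] using this
  · simp only [resSrc, resTgt, tail, head, dirSign] at this ⊢
    linarith

/-- Where storage has slack, potentials are monotone in time; this holds trivially in the sink. -/
theorem IsPotential.hold_le (hp : G.IsPotential p) (v : V) {n : ℤ} (h0 : 0 ≤ n) (s : Bool)
    (h : n < G.size → ∀ θ ∈ G.holdSet n, 0 < N.storageSlack x v s θ) :
    dirSign s * p (G.node v n) ≤ dirSign s * p (G.node v (n + 1)) := by
  rcases lt_or_ge n (G.size : ℤ) with hn | hn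
  · lift n to ℕ using h0
    have hn' : n < G.size := by exact_mod_cast hn
    have := hp.le (.inr (v, ⟨n, hn'⟩)) s (h hn)
    rw [node_of_lt hn']
    cases s <;> simp only [resSrc, resTgt, tail, head, dirSign, weight] at this ⊢ <;> linarith
  · rw [node, node, if_neg (by omega), if_neg (by omega)]

/-- Interpolation of the window potentials on all translates of the cell `j` simultaneously; these cells
are linked only among themselves. The time `σ` runs through the cell `j`, and the function at `(v, i)`
describes the node `v` in the cell `i`. -/
theorem IsPotential.exists_class (hp : G.IsPotential p) {j : ℤ} (hj : j ∈ Ico (0 : ℤ) G.m) :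
    ∃ f : V × ℤ → ℝ → ℝ, (∀ a, HasAnalyticGerms (G.d j) (G.d (j + 1)) (f a)) ∧
      (∀ e s, ∀ k : ℕ, k < G.K →
        (∀ θ ∈ Ioo (G.d (j + k * G.m)) (G.d (j + k * G.m + 1)), 0 < N.flowSlack x e s θ) →
        ∀ σ ∈ Icc (G.d j) (G.d (j + 1)),
          dirSign s * (f (N.src e, j + k * G.m) σ - f (N.tgt e, j + k * G.m + G.r e * G.m) σ)
            ≤ dirSign s * G.C e (j + k * G.m) (σ + k * G.Δ)) ∧
      (∀ a, ∀ θ ∈ Icc (G.d j) (G.d (j + 1)),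
        min (p (G.node a.1 (2 * a.2))) (p (G.node a.1 (2 * a.2 + 1))) ≤ f a θ ∧
          f a θ ≤ max (p (G.node a.1 (2 * a.2))) (p (G.node a.1 (2 * a.2 + 1)))) ∧
      (∀ a, p (G.node a.1 (2 * a.2)) ≤ p (G.node a.1 (2 * a.2 + 1)) →
        MonotoneOn (f a) (Icc (G.d j) (G.d (j + 1)))) ∧
      (∀ a, p (G.node a.1 (2 * a.2 + 1)) ≤ p (G.node a.1 (2 * a.2)) →
        AntitoneOn (f a) (Icc (G.d j) (G.d (j + 1)))) := by
  have hd := (G.d_lt j).le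
  have hcell : ∀ k : ℕ, k < G.K → j + (k : ℤ) * G.m ∈ Ico (0 : ℤ) (G.K * G.m) := fun k hk => by
    have h1 : ((k : ℤ) + 1) * G.m ≤ G.K * G.m :=
      mul_le_mul_of_nonneg_right (by exact_mod_cast hk) (by positivity)
    have h2 : (0 : ℤ) ≤ k * G.m := by positivity
    exact ⟨by linarith [hj.1], by linarith [hj.2]⟩
  set Res : (E × Fin G.K) × Bool → Prop := fun a => ∀ θ ∈ Ioo (G.d (j + (a.1.2 : ℕ) * G.m))
    (G.d (j + (a.1.2 : ℕ) * G.m + 1)), 0 < N.flowSlack x a.1.1 a.2 θ with hRes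
  set u : (E × Fin G.K) × Bool → V × ℤ := fun a => (N.src a.1.1, j + (a.1.2 : ℕ) * G.m) with hu
  set w : (E × Fin G.K) × Bool → V × ℤ := fun a =>
    (N.tgt a.1.1, j + (a.1.2 : ℕ) * G.m + G.r a.1.1 * G.m) with hw
  have key : ∀ (a : (E × Fin G.K) × Bool) (g : V × ℤ → ℝ),
      g (if a.2 then w a else u a) - g (if a.2 then u a else w a) = dirSign a.2 * (g (u a) - g (w a)) := by
    rintro ⟨a, _ | _⟩ g <;> simp [dirSign]
  -- the window potentials are feasible for the costs at the two ends of the cells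
  have hwin : ∀ a, Res a → ∀ t : ℤ, t = 0 ∨ t = 1 →
      dirSign a.2 * (p (G.node (u a).1 (2 * (u a).2 + t)) - p (G.node (w a).1 (2 * (w a).2 + t))) ≤
        dirSign a.2 * G.C a.1.1 (j + (a.1.2 : ℕ) * G.m) (G.d (j + t) + (a.1.2 : ℕ) * G.Δ) := by
    rintro ⟨⟨e, k⟩, s⟩ ha t ht
    have hk := hcell k k.2
    obtain ⟨n, hn⟩ : ∃ n : ℕ, (n : ℤ) = 2 * (j + (k : ℕ) * G.m) + t :=
      ⟨(2 * (j + (k : ℕ) * G.m) + t).toNat, Int.toNat_of_nonneg (by have := hk.1; omega)⟩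
    have hns : n < G.size := by
      have h1 := hk.2
      have h2 : (n : ℤ) < 2 * (G.K * G.m) := by omega
      exact_mod_cast h2
    have hn2 : (n : ℤ) / 2 = j + (k : ℕ) * G.m := by omega
    have := hp.flow_le e ⟨n, hns⟩ s (by
      simp only [Residual, hn2]
      exact ha)
    simp only [weight, hn2] at this
    rw [show ((n : ℤ) + 1) / 2 = j + t + (k : ℕ) * G.m by omega, G.d_add, hn] at this
    simp only [hu, hw]
    rw [Int.cast_natCast] at this
    rw [show 2 * (j + (k : ℕ) * G.m + G.r e * G.m) + t
      = 2 * (j + (k : ℕ) * G.m) + t + 2 * (G.r e * G.m) by ring]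
    exact this
  obtain ⟨f, h1, h2, h3, h4, h5⟩ := exists_interpolated_potential (A := {a // Res a})
    (src := fun a => if a.1.2 then w a else u a) (tgt := fun a => if a.1.2 then u a else w a)
    (c := fun a σ => dirSign a.1.2 * G.C a.1.1.1 (j + (a.1.1.2 : ℕ) * G.m) (σ + (a.1.1.2 : ℕ) * G.Δ))
    hd (p₀ := fun b => p (G.node b.1 (2 * b.2))) (p₁ := fun b => p (G.node b.1 (2 * b.2 + 1)))
    (by
      intro a σ hσ
      refine analyticAt_const.mul ((G.C_analytic _ _ (hcell _ a.1.1.2.2) _ ?_).comp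
        (f := fun σ => σ + (a.1.1.2 : ℕ) * G.Δ) (analyticAt_id.add analyticAt_const))
      have e1 := G.d_add j (a.1.1.2 : ℕ)
      have e2 := G.d_add (j + 1) (a.1.1.2 : ℕ)
      rw [add_right_comm] at e2
      push_cast at e1 e2
      rw [e1, e2]
      exact ⟨by linarith [hσ.1], by linarith [hσ.2]⟩)
    (by
      intro l hl
      have := G.C_mono j hj (l.map Subtype.val) (hl.map Subtype.val_injective)
      simpa [List.map_map, Function.comp_def] using this)
    (by
      intro a
      rw [key a.1 fun b => p (G.node b.1 (2 * b.2))]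
      simpa using hwin a.1 a.2 0 (.inl rfl))
    (by
      intro a
      rw [key a.1 fun b => p (G.node b.1 (2 * b.2 + 1))]
      exact hwin a.1 a.2 1 (.inr rfl))
  refine ⟨f, h1, fun e s k hk hs σ hσ => ?_, h3, h4, h5⟩
  have := h2 ⟨((e, ⟨k, hk⟩), s), hs⟩ σ hσ
  rw [key _ fun b => f b σ] at this
  exact this

theorem IsPotential.nonempty_cellPotential (hp : G.IsPotential p) : Nonempty (G.CellPotential p) := by
  have hm : (0 : ℤ) < G.m := by exact_mod_cast G.m_pos
  have hmod : ∀ i : ℤ, i % G.m ∈ Ico (0 : ℤ) G.m := fun i =>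
    ⟨Int.emod_nonneg _ hm.ne', Int.emod_lt_of_pos _ hm⟩
  have hi : ∀ i : ℤ, i % G.m + i / G.m * G.m = i := fun i => Int.emod_add_ediv_mul i G.m
  have hd : ∀ i : ℤ, G.d i = G.d (i % G.m) + (i / G.m : ℤ) * G.Δ := fun i => by
    rw [← G.d_add, hi]
  have hd' : ∀ i : ℤ, G.d (i + 1) = G.d (i % G.m + 1) + (i / G.m : ℤ) * G.Δ := fun i => by
    rw [← G.d_add, add_right_comm, hi]
  choose! f h1 h2 h3 h4 h5 using fun j (hj : j ∈ Ico (0 : ℤ) G.m) => hp.exists_class hj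
  have hshift : ∀ {i : ℤ} {θ : ℝ}, θ ∈ Icc (G.d i) (G.d (i + 1)) →
      θ - (i / G.m : ℤ) * G.Δ ∈ Icc (G.d (i % G.m)) (G.d (i % G.m + 1)) := fun {i θ} hθ => by
    rw [hd, hd'] at hθ
    exact ⟨by linarith [hθ.1], by linarith [hθ.2]⟩
  refine ⟨⟨fun i v θ => f (i % G.m) (v, i) (θ - (i / G.m : ℤ) * G.Δ), fun i v => ?_,
    fun e s i hiK hs θ hθ => ?_, fun i v θ hθ => h3 _ (hmod i) (v, i) _ (hshift hθ),
    fun i v h θ hθ θ' hθ' hle => h4 _ (hmod i) (v, i) h (hshift hθ) (hshift hθ') (by linarith),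
    fun i v h θ hθ θ' hθ' hle => h5 _ (hmod i) (v, i) h (hshift hθ) (hshift hθ') (by linarith)⟩⟩
  · have := h1 _ (hmod i) (v, i)
    have e1 : G.d (i % G.m) = G.d i + -((i / G.m : ℤ) * G.Δ) := by rw [hd i]; ring
    have e2 : G.d (i % G.m + 1) = G.d (i + 1) + -((i / G.m : ℤ) * G.Δ) := by rw [hd' i]; ring
    rw [e1, e2] at this
    have := this.comp_add (-((i / G.m : ℤ) * G.Δ))
    simpa [← sub_eq_neg_add] using this
  · have hk0 : 0 ≤ i / (G.m : ℤ) := Int.ediv_nonneg hiK.1 hm.le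
    obtain ⟨k, hk⟩ : ∃ k : ℕ, (k : ℤ) = i / G.m := ⟨(i / G.m).toNat, Int.toNat_of_nonneg hk0⟩
    have hkK : k < G.K := by
      have := Int.ediv_lt_of_lt_mul hm hiK.2
      rw [← hk] at this
      exact_mod_cast this
    have := h2 _ (hmod i) e s k hkK (by rwa [hk, hi]) _ (hshift hθ)
    have e1 : (i + G.r e * G.m) % (G.m : ℤ) = i % G.m := Int.add_mul_emod_self_right _ _ _
    have e2 : (i + G.r e * G.m) / (G.m : ℤ) = i / G.m + G.r e := Int.add_mul_ediv_right _ _ hm.ne'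
    have e3 : θ + N.τ e - ((i / G.m + G.r e : ℤ) : ℝ) * G.Δ = θ - (i / G.m : ℤ) * G.Δ := by
      rw [G.τ_eq]
      push_cast
      ring
    have e4 : (k : ℝ) = ((i / G.m : ℤ) : ℝ) := by exact_mod_cast congrArg (Int.cast : ℤ → ℝ) hk
    simp only [e1, e2, e3]
    rw [hk, hi, e4, sub_add_cancel] at this
    exact this

namespace CellPotential

variable (P : G.CellPotential p)

/-- The dual function that is given by the function of the cell at each time. -/
noncomputable def glue (v : V) (θ : ℝ) : ℝ := P.val (G.cell θ) v θ

variable {P}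

theorem glue_eq {v : V} {i : ℤ} {θ : ℝ} (hθ : θ ∈ Ico (G.d i) (G.d (i + 1))) :
    P.glue v θ = P.val i v θ := by
  rw [glue, cell_eq hθ]

theorem hasAnalyticGerms_glue (v : V) (a b : ℝ) : HasAnalyticGerms a b (P.glue v) := by
  have hcell : ∀ i, HasAnalyticGerms (G.d i) (G.d (i + 1)) (P.glue v) := fun i =>
    (P.germs i v).congr fun θ hθ => (glue_eq hθ).symm
  refine ⟨fun t _ => (hcell _).right t (mem_cell t), fun t _ => ?_⟩
  obtain ⟨i, hi⟩ : ∃ i, t ∈ Ioc (G.d i) (G.d (i + 1)) := by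
    have h := mem_cell (G := G) t
    rcases h.1.lt_or_eq with h1 | h1
    · exact ⟨_, h1, h.2.le⟩
    · refine ⟨G.cell t - 1, ?_, ?_⟩
      · exact (d_strictMono (by omega)).trans_le h.1
      · rw [sub_add_cancel, h1]
  exact (hcell i).left t hi

/-- From time `T` on all windows belong to the sink. -/
theorem glue_eq_zero (hp : G.IsPotential p) (v : V) {θ : ℝ} (hθ : N.T ≤ θ) : P.glue v θ = 0 := by
  have h := mem_cell (G := G) θ
  have h1 := hθ.trans_lt h.2
  rw [← G.d_end] at h1
  have h1 := d_strictMono.lt_iff_lt.1 h1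
  have hn : ∀ n : ℤ, 2 * G.cell θ ≤ n → p (G.node v n) = 0 := fun n hn => by
    rw [node, if_neg (by simp only [size]; push_cast; omega), hp.sink]
  have := P.bounds _ v θ (Ico_subset_Icc_self h)
  rw [hn _ le_rfl, hn _ (by omega), min_self, max_self] at this
  exact le_antisymm this.2 this.1

theorem glue_clamp (hp : G.IsPotential p) (v : V) {θ : ℝ} (hθ : 0 ≤ θ) :
    P.glue v (clamp N.T θ) = P.glue v θ := by
  rcases le_total θ N.T with h | h
  · rw [show clamp N.T θ = θ by simp [clamp, h, hθ]]
  · rw [show clamp N.T θ = N.T by simp [clamp, h, N.T_pos.le], glue_eq_zero hp v le_rfl,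
      glue_eq_zero hp v h]

/-- If the flow on `e` can be increased (`s = false`) or decreased (`s = true`), the reduced cost is
nonnegative or nonpositive. Arrival before time `0` is excluded because `clamp` would then evaluate the
potential of the target at a time other than that of arrival. -/
theorem redCost_glue (hp : G.IsPotential p) {e : E} {s : Bool} {θ : ℝ} (hθ : θ ∈ Ico 0 N.T)
    (hτ : 0 ≤ θ + N.τ e) (hs : ∀ t ∈ Ioo (G.d (G.cell θ)) (G.d (G.cell θ + 1)),
      0 < N.flowSlack x e s t) : 0 ≤ dirSign s * N.redCost P.glue e θ := by
  have h := mem_cell (G := G) θ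
  have h1 := P.arc e s _ (cell_mem hθ) hs θ (Ico_subset_Icc_self h)
  rw [G.C_eq e _ (cell_mem hθ) h] at h1
  rw [redCost, glue_clamp hp _ hτ, glue_eq h, glue_eq (i := G.cell θ + G.r e * G.m)]
  · linarith
  · rw [add_right_comm, d_add_mul_r, d_add_mul_r]
    exact ⟨by linarith [h.1], by linarith [h.2]⟩

theorem signed_monotoneOn {v : V} {s : Bool} {i : ℤ}
    (h : dirSign s * p (G.node v (2 * i)) ≤ dirSign s * p (G.node v (2 * i + 1))) :
    MonotoneOn (fun θ => dirSign s * P.val i v θ) (Icc (G.d i) (G.d (i + 1))) ∧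
      ∀ θ ∈ Icc (G.d i) (G.d (i + 1)), dirSign s * p (G.node v (2 * i)) ≤ dirSign s * P.val i v θ ∧
        dirSign s * P.val i v θ ≤ dirSign s * p (G.node v (2 * i + 1)) := by
  have hb := P.bounds i v
  cases s
  · simp only [dirSign, one_mul] at h ⊢
    rw [min_eq_left h, max_eq_right h] at hb
    exact ⟨P.mono i v h, hb⟩
  · simp only [dirSign, neg_one_mul, neg_le_neg_iff] at h ⊢
    rw [min_eq_right h, max_eq_left h] at hb
    exact ⟨fun a ha b hb hab => neg_le_neg (P.anti i v h ha hb hab), fun θ hθ => (hb θ hθ).symm⟩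

theorem slack_of_mem_cell {v : V} {s : Bool} {i : ℤ} (hi : i ∈ Ico (0 : ℤ) (G.K * G.m)) {θ : ℝ}
    (hθ : θ ∈ Ioo (G.d i) (G.d (i + 1))) (hs : 0 < N.storageSlack x v s θ) :
    ∀ t ∈ G.holdSet (2 * i), 0 < N.storageSlack x v s t := by
  rw [holdSet, if_pos (by omega), show 2 * i / 2 = i by omega]
  cases s
  · rcases G.U_sign v i hi with h | h
    · exact absurd (h θ hθ) (sub_pos.1 hs).ne
    · exact fun t ht => sub_pos.2 (h t ht)
  · rcases G.Y_sign v i hi with h | h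
    · exact absurd (h θ hθ) (ne_of_gt hs)
    · exact h

/-- Near a time at which storage has slack, the dual function is monotone: on each cell that has slack
inside, and across a grid point that has slack, because the window potentials are. -/
theorem exists_signed_monotoneOn_glue (hp : G.IsPotential p)
    (hcont : ∀ v s, ContinuousOn (N.storageSlack x v s) (Icc 0 N.T)) {v : V} {s : Bool} {θ : ℝ}
    (hθ : θ ∈ Icc 0 N.T) (hs : 0 < N.storageSlack x v s θ) :
    ∃ l < θ, ∃ r > θ, MonotoneOn (fun t => dirSign s * P.glue v t) (Icc l r ∩ Icc 0 N.T) := by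
  have hd := d_strictMono (G := G)
  have hcellmono : ∀ i : ℤ, 0 ≤ i → (i < G.K * G.m →
      ∃ t ∈ Ioo (G.d i) (G.d (i + 1)), 0 < N.storageSlack x v s t) →
      dirSign s * p (G.node v (2 * i)) ≤ dirSign s * p (G.node v (2 * i + 1)) := fun i h0 h =>
    hp.hold_le v (by omega) s fun hn => by
      have hi : i < G.K * G.m := by
        simp only [size] at hn
        push_cast at hn
        omega
      obtain ⟨t, ht, hpos⟩ := h hi
      exact slack_of_mem_cell ⟨h0, hi⟩ ht hpos
  set i := G.cell θ with hi
  have hmem : θ ∈ Ico (G.d i) (G.d (i + 1)) := mem_cell θ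
  have hi0 : 0 ≤ i := by
    have h2 := hθ.1.trans_lt hmem.2
    rw [← G.d_zero] at h2
    have := hd.lt_iff_lt.1 h2
    omega
  have hiK : i ≤ G.K * G.m := by
    have h2 := hmem.1.trans hθ.2
    rw [← G.d_end] at h2
    exact hd.le_iff_le.1 h2
  have hr : θ < (θ + G.d (i + 1)) / 2 := by linarith [hmem.2]
  have hr' : (θ + G.d (i + 1)) / 2 < G.d (i + 1) := by linarith [hmem.2]
  rcases hmem.1.lt_or_eq with hlt | heq
  · obtain ⟨hm, -⟩ := signed_monotoneOn (P := P) (hcellmono i hi0 fun _ => ⟨θ, ⟨hlt, hmem.2⟩, hs⟩)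
    refine ⟨G.d i, hlt, _, hr, fun a ha b hb hab => ?_⟩
    have ha' : a ∈ Ico (G.d i) (G.d (i + 1)) := ⟨ha.1.1, ha.1.2.trans_lt hr'⟩
    have hb' : b ∈ Ico (G.d i) (G.d (i + 1)) := ⟨hb.1.1, hb.1.2.trans_lt hr'⟩
    simp only [glue_eq ha', glue_eq hb']
    exact hm (Ico_subset_Icc_self ha') (Ico_subset_Icc_self hb') hab
  · have hev := (hcont v s θ hθ).eventually (lt_mem_nhds hs)
    obtain ⟨ε, hε, hball⟩ := Metric.mem_nhdsWithin_iff.1 hev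
    obtain ⟨hm, hb1⟩ := signed_monotoneOn (P := P) (hcellmono i hi0 fun hlt => by
      obtain ⟨t, ht1, ht2⟩ := exists_between (lt_min hmem.2 (lt_add_of_pos_right θ hε))
      have htc : t ∈ Ioo (G.d i) (G.d (i + 1)) := ⟨heq.trans_lt ht1, ht2.trans_le (min_le_left _ _)⟩
      refine ⟨t, htc, hball ⟨?_, ?_⟩⟩
      · rw [Metric.mem_ball, Real.dist_eq, abs_lt]
        have := ht2.trans_le (min_le_right _ _)
        constructor <;> linarith
      · exact Ico_subset_Icc_self (cell_subset ⟨hi0, hlt⟩ (Ioo_subset_Ico_self htc)))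
    have hl : G.d (i - 1) < θ := heq ▸ hd (by omega)
    have hleft : ∀ {a : ℝ}, a ∈ Icc (G.d (i - 1)) ((θ + G.d (i + 1)) / 2) ∩ Icc 0 N.T → a < θ →
        a ∈ Ico (G.d (i - 1)) (G.d (i - 1 + 1)) ∧ 0 < i := fun {a} ha h => by
      refine ⟨⟨ha.1.1, by rw [sub_add_cancel, heq]; exact h⟩, ?_⟩
      by_contra! h'
      have := ha.2.1
      rw [h'.antisymm hi0, G.d_zero] at heq
      linarith
    have hright : ∀ {a : ℝ}, a ∈ Icc (G.d (i - 1)) ((θ + G.d (i + 1)) / 2) ∩ Icc 0 N.T → θ ≤ a →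
        a ∈ Ico (G.d i) (G.d (i + 1)) := fun {a} ha h => ⟨heq.trans_le h, ha.1.2.trans_lt hr'⟩
    have hprev : 0 < i → dirSign s * p (G.node v (2 * (i - 1))) ≤
        dirSign s * p (G.node v (2 * (i - 1) + 1)) := fun h0 => hcellmono _ (by omega) fun hlt => by
      obtain ⟨t, ht1, ht2⟩ := exists_between (max_lt hl (sub_lt_self θ hε))
      have htc : t ∈ Ioo (G.d (i - 1)) (G.d (i - 1 + 1)) :=
        ⟨(le_max_left _ _).trans_lt ht1, by rwa [sub_add_cancel, heq]⟩
      refine ⟨t, htc, hball ⟨?_, ?_⟩⟩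
      · rw [Metric.mem_ball, Real.dist_eq, abs_lt]
        have := (le_max_right _ _).trans_lt ht1
        constructor <;> linarith
      · exact Ico_subset_Icc_self (cell_subset ⟨by omega, hlt⟩ (Ioo_subset_Ico_self htc))
    refine ⟨G.d (i - 1), hl, _, hr, fun a ha b hb hab => ?_⟩
    rcases lt_or_ge b θ with h2 | h2
    · obtain ⟨ha', h0⟩ := hleft ha (hab.trans_lt h2)
      obtain ⟨hb', -⟩ := hleft hb h2
      simp only [glue_eq ha', glue_eq hb']
      exact (signed_monotoneOn (hprev h0)).1 (Ico_subset_Icc_self ha') (Ico_subset_Icc_self hb') hab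
    have hb' := hright hb h2
    rcases lt_or_ge a θ with h1 | h1
    · obtain ⟨ha', h0⟩ := hleft ha h1
      simp only [glue_eq ha', glue_eq hb']
      have hjump := hp.hold_le v (n := 2 * (i - 1) + 1) (by omega) s fun _ => by
        rw [holdSet, if_neg (by omega), show (2 * (i - 1) + 1) / 2 + 1 = i by omega]
        rintro _ rfl
        rwa [heq]
      rw [show 2 * (i - 1) + 1 + 1 = 2 * i by ring] at hjump
      exact (((signed_monotoneOn (P := P) (hprev h0)).2 a (Ico_subset_Icc_self ha')).2.trans
        hjump).trans (hb1 b (Ico_subset_Icc_self hb')).1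
    · have ha' := hright ha h1
      simp only [glue_eq ha', glue_eq hb']
      exact hm (Ico_subset_Icc_self ha') (Ico_subset_Icc_self hb') hab

end CellPotential

end TimeGrid

theorem TimeGrid.CellPotential.complementarySlack_glue {G : TimeGrid N x} {p : Option (V × ℤ) → ℝ}
    (P : G.CellPotential p) (hp : G.IsPotential p) (hx : N.Feasible x)
    (hu : ∀ e, PiecewiseAnalytic N.T (N.u e))
    (hb : ∀ v, PiecewiseAnalytic N.T (N.b v)) (hUcont : ∀ v, ContinuousOn (N.U v) (Icc 0 N.T))
    (hearly : ∀ e, ∀ θ ∈ Ico 0 N.T, θ + N.τ e < 0 → N.u e θ = 0)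
    (hxa : ∀ e, PiecewiseAnalytic N.T (x e)) : N.ComplementarySlack x P.glue := by
  have hcont := TimeGrid.continuousOn_storageSlack hx hb hUcont hearly
  have hbv : ∀ v, BoundedVariationOn (P.glue v) (Icc 0 N.T) := fun v =>
    (P.hasAnalyticGerms_glue v 0 N.T).boundedVariationOn N.T_pos.le
  have hx0 := hx.nonneg hxa
  have hxu := hx.le_capacity hxa hu
  refine ⟨fun e θ hθ h => ?_, fun e θ hθ h => ?_, fun v θ hθ h => ?_, fun v θ hθ h => ?_⟩
  · rcases G.x_sign e _ (TimeGrid.cell_mem hθ) with h1 | h1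
    · exact h1 θ (TimeGrid.mem_cell θ)
    rcases lt_or_ge (θ + N.τ e) 0 with h2 | h2
    · exact le_antisymm ((hxu e θ hθ).trans_eq (hearly e θ hθ h2)) (hx0 e θ hθ)
    · have := P.redCost_glue hp (s := true) hθ h2 h1
      simp only [dirSign] at this
      linarith
  · rcases G.u_sign e _ (TimeGrid.cell_mem hθ) with h1 | h1
    · exact h1 θ (TimeGrid.mem_cell θ)
    rcases lt_or_ge (θ + N.τ e) 0 with h2 | h2
    · have h3 := hearly e θ hθ h2
      exact le_antisymm (hxu e θ hθ) (h3.trans_le (hx0 e θ hθ))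
    · have := P.redCost_glue hp (s := false) hθ h2 fun t ht => sub_pos.2 (h1 t ht)
      simp only [dirSign] at this
      linarith
  · by_contra hY
    have hpos : 0 < N.storageSlack x v true θ := lt_of_le_of_ne (hx.storage v θ hθ).1 (Ne.symm hY)
    obtain ⟨l, hl, r, hr, hm⟩ := P.exists_signed_monotoneOn_glue hp hcont hθ hpos
    refine not_strictIncAt_of_antitoneOn N.T_pos (hbv v) hθ hl hr (fun a ha b hb hab => ?_) h
    have := hm ha hb hab
    simp only [dirSign] at this
    linarith
  · by_contra hY
    have hpos : 0 < N.storageSlack x v false θ :=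
      sub_pos.2 (lt_of_le_of_ne (hx.storage v θ hθ).2 hY)
    obtain ⟨l, hl, r, hr, hm⟩ := P.exists_signed_monotoneOn_glue hp hcont hθ hpos
    refine not_strictDecAt_of_monotoneOn N.T_pos (hbv v) hθ hl hr (fun a ha b hb hab => ?_) h
    have := hm ha hb hab
    simp only [dirSign] at this
    linarith

end FlowNetwork

theorem theorem6 {V E : Type*} [Fintype V] [DecidableEq V] [Fintype E] (N : FlowNetwork V E)
    (hT : ∃ q : ℚ, (q : ℝ) = N.T)
    (hτ : ∀ e, ∃ q : ℚ, (q : ℝ) = N.τ e)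
    (hc : ∀ e, PiecewiseAnalytic N.T (N.c e))
    (hu : ∀ e, PiecewiseAnalytic N.T (N.u e))
    (hb : ∀ v, PiecewiseAnalytic N.T (N.b v))
    (hU : ∀ v, PiecewiseAnalytic N.T (N.U v))
    (hUcont : ∀ v, ContinuousOn (N.U v) (Icc 0 N.T))
    (hearly : ∀ e, ∀ θ ∈ Ico 0 N.T, θ + N.τ e < 0 → N.u e θ = 0)
    (x : E → ℝ → ℝ) (hxfeas : N.Feasible x) (hx : ∀ e, PiecewiseAnalytic N.T (x e)) :
    N.Optimal x ↔
      ∃ π : V → ℝ → ℝ, (∀ v, PiecewiseAnalytic N.T (π v)) ∧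
        N.DualFeasible π (N.rho π) ∧ N.ComplementarySlack x π := by
  refine ⟨fun hopt => ?_, fun ⟨π, hπ, hdual, hcs⟩ => ⟨hxfeas, fun x' hx' => ?_⟩⟩
  · obtain ⟨G⟩ := FlowNetwork.exists_timeGrid hT hτ hc hu hb hU hearly hxfeas hx
    obtain ⟨p, hp⟩ := G.exists_isPotential hopt hc hu hb hUcont hearly hx
    obtain ⟨P⟩ := hp.nonempty_cellPotential
    have hg := fun v => P.hasAnalyticGerms_glue v 0 N.T
    exact ⟨P.glue, fun v => (hg v).piecewiseAnalytic N.T_pos.le,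
      FlowNetwork.dualFeasible_rho hg fun v => P.glue_eq_zero hp v le_rfl,
      P.complementarySlack_glue hp hxfeas hu hb hUcont hearly hx⟩
  · exact FlowNetwork.cost_le_of_complementarySlack hc hearly hxfeas
      (fun v => (hπ v).hasAnalyticGerms) hdual.terminal hcs hx'
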